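/- **Objects.** Write $[m]=\{1,\dots,m\}$. For a finite set $I$ of integers let $\lambda_I$ be the order-preserving bijection from $[|I|]$ to $I$; for a tree $\tau$ with integer leaf labels, $\lambda(\tau)$ is obtained by replacing each leaf label $i$ by $\lambda(i)$. A *well-labelled path* of size $n\ge 1$ is a pair $(\mathbf p,\sigma)$ of a word $\mathbf p=p_1\cdots p_{n-1}$ on $\{-1,0,1\}$ and a permutation $\sigma=\sigma_1\cdots\sigma_n$ of $[n]$ such that $p_i=-1$ implies $\sigma_i<\sigma_{i+1}$ and $p_i=1$ implies $\sigma_i>\sigma_{i+1}$. It is *positive* if $\sum_{i\le j}p_i\ge 0$ for all $j\le n-1$, and *Motzkin* if $\sum_{i\le j}p_i\ge0$ for all $j\le n-2$ and $\sum_{i\le n-1}p_i=-1$. A *horizontal step* is a letter $0$ of $\mathbf p$. A *labelled binary tree* of size $n\geq 1$ is a rooted tree with $n$ leaves, bearing the $n$ different labels of $[n]$, in which each (unlabelled) internal vertex has exactly two unordered children. A *marked* labelled binary tree is one in which exactly one vertex (internal or leaf, possibly the root) is marked. A leaf of a marked tree is *quasi-single* if it is not marked and it has a sibling which is marked or internal.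 A *matching* on $[2n]$ is a fixed-point free involution $\pi$ of $[2n]$; its pairs are the $\{i,\pi(i)\}$. **The map $\Phi$** (from well-labelled Motzkin paths to labelled binary trees of the same size). For the unique path with $p_1=-1$ (it has size $2$), $\Phi$ is the tree with two leaves. If $p_1=0$, let $J=[n]\setminus\{\sigma_1\}$, $\mathbf p'=p_2\cdots p_{n-1}$, $\sigma'_i=\lambda_J^{-1}(\sigma_{i+1})$ $(1\le i\le n-1)$; then $\Phi(\mathbf p,\sigma)$ has as its two root subtrees the leaf $\sigma_1$ and $\lambda_J(\Phi(\mathbf p',\sigma'))$. If $p_1=1$, let $k$ be the least integer $\geq 1$ with $\sum_{i=1}^kp_i=0$, and put $$I'=\{\sigma_1,\dots,\sigma_k\},\quad I''=\{\sigma_{k+1},\dots,\sigma_n\},\quad p'_i=-p_{k-i}\ (1\le i\le k-1),\quad p''_i=p_{k+i}\ (1\le i\le n-k-1),$$ $$\sigma'_i=\lambda_{I'}^{-1}(\sigma_{k+1-i})\ (1\le i\le k),\quad \sigma''_i=\lambda_{I''}^{-1}(\sigma_{k+i})\ (1\le i\le n-k);\qquad(*)$$ then $\Phi(\mathbf p,\sigma)$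 has root subtrees $\lambda_{I'}(\Phi(\mathbf p',\sigma'))$ and $\lambda_{I''}(\Phi(\mathbf p'',\sigma''))$. **The map $\Phi'$** (from well-labelled positive paths to marked labelled binary trees of the same size). The path of size $1$ is sent to the one-vertex tree with its vertex marked. If $n>1$ and $p_1=0$, then, with $J,\mathbf p',\sigma'$ as for $\Phi$, $\Phi'(\mathbf p,\sigma)$ has a non-marked root and root subtrees the non-marked leaf $\sigma_1$ and the marked tree $\lambda_J(\Phi'(\mathbf p',\sigma'))$. If $n>1$ and $p_1=1$, let $k\le n$ be the greatest integer such that $\sum_{i=1}^{j-1}p_i\ge1$ for $2\le j\le k-1$ and $\sum_{i=1}^{k-1}p_i=1$, and define $I',I'',\mathbf p',\mathbf p'',\sigma',\sigma''$ by $(*)$. If $k=n$, then $\Phi'(\mathbf p,\sigma)$ is $\Phi(\mathbf p',\sigma')$ with its root marked. If $k<n$, then $\Phi'(\mathbf p,\sigma)$ has a non-marked root, with root subtrees the non-marked tree $\lambda_{I'}(\Phi(\mathbf p',\sigma'))$ and the marked tree $\lambda_{I''}(\Phi'(\mathbf p'',\sigma''))$. **The map $\Psi'$** (from marked labelled binary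 trees of size $n$ to matchings on $[2n]$). Let $\tau'$ be a marked labelled binary tree of size $n$ and $\tau$ the tree without its mark. Attribute the labels $n+1,n+2,\dots,2n-2$, in this order, to the internal non-root vertices of $\tau$: at each step, among the unlabelled non-root vertices with both children labelled, the one having the child with least label receives the next label. Let $\pi=\Psi(\tau)$ be the matching on $[2n-2]$ that pairs the labels of siblings. If the root of $\tau'$ is marked, $\pi'=\Psi'(\tau')$ consists of the pairs of $\pi$ and $\{2n-1,2n\}$. Otherwise let $k$ be the label of the marked vertex and $l$ that of its sibling; $\pi'$ is obtained from $\pi$ by replacing the pair $\{k,l\}$ by the two pairs $\{k,2n\}$ and $\{l,2n-1\}$. **Theorem.** For all integers $n\ge1$ and $k\ge0$, the map $\Phi'$ restricts to a bijection from the set of well-labelled positive paths of size $n$ with $k$ horizontal steps onto the set of marked labelled binary trees with $n$ leaves, exactly $k$ of which are quasi-single; and the map $\Psi'$ restricts to a bijection from the latter set onto the set of matchings on $[2n]$ having exactly $k$ pairs $\{i,j\}$ with $i\in\{1,\dots,n\}$ and $j\in\{n+1,\dots,2n-1\}$. -/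

import Mathlib

/-! ### Well-labelled paths -/

/-- A word `p = p₁ … p_{n-1}` together with a word `σ = σ₁ … σ_n`; list position `i` (from `0`)
holds the letter of index `i + 1`. -/
structure LabelledPath where
  steps : List ℤ
  labels : List ℕ

namespace LabelledPath

/-- `(p, σ)` is a well-labelled path of size `n`: `p` is a word of length `n - 1` (so `n ≥ 1`) on
`{-1, 0, 1}`, `σ` is a permutation of `{1, …, n}`, ascending along steps `-1` and descending along
steps `1`. -/
structure IsWellLabelled (P : LabelledPath) (n : ℕ) : Prop where
  length_steps : P.steps.length + 1 = n
  alphabet : ∀ s ∈ P.steps, s = -1 ∨ s = 0 ∨ s = 1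
  perm : P.labels.Perm (List.range' 1 n)
  ascent : ∀ (i : ℕ) (hp : i < P.steps.length) (hs : i + 1 < P.labels.length),
    P.steps[i] = -1 → P.labels[i] < P.labels[i + 1]
  descent : ∀ (i : ℕ) (hp : i < P.steps.length) (hs : i + 1 < P.labels.length),
    P.steps[i] = 1 → P.labels[i + 1] < P.labels[i]

/-- All partial sums of the word of steps are nonnegative. -/
def IsPositive (P : LabelledPath) : Prop :=
  ∀ j ≤ P.steps.length, 0 ≤ (P.steps.take j).sum

/-- The number of letters `0`. -/
def horizontalSteps (P : LabelledPath) : ℕ := P.steps.count 0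

end LabelledPath

/-! ### Binary trees -/

/-- Plane binary trees. Every vertex may be marked, leaves carry a label, and internal vertices may
carry a label (they do so only during the labelling procedure used by `psi`). -/
inductive PlaneTree : Type
  | leaf (marked : Bool) (label : ℕ) : PlaneTree
  | node (marked : Bool) (label : Option ℕ) (left right : PlaneTree) : PlaneTree

namespace PlaneTree

/-- Equality up to exchanging the two children of any number of internal vertices. -/
inductive Equiv : PlaneTree → PlaneTree → Prop
  | leaf (m : Bool) (a : ℕ) : Equiv (.leaf m a) (.leaf m a)
  | node (m : Bool) (x : Option ℕ) {l r l' r' : PlaneTree} :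
      Equiv l l' → Equiv r r' → Equiv (.node m x l r) (.node m x l' r')
  | swap (m : Bool) (x : Option ℕ) {l r l' r' : PlaneTree} :
      Equiv l r' → Equiv r l' → Equiv (.node m x l r) (.node m x l' r')

theorem Equiv.refl (t : PlaneTree) : Equiv t t := by
  induction t with
  | leaf m a => exact .leaf m a
  | node m x l r hl hr => exact .node m x hl hr

theorem Equiv.symm {t u : PlaneTree} (h : Equiv t u) : Equiv u t := by
  induction h with
  | leaf m a => exact .leaf m a
  | node m x _ _ hl hr => exact .node m x hl hr
  | swap m x _ _ hl hr => exact .swap m x hr hl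

theorem Equiv.trans {t u v : PlaneTree} (h : Equiv t u) (h' : Equiv u v) : Equiv t v := by
  induction h generalizing v with
  | leaf m a => exact h'
  | node m x _ _ hl hr =>
    cases h' with
    | node _ _ a b => exact .node m x (hl a) (hr b)
    | swap _ _ a b => exact .swap m x (hl a) (hr b)
  | swap m x _ _ hl hr =>
    cases h' with
    | node _ _ a b => exact .swap m x (hl b) (hr a)
    | swap _ _ a b => exact .node m x (hl b) (hr a)

instance setoid : Setoid PlaneTree := ⟨Equiv, Equiv.refl, Equiv.symm, Equiv.trans⟩

/-- Is the root marked? -/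
def rootMarked : PlaneTree → Bool
  | leaf m _ => m
  | node m _ _ _ => m

/-- The label of the root, if it has one. -/
def rootLabel : PlaneTree → Option ℕ
  | leaf _ a => some a
  | node _ x _ _ => x

/-- Is the root an internal vertex? -/
def rootInternal : PlaneTree → Bool
  | leaf _ _ => false
  | node _ _ _ _ => true

/-- The labels of the leaves, with multiplicity. -/
def leafLabels : PlaneTree → Multiset ℕ
  | leaf _ a => {a}
  | node _ _ l r => leafLabels l + leafLabels r

/-- The labels carried by internal vertices, with multiplicity. -/
def internalLabels : PlaneTree → Multiset ℕ
  | leaf _ _ => 0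
  | node _ x l r => (x.elim 0 fun a => {a}) + (internalLabels l + internalLabels r)

/-- The number of marked vertices. -/
def markCount : PlaneTree → ℕ
  | leaf m _ => m.toNat
  | node m _ l r => m.toNat + (markCount l + markCount r)

/-- If `t` and `u` are sibling subtrees, is the root of `t` a quasi-single leaf, that is, a
non-marked leaf whose sibling is either marked or internal? -/
def quasiSingleBeside (t u : PlaneTree) : Bool :=
  !t.rootInternal && !t.rootMarked && (u.rootMarked || u.rootInternal)

/-- The number of quasi-single leaves. -/
def quasiSingleCount : PlaneTree → ℕ
  | leaf _ _ => 0
  | node _ _ l r => ((quasiSingleBeside l r).toNat + (quasiSingleBeside r l).toNat) +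
      (quasiSingleCount l + quasiSingleCount r)

/-- Replace every leaf label `i` by `f i`. -/
def relabel (f : ℕ → ℕ) : PlaneTree → PlaneTree
  | leaf m a => leaf m (f a)
  | node m x l r => node m x (relabel f l) (relabel f r)

/-- Mark the root. -/
def markRoot : PlaneTree → PlaneTree
  | leaf _ a => leaf true a
  | node _ x l r => node true x l r

/-! ### Labelling the internal vertices -/

/-- For an unlabelled vertex with label `x = none` and children `l`, `r` which are both labelled,
the singleton of the smaller of the two labels of the children; otherwise empty. -/
def readyKey (x : Option ℕ) (l r : PlaneTree) : Finset ℕ :=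
  match x, l.rootLabel, r.rootLabel with
  | none, some a, some b => {min a b}
  | _, _, _ => ∅

/-- The smaller labels of the children, for all unlabelled vertices (including the root) having both
of their children labelled. -/
def readyKeys : PlaneTree → Finset ℕ
  | leaf _ _ => ∅
  | node _ x l r => readyKey x l r ∪ (readyKeys l ∪ readyKeys r)

/-- Attribute the label `c` to the unlabelled vertex having both children labelled, the smaller label
being `key`. -/
def assign (key c : ℕ) : PlaneTree → PlaneTree
  | leaf m a => leaf m a
  | node m x l r =>
      node m (if key ∈ readyKey x l r then some c else x) (assign key c l) (assign key c r)

/-- One step of the procedure: among the unlabelled non-root vertices having both of their children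
labelled, the one which has the child with least label gets the label `c`. -/
def labelStep (c : ℕ) : PlaneTree → PlaneTree
  | leaf m a => leaf m a
  | node m x l r =>
      if h : (readyKeys l ∪ readyKeys r).Nonempty then
        node m x (assign ((readyKeys l ∪ readyKeys r).min' h) c l)
          (assign ((readyKeys l ∪ readyKeys r).min' h) c r)
      else node m x l r

/-- The number of leaves. -/
def size (t : PlaneTree) : ℕ := t.leafLabels.card

/-- The fully labelled tree: for a tree with `n` leaves, the labels `n + 1, …, 2n - 2` are attributed
in this order to the `n - 2` internal non-root vertices. -/
def fullLabelling (t : PlaneTree) : PlaneTree :=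
  (List.range' (t.size + 1) (t.size - 2)).foldl (fun u c => labelStep c u) t

/-- `a` and `b` are the labels of two sibling vertices. -/
def Siblings : PlaneTree → ℕ → ℕ → Prop
  | leaf _ _, _, _ => False
  | node _ _ l r, a, b =>
      ((l.rootLabel = some a ∧ r.rootLabel = some b) ∨
        (r.rootLabel = some a ∧ l.rootLabel = some b)) ∨ (Siblings l a b ∨ Siblings r a b)

/-- `a` is the label of a marked non-root vertex and `b` is the label of its sibling. -/
def MarkedSiblings : PlaneTree → ℕ → ℕ → Prop
  | leaf _ _, _, _ => False
  | node _ _ l r, a, b =>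
      ((l.rootMarked = true ∧ l.rootLabel = some a ∧ r.rootLabel = some b) ∨
        (r.rootMarked = true ∧ r.rootLabel = some a ∧ l.rootLabel = some b)) ∨
        (MarkedSiblings l a b ∨ MarkedSiblings r a b)

open Classical in
/-- The map `Ψ` (marks are ignored): `π i = j` when `i` and `j` label siblings in the fully labelled
tree, and `π i = i` when `i` is not the label of a vertex having a labelled sibling. -/
noncomputable def psi (t : PlaneTree) (i : ℕ) : ℕ :=
  if h : ∃ j, t.fullLabelling.Siblings i j then h.choose else i

/-- Change `π` so that it exchanges `a` and `b`. -/
def joinPair (π : ℕ → ℕ) (a b : ℕ) : ℕ → ℕ :=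
  Function.update (Function.update π a b) b a

open Classical in
/-- The map `Ψ'` on plane representatives. If the root is marked, the pair `{2n-1, 2n}` is added to
`Ψ(τ)`; otherwise, with `k` the label of the marked vertex and `l` the label of its sibling, the pair
`{k, l}` is replaced by `{k, 2n}` and `{l, 2n-1}`. -/
noncomputable def psiMarked (t : PlaneTree) : ℕ → ℕ :=
  if t.rootMarked = true then joinPair t.psi (2 * t.size - 1) (2 * t.size)
  else if h : ∃ q : ℕ × ℕ, t.fullLabelling.MarkedSiblings q.1 q.2 then
    joinPair (joinPair t.psi h.choose.1 (2 * t.size)) h.choose.2 (2 * t.size - 1)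
  else t.psi

/-! ### Independence of the order of children -/

theorem Equiv.rootMarked_eq {t u : PlaneTree} (h : Equiv t u) : t.rootMarked = u.rootMarked := by
  cases h <;> rfl

theorem Equiv.rootLabel_eq {t u : PlaneTree} (h : Equiv t u) : t.rootLabel = u.rootLabel := by
  cases h <;> rfl

theorem Equiv.rootInternal_eq {t u : PlaneTree} (h : Equiv t u) :
    t.rootInternal = u.rootInternal := by
  cases h <;> rfl

theorem Equiv.leafLabels_eq {t u : PlaneTree} (h : Equiv t u) : t.leafLabels = u.leafLabels := by
  induction h with
  | leaf m a => rfl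
  | node m x _ _ hl hr => simp only [leafLabels, hl, hr]
  | swap m x _ _ hl hr => simp only [leafLabels, hl, hr, add_comm]

theorem Equiv.size_eq {t u : PlaneTree} (h : Equiv t u) : t.size = u.size := by
  rw [size, size, h.leafLabels_eq]

theorem Equiv.internalLabels_eq {t u : PlaneTree} (h : Equiv t u) :
    t.internalLabels = u.internalLabels := by
  induction h with
  | leaf m a => rfl
  | node m x _ _ hl hr => simp only [internalLabels, hl, hr]
  | swap m x _ _ hl hr =>
    simp only [internalLabels, hl, hr]
    congr 1
    exact add_comm _ _

theorem Equiv.markCount_eq {t u : PlaneTree} (h : Equiv t u) : t.markCount = u.markCount := by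
  induction h with
  | leaf m a => rfl
  | node m x _ _ hl hr => simp only [markCount, hl, hr]
  | swap m x _ _ hl hr => simp only [markCount, hl, hr]; omega

theorem Equiv.quasiSingleBeside_eq {t u t' u' : PlaneTree} (h : Equiv t u) (h' : Equiv t' u') :
    quasiSingleBeside t t' = quasiSingleBeside u u' := by
  simp only [quasiSingleBeside, h.rootInternal_eq, h.rootMarked_eq, h'.rootInternal_eq,
    h'.rootMarked_eq]

theorem Equiv.quasiSingleCount_eq {t u : PlaneTree} (h : Equiv t u) :
    t.quasiSingleCount = u.quasiSingleCount := by
  induction h with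
  | leaf m a => rfl
  | node m x a b hl hr =>
    simp only [quasiSingleCount, hl, hr, a.quasiSingleBeside_eq b, b.quasiSingleBeside_eq a]
  | swap m x a b hl hr =>
    simp only [quasiSingleCount, hl, hr, a.quasiSingleBeside_eq b, b.quasiSingleBeside_eq a]
    omega

theorem readyKey_comm (x : Option ℕ) (l r : PlaneTree) : readyKey x l r = readyKey x r l := by
  unfold readyKey
  cases x <;> cases l.rootLabel <;> cases r.rootLabel <;> simp [min_comm]

theorem Equiv.readyKey_eq {l r l' r' : PlaneTree} (x : Option ℕ) (h : Equiv l l')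
    (h' : Equiv r r') : readyKey x l r = readyKey x l' r' := by
  simp only [readyKey, h.rootLabel_eq, h'.rootLabel_eq]

theorem Equiv.readyKeys_eq {t u : PlaneTree} (h : Equiv t u) : t.readyKeys = u.readyKeys := by
  induction h with
  | leaf m a => rfl
  | node m x a b hl hr => simp only [readyKeys, hl, hr, a.readyKey_eq x b]
  | swap m x a b hl hr =>
    simp only [readyKeys, hl, hr, a.readyKey_eq x b]
    rw [readyKey_comm, Finset.union_comm (readyKeys _) (readyKeys _)]

theorem Equiv.assign {t u : PlaneTree} (key c : ℕ) (h : Equiv t u) :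
    Equiv (t.assign key c) (u.assign key c) := by
  induction h with
  | leaf m a => exact .leaf m a
  | node m x a b hl hr =>
    simp only [PlaneTree.assign, a.readyKey_eq x b]
    exact .node _ _ hl hr
  | swap m x a b hl hr =>
    simp only [PlaneTree.assign, a.readyKey_eq x b]
    rw [readyKey_comm]
    exact .swap _ _ hl hr

theorem Equiv.labelStep {t u : PlaneTree} (c : ℕ) (h : Equiv t u) :
    Equiv (t.labelStep c) (u.labelStep c) := by
  cases h with
  | leaf m a => exact .leaf m a
  | @node m x l r l' r' a b =>
    have hk : readyKeys l ∪ readyKeys r = readyKeys l' ∪ readyKeys r' := by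
      rw [a.readyKeys_eq, b.readyKeys_eq]
    simp only [PlaneTree.labelStep, hk]
    split
    · exact .node _ _ (a.assign _ _) (b.assign _ _)
    · exact .node _ _ a b
  | @swap m x l r l' r' a b =>
    have hk : readyKeys l ∪ readyKeys r = readyKeys l' ∪ readyKeys r' := by
      rw [a.readyKeys_eq, b.readyKeys_eq, Finset.union_comm]
    simp only [PlaneTree.labelStep, hk]
    split
    · exact .swap _ _ (a.assign _ _) (b.assign _ _)
    · exact .swap _ _ a b

theorem Equiv.foldl_labelStep (L : List ℕ) {t u : PlaneTree} (h : Equiv t u) :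
    Equiv (L.foldl (fun u c => PlaneTree.labelStep c u) t)
      (L.foldl (fun u c => PlaneTree.labelStep c u) u) := by
  induction L generalizing t u with
  | nil => exact h
  | cons c L ih => exact ih (h.labelStep c)

theorem Equiv.fullLabelling {t u : PlaneTree} (h : Equiv t u) :
    Equiv t.fullLabelling u.fullLabelling := by
  rw [PlaneTree.fullLabelling, PlaneTree.fullLabelling, h.size_eq]
  exact h.foldl_labelStep _

theorem Equiv.siblings_eq {t u : PlaneTree} (h : Equiv t u) : t.Siblings = u.Siblings := by
  funext i j
  apply propext
  induction h with
  | leaf m a => exact Iff.rfl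
  | node m x a b hl hr => simp only [Siblings, hl, hr, a.rootLabel_eq, b.rootLabel_eq]
  | swap m x a b hl hr =>
    simp only [Siblings, hl, hr, a.rootLabel_eq, b.rootLabel_eq]
    tauto

theorem Equiv.markedSiblings_eq {t u : PlaneTree} (h : Equiv t u) :
    t.MarkedSiblings = u.MarkedSiblings := by
  funext i j
  apply propext
  induction h with
  | leaf m a => exact Iff.rfl
  | node m x a b hl hr =>
    simp only [MarkedSiblings, hl, hr, a.rootLabel_eq, b.rootLabel_eq, a.rootMarked_eq,
      b.rootMarked_eq]
  | swap m x a b hl hr =>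
    simp only [MarkedSiblings, hl, hr, a.rootLabel_eq, b.rootLabel_eq, a.rootMarked_eq,
      b.rootMarked_eq]
    tauto

theorem Equiv.psi_eq {t u : PlaneTree} (h : Equiv t u) : t.psi = u.psi := by
  funext i
  unfold PlaneTree.psi
  rw [h.fullLabelling.siblings_eq]

theorem Equiv.psiMarked_eq {t u : PlaneTree} (h : Equiv t u) : t.psiMarked = u.psiMarked := by
  unfold PlaneTree.psiMarked
  rw [h.fullLabelling.markedSiblings_eq, h.psi_eq, h.size_eq, h.rootMarked_eq]

end PlaneTree

/-- Binary trees with unordered children. -/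
def UnorderedTree : Type := Quotient PlaneTree.setoid

namespace UnorderedTree

/-- The labels of the leaves, with multiplicity. -/
def leafLabels (t : UnorderedTree) : Multiset ℕ :=
  Quotient.lift PlaneTree.leafLabels (fun _ _ h => PlaneTree.Equiv.leafLabels_eq h) t

/-- The labels carried by internal vertices, with multiplicity. -/
def internalLabels (t : UnorderedTree) : Multiset ℕ :=
  Quotient.lift PlaneTree.internalLabels (fun _ _ h => PlaneTree.Equiv.internalLabels_eq h) t

/-- The number of marked vertices. -/
def markCount (t : UnorderedTree) : ℕ :=
  Quotient.lift PlaneTree.markCount (fun _ _ h => PlaneTree.Equiv.markCount_eq h) t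

/-- The number of quasi-single leaves: non-marked leaves whose sibling is marked or internal. -/
def quasiSingleCount (t : UnorderedTree) : ℕ :=
  Quotient.lift PlaneTree.quasiSingleCount
    (fun _ _ h => PlaneTree.Equiv.quasiSingleCount_eq h) t

/-- Marked labelled binary trees with `n` leaves: the leaves have the `n` different labels
`1, …, n`, the internal vertices are unlabelled, and exactly one vertex is marked. -/
structure IsMarkedLabelled (t : UnorderedTree) (n : ℕ) : Prop where
  leafLabels_eq : t.leafLabels = (Finset.Icc 1 n).val
  internalLabels_eq : t.internalLabels = 0
  markCount_eq : t.markCount = 1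

/-- The map `Ψ'` from marked labelled binary trees to matchings. -/
noncomputable def psiMarked (t : UnorderedTree) : ℕ → ℕ :=
  Quotient.lift PlaneTree.psiMarked (fun _ _ h => PlaneTree.Equiv.psiMarked_eq h) t

end UnorderedTree

/-! ### From paths to trees -/

/-- The order preserving bijection `λ_I` from `{1, …, |I|}` to `I`. -/
noncomputable def lam (I : Finset ℕ) (i : ℕ) : ℕ := Nat.nth (· ∈ I) (i - 1)

/-- The inverse bijection `λ_I⁻¹` from `I` to `{1, …, |I|}`. -/
def lamInv (I : Finset ℕ) (x : ℕ) : ℕ := Nat.count (· ∈ I) x + 1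

/-- The least `k ≥ 1` such that `p₁ + ⋯ + p_k = 0`. -/
noncomputable def firstReturn (p : List ℤ) : ℕ := sInf {k : ℕ | 1 ≤ k ∧ (p.take k).sum = 0}

open Classical in
/-- The greatest `k ≤ n` such that `p₁ + ⋯ + p_{j-1} ≥ 1` for `j = 2, …, k - 1` and
`p₁ + ⋯ + p_{k-1} = 1`. -/
noncomputable def lastPassage (p : List ℤ) (n : ℕ) : ℕ :=
  Nat.findGreatest
    (fun k => (∀ j ∈ Finset.Icc 2 (k - 1), 1 ≤ (p.take (j - 1)).sum) ∧ (p.take (k - 1)).sum = 1) n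

/-- The word `p'` with `p'_i = -p_{k-i}` for `i = 1, …, k - 1`. -/
def reverseSteps (p : List ℤ) (k : ℕ) : List ℤ := ((p.take (k - 1)).map (fun s => -s)).reverse

/-- The map `Φ` from well-labelled Motzkin paths to (unmarked) labelled binary trees; the values on
other words are irrelevant. -/
noncomputable def phi : List ℤ → List ℕ → PlaneTree
  | [], _ => .leaf false 0
  | _ :: _, [] => .leaf false 0
  | s :: q, a :: w =>
    if s = -1 then .node false none (.leaf false 1) (.leaf false 2)
    else if s = 0 then
      let I := (Finset.Icc 1 (a :: w).length).erase a
      .node false none (.leaf false a) ((phi q (w.map (lamInv I))).relabel (lam I))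
    else
      let k := firstReturn (s :: q)
      if _h : 1 ≤ k ∧ k ≤ (s :: q).length then
        let I' := ((a :: w).take k).toFinset
        let I'' := ((a :: w).drop k).toFinset
        .node false none
          ((phi (reverseSteps (s :: q) k)
            (((a :: w).take k).reverse.map (lamInv I'))).relabel (lam I'))
          ((phi ((s :: q).drop k) (((a :: w).drop k).map (lamInv I''))).relabel (lam I''))
      else .leaf false 0
termination_by p => p.length
decreasing_by
  · simp
  · simp only [reverseSteps, List.length_reverse, List.length_map, List.length_take,
      List.length_cons]
    simp only [List.length_cons] at _h
    omega
  · simp only [List.length_drop, List.length_cons]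
    omega

/-- The map `Φ'` on words, with values in plane representatives of marked trees; the values on words
which do not form a well-labelled positive path are irrelevant. -/
noncomputable def phiMarked : List ℤ → List ℕ → PlaneTree
  | [], _ => .leaf true 1
  | _ :: _, [] => .leaf false 0
  | s :: q, a :: w =>
    if s = 0 then
      let I := (Finset.Icc 1 (a :: w).length).erase a
      .node false none (.leaf false a) ((phiMarked q (w.map (lamInv I))).relabel (lam I))
    else
      let k := lastPassage (s :: q) (a :: w).length
      let I' := ((a :: w).take k).toFinset
      let I'' := ((a :: w).drop k).toFinset
      let t' := phi (reverseSteps (s :: q) k) (((a :: w).take k).reverse.map (lamInv I'))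
      if k = (a :: w).length then t'.markRoot
      else if _h : 1 ≤ k then
        .node false none (t'.relabel (lam I'))
          ((phiMarked ((s :: q).drop k) (((a :: w).drop k).map (lamInv I''))).relabel (lam I''))
      else .leaf false 0
termination_by p => p.length
decreasing_by
  · simp
  · rw [List.length_drop]
    have : (s :: q).length = q.length + 1 := rfl
    omega

/-- The map `Φ'` from well-labelled positive paths to marked labelled binary trees. -/
noncomputable def LabelledPath.toMarkedTree (P : LabelledPath) : UnorderedTree :=
  Quotient.mk PlaneTree.setoid (phiMarked P.steps P.labels)

/-! ### Matchings and the three families -/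

/-- `π` is a matching, that is, a fixed-point free involution, on `{1, …, N}`; a map on `{1, …, N}` is
represented by its extension to `ℕ` by the identity. -/
structure IsMatchingOn (N : ℕ) (π : ℕ → ℕ) : Prop where
  mapsTo : ∀ i ∈ Finset.Icc 1 N, π i ∈ Finset.Icc 1 N
  involutive : ∀ i ∈ Finset.Icc 1 N, π (π i) = i
  ne_self : ∀ i ∈ Finset.Icc 1 N, π i ≠ i
  outside : ∀ i ∉ Finset.Icc 1 N, π i = i

/-- Well-labelled positive paths of size `n` with `k` horizontal steps. -/
def positivePaths (n k : ℕ) : Set LabelledPath :=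
  {P | P.IsWellLabelled n ∧ P.IsPositive ∧ P.horizontalSteps = k}

/-- Marked labelled binary trees with `n` leaves, `k` of which are quasi-single. -/
def markedTrees (n k : ℕ) : Set UnorderedTree :=
  {t | t.IsMarkedLabelled n ∧ t.quasiSingleCount = k}

/-- Matchings on `{1, …, 2n}` having `k` pairs `(i, j)` with `i ∈ {1, …, n}` and
`j ∈ {n + 1, …, 2n - 1}`. -/
def matchingsWithPairs (n k : ℕ) : Set (ℕ → ℕ) :=
  {π | IsMatchingOn (2 * n) π ∧
    ((Finset.Icc 1 n ×ˢ Finset.Icc (n + 1) (2 * n - 1)).filter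
      (fun q : ℕ × ℕ => π q.1 = q.2)).card = k}

/-! The two bijections are independent; each comes from taking the tree apart in a way that the
path, or the matching, remembers.

Paths. The maps λ_I only standardise labels, so the argument is run with arbitrary distinct labels:
`MotzkinTree` and `PositiveTree` say how a labelled word of steps builds a tree, without any
standardisation. A leaf beside an internal or marked sibling is a level step. Two internal subtrees
come from cutting the word at its first return to zero and reversing the first piece; the reversal
places the first labels a and b of the two codes on either side of the cutting step. In an unmarked
tree that step is -1, which forces a < b, and this inequality decides which of the two unordered
subtrees comes first. In a marked tree the marked subtree comes second in any case, so the order of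
a and b is free, and the cutting step, -1 or 1, records it. Hence each labelled word has a tree
(`exists_positiveTree`), each unordered tree has a code (`exists_equiv_positiveTree`), and the code
is unique (`PositiveTree.eq_of_equiv`). Standardisation enters only in
`PositiveTree.represents_phiMarked`, which identifies this correspondence with Φ'. Level steps match
quasi-single leaves one by one.

Matchings. Generalise to a set A of m + 2 leaf labels, all below c, with new labels c, ..., c + m -
1. For m > 0 the label c goes to the parent of the two sibling leaves a, b with least minimum.
Cutting off these two leaves turns their parent into a leaf c, and the rest of the procedure does
not see the difference. So the matching of the tree is the pair {a, b} together with the matching of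
a smaller tree on (A \ {a, b}) ∪ {c}. Conversely a matching of A and the new labels must pair two
elements of A, as A is larger than the set of new labels; the pair with least minimum is the one to
be grafted. This gives injectivity (`IsPlain.equiv_of_siblings_eq`) and surjectivity
(`exists_isPlain_siblings_iff`) of Ψ.

Marks. The non-root vertices of a fully labelled tree bear the distinct labels 1, ..., 2n - 2, so a
mark is either on the root or a number k in [2n - 2]. A matching ρ of [2n] has the same two forms:
either ρ(2n) = 2n - 1, or ρ arises in one way from a matching of [2n - 2] by splitting the pair of k
= ρ(2n). A leaf has its partner in [n + 1, 2n - 1] when its sibling is internal and neither is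
marked, or when its sibling is marked (partner 2n - 1); a marked leaf has partner 2n. This is
quasi-singleness. -/

/-! ### Words of steps -/

/-- The word read backwards with all signs changed. -/
def reverseNeg (p : List ℤ) : List ℤ := (p.map (fun s => -s)).reverse

@[simp] theorem reverseNeg_reverseNeg (p : List ℤ) : reverseNeg (reverseNeg p) = p := by
  simp [reverseNeg, List.map_reverse]

@[simp] theorem length_reverseNeg (p : List ℤ) : (reverseNeg p).length = p.length := by
  simp [reverseNeg]

@[simp] theorem count_zero_reverseNeg (p : List ℤ) : (reverseNeg p).count 0 = p.count 0 := by
  rw [reverseNeg, List.count_reverse]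
  induction p with
  | nil => rfl
  | cons s p ih => simp [List.count_cons, ih]

@[simp] theorem sum_reverseNeg (p : List ℤ) : (reverseNeg p).sum = -p.sum := by
  rw [reverseNeg, List.sum_reverse]
  induction p with
  | nil => rfl
  | cons s p ih => simp [ih]; ring

/-- A prefix of the reversed word is a reversed suffix, and a suffix sum is the total minus a prefix
sum. For a word of total -1 this exchanges heights at least 0 with heights at least 1. -/
theorem sum_take_reverseNeg (p : List ℤ) (j : ℕ) :
    ((reverseNeg p).take j).sum = (p.take (p.length - j)).sum - p.sum := by
  have h : (reverseNeg p).take j = reverseNeg (p.drop (p.length - j)) := by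
    simp [reverseNeg, List.take_reverse, List.map_drop]
  have h' := congrArg List.sum (List.take_append_drop (p.length - j) p)
  rw [List.sum_append] at h'
  rw [h, sum_reverseNeg]
  linarith

theorem sum_take_append (p q : List ℤ) (j : ℕ) :
    ((p ++ q).take j).sum = (p.take j).sum + (q.take (j - p.length)).sum := by
  rw [List.take_append, List.sum_append]

theorem sum_take_cons (s : ℤ) (q : List ℤ) (j : ℕ) (hj : 1 ≤ j) :
    ((s :: q).take j).sum = s + (q.take (j - 1)).sum := by
  obtain ⟨i, rfl⟩ : ∃ i, j = i + 1 := ⟨j - 1, by omega⟩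
  simp

/-- The partial sums are nonnegative except the last one, which is `-1`. -/
def IsMotzkinWord (p : List ℤ) : Prop :=
  (∀ j < p.length, 0 ≤ (p.take j).sum) ∧ p.sum = -1

/-- All partial sums are nonnegative. -/
def IsPositiveWord (p : List ℤ) : Prop := ∀ j ≤ p.length, 0 ≤ (p.take j).sum

theorem IsMotzkinWord.length_pos {p : List ℤ} (h : IsMotzkinWord p) : 1 ≤ p.length := by
  rcases p with _ | ⟨s, p⟩
  · simp [IsMotzkinWord] at h
  · simp

theorem IsMotzkinWord.one_le_sum_take_reverseNeg {p : List ℤ} (h : IsMotzkinWord p) {j : ℕ}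
    (hj : 1 ≤ j) : 1 ≤ ((reverseNeg p).take j).sum := by
  have hl := h.length_pos
  have := h.1 (p.length - j) (by omega)
  rw [sum_take_reverseNeg, h.2]
  omega

theorem IsMotzkinWord.sum_reverseNeg {p : List ℤ} (h : IsMotzkinWord p) :
    (reverseNeg p).sum = 1 := by
  rw [_root_.sum_reverseNeg, h.2]; rfl

/-- Together with `IsMotzkinWord.one_le_sum_take_reverseNeg`: Motzkin words are exactly the
reversals of words that stay at height at least 1 after their start and end at height 1. Both ways
of cutting a word produce such a first piece. -/
theorem isMotzkinWord_reverseNeg {p : List ℤ}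
    (h : ∀ j, 1 ≤ j → j ≤ p.length → 1 ≤ (p.take j).sum) (hs : p.sum = 1) :
    IsMotzkinWord (reverseNeg p) := by
  refine ⟨fun j hj => ?_, by rw [sum_reverseNeg, hs]⟩
  rw [length_reverseNeg] at hj
  rw [sum_take_reverseNeg, hs]
  have := h (p.length - j) (by omega) (by omega)
  omega

/-- Partial sums of a concatenation `p ++ s :: q` beyond the letter `s`. -/
theorem sum_take_append_cons (p q : List ℤ) (s : ℤ) (j : ℕ) (hj : p.length + 1 ≤ j) :
    ((p ++ s :: q).take j).sum = p.sum + s + (q.take (j - (p.length + 1))).sum := by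
  rw [sum_take_append, List.take_of_length_le (by omega), sum_take_cons _ _ _ (by omega), add_assoc,
    Nat.sub_sub]

theorem sum_take_append_of_le (p q : List ℤ) (j : ℕ) (hj : j ≤ p.length) :
    ((p ++ q).take j).sum = (p.take j).sum := by
  rw [List.take_append_of_le_length hj]

theorem isMotzkinWord_zero_cons {q : List ℤ} : IsMotzkinWord (0 :: q) ↔ IsMotzkinWord q := by
  unfold IsMotzkinWord
  constructor
  · rintro ⟨h, hs⟩
    refine ⟨fun j hj => ?_, by simpa using hs⟩
    simpa using h (j + 1) (by simpa using hj)
  · rintro ⟨h, hs⟩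
    refine ⟨fun j hj => ?_, by simpa using hs⟩
    rcases j with _ | j
    · simp
    · simpa using h j (by simpa using hj)

theorem isPositiveWord_zero_cons {q : List ℤ} : IsPositiveWord (0 :: q) ↔ IsPositiveWord q := by
  unfold IsPositiveWord
  constructor
  · intro h j hj
    simpa using h (j + 1) (by simpa using hj)
  · intro h j hj
    rcases j with _ | j
    · simp
    · simpa using h j (by simpa using hj)

theorem IsMotzkinWord.append {p q : List ℤ} (hp : IsMotzkinWord p) (hq : IsMotzkinWord q) :
    IsMotzkinWord (reverseNeg p ++ -1 :: q) := by
  have hs := hp.sum_reverseNeg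
  refine ⟨fun j hj => ?_, by simp [hs, hq.2]⟩
  rcases Nat.lt_or_ge p.length j with h | h
  · rw [sum_take_append_cons _ _ _ _ (by simpa using h), hs]
    have := hq.1 (j - ((reverseNeg p).length + 1)) (by simp at hj ⊢; omega)
    omega
  · rw [sum_take_append_of_le _ _ _ (by simpa using h)]
    rcases Nat.eq_zero_or_pos j with rfl | h0
    · simp
    · exact zero_le_one.trans (hp.one_le_sum_take_reverseNeg h0)

theorem IsMotzkinWord.isPositiveWord_reverseNeg {p : List ℤ} (hp : IsMotzkinWord p) :
    IsPositiveWord (reverseNeg p) := by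
  intro j _
  rcases Nat.eq_zero_or_pos j with rfl | h0
  · simp
  · exact zero_le_one.trans (hp.one_le_sum_take_reverseNeg h0)

theorem IsPositiveWord.append {p q : List ℤ} {s : ℤ} (hp : IsMotzkinWord p)
    (hq : IsPositiveWord q) (hs : -1 ≤ s) : IsPositiveWord (reverseNeg p ++ s :: q) := by
  have hsum := hp.sum_reverseNeg
  intro j hj
  rcases Nat.lt_or_ge p.length j with h | h
  · rw [sum_take_append_cons _ _ _ _ (by simpa using h), hsum]
    have := hq (j - ((reverseNeg p).length + 1)) (by simp at hj ⊢; omega)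
    omega
  · rw [sum_take_append_of_le _ _ _ (by simpa using h)]
    exact hp.isPositiveWord_reverseNeg j (by simpa using h)

theorem sum_take_succ_add (p : List ℤ) (j : ℕ) (hj : j < p.length) :
    (p.take (j + 1)).sum = (p.take j).sum + p[j] := by
  rw [List.sum_take_succ]

theorem sum_take_drop (p : List ℤ) (i j : ℕ) :
    ((p.drop i).take j).sum = (p.take (i + j)).sum - (p.take i).sum := by
  rw [List.take_add, List.sum_append]; ring

/-- Decomposition of a Motzkin word at its first return to zero. -/
theorem IsMotzkinWord.exists_append {q : List ℤ} (h : IsMotzkinWord (1 :: q))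
    (ha : ∀ s ∈ 1 :: q, -1 ≤ s) :
    ∃ p₁ p₂, 1 :: q = reverseNeg p₁ ++ -1 :: p₂ ∧ IsMotzkinWord p₁ ∧ IsMotzkinWord p₂ := by
  generalize hp : (1 :: q : List ℤ) = p at *
  have hone : (p.take 1).sum = 1 := by simp [← hp]
  -- Searching for height at most 0 instead of exactly 0 makes existence obvious from the final
  -- height -1; steps at least -1 make the first such visit a visit of 0.
  have hex : ∃ k, 1 ≤ k ∧ k ≤ p.length ∧ (p.take k).sum ≤ 0 :=
    ⟨p.length, h.length_pos, le_rfl, by rw [List.take_length, h.2]; norm_num⟩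
  classical
  obtain ⟨k, ⟨hk1, hkl, hk0⟩, hmin⟩ : ∃ k, (1 ≤ k ∧ k ≤ p.length ∧ (p.take k).sum ≤ 0) ∧
      ∀ j < k, ¬ (1 ≤ j ∧ j ≤ p.length ∧ (p.take j).sum ≤ 0) :=
    ⟨Nat.find hex, Nat.find_spec hex, fun j hj => Nat.find_min hex hj⟩
  have hk2 : 2 ≤ k := by
    rcases Nat.lt_or_ge k 2 with h2 | h2
    · obtain rfl : k = 1 := by omega
      omega
    · exact h2
  obtain ⟨m, rfl⟩ : ∃ m, k = m + 1 := ⟨k - 1, by omega⟩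
  have hpos : ∀ j, 1 ≤ j → j ≤ m → 1 ≤ (p.take j).sum := by
    intro j h1 h2
    by_contra h3
    exact hmin j (by omega) ⟨h1, by omega, by omega⟩
  have hstep := sum_take_succ_add p m (by omega)
  have hm := hpos m (by omega) le_rfl
  have hge := ha p[m] (List.getElem_mem _)
  have hpm : p[m] = -1 := by omega
  -- The height is 0 here but -1 at the end, so a nonempty piece remains.
  have hlt : m + 1 < p.length := by
    by_contra hc
    have : m + 1 = p.length := by omega
    rw [this, List.take_length, h.2] at hstep
    omega
  refine ⟨reverseNeg (p.take m), p.drop (m + 1), ?_, isMotzkinWord_reverseNeg ?_ (by omega), ?_⟩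
  · rw [reverseNeg_reverseNeg, ← hpm, List.getElem_cons_drop, List.take_append_drop]
  · intro j h1 h2
    rw [List.length_take] at h2
    rw [List.take_take, min_eq_left (by omega)]
    exact hpos j h1 (by omega)
  · refine ⟨fun j hj => ?_, ?_⟩
    · rw [List.length_drop] at hj
      rw [sum_take_drop]
      have := h.1 (m + 1 + j) (by omega)
      omega
    · have h1 := congrArg List.sum (List.take_append_drop (m + 1) p)
      rw [List.sum_append, h.2] at h1
      omega

/-- Decomposition of a positive word at its last visit of height one before its first return. -/
theorem IsPositiveWord.exists_append {q : List ℤ} (h : IsPositiveWord (1 :: q))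
    (ha : ∀ s ∈ 1 :: q, s = -1 ∨ s = 0 ∨ s = 1) :
    ∃ p₁, IsMotzkinWord p₁ ∧ (1 :: q = reverseNeg p₁ ∨
      ∃ s p₂, 1 :: q = reverseNeg p₁ ++ s :: p₂ ∧ IsPositiveWord p₂ ∧ (s = -1 ∨ s = 1)) := by
  generalize hp : (1 :: q : List ℤ) = p at *
  have hone : (p.take 1).sum = 1 := by simp [← hp]
  have hl : 1 ≤ p.length := by simp [← hp]
  -- This is the condition defining `lastPassage`, at k = m + 1.
  let Q : ℕ → Prop := fun m => (∀ j, 1 ≤ j → j ≤ m → 1 ≤ (p.take j).sum) ∧ (p.take m).sum = 1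
  have hQ1 : Q 1 := by
    refine ⟨fun j h1 h2 => ?_, hone⟩
    obtain rfl : j = 1 := by omega
    omega
  classical
  obtain ⟨m, hm1, hml, ⟨hpos, hsum⟩, hmax⟩ :
      ∃ m, 1 ≤ m ∧ m ≤ p.length ∧ Q m ∧ ∀ j, m < j → j ≤ p.length → ¬ Q j :=
    ⟨Nat.findGreatest Q p.length, Nat.le_findGreatest hl hQ1, Nat.findGreatest_le _,
      Nat.findGreatest_spec hl hQ1, fun j h1 h2 => Nat.findGreatest_is_greatest h1 h2⟩
  refine ⟨reverseNeg (p.take m), isMotzkinWord_reverseNeg ?_ hsum, ?_⟩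
  · intro j h1 h2
    rw [List.length_take] at h2
    rw [List.take_take, min_eq_left (by omega)]
    exact hpos j h1 (by omega)
  · rcases hml.eq_or_lt with hml | hml
    · left
      rw [reverseNeg_reverseNeg, hml, List.take_length]
    · right
      have hstep := sum_take_succ_add p m hml
      refine ⟨p[m], p.drop (m + 1), ?_, ?_, ?_⟩
      · rw [reverseNeg_reverseNeg, List.getElem_cons_drop, List.take_append_drop]
      · intro j hj
        rw [List.length_drop] at hj
        rw [sum_take_drop, hstep, hsum]
        rcases ha p[m] (List.getElem_mem _) with hs | hs | hs
        · have := h (m + 1 + j) (by omega)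
          omega
        · have := h (m + 1 + j) (by omega)
          exfalso
          refine hmax (m + 1) (by omega) (by omega) ⟨fun i h1 h2 => ?_, by omega⟩
          rcases Nat.lt_or_ge m i with h3 | h3
          · obtain rfl : i = m + 1 := by omega
            omega
          · exact hpos i h1 h3
        -- After an up step the path is at height 2. Steps lower the height by at most 1, so the
        -- first return below 2 would be at height 1, and `Q` would hold beyond the maximal m. Hence
        -- the rest never goes below 2.
        · have key : ∀ j, m + 1 + j ≤ p.length →
              ∀ i ≤ j, 2 ≤ (p.take (m + 1 + i)).sum := by
            intro j hj
            induction j with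
            | zero =>
              intro i hi
              obtain rfl : i = 0 := by omega
              rw [Nat.add_zero]
              omega
            | succ j ih =>
              have ih := ih (by omega)
              intro i hi
              rcases Nat.lt_or_ge j i with h3 | h3
              · obtain rfl : i = j + 1 := by omega
                have h4 := sum_take_succ_add p (m + 1 + j) (by omega)
                have h5 := ih j le_rfl
                have h6 := ha (p[m + 1 + j]'(by omega)) (List.getElem_mem _)
                by_contra h7
                have h8 : (p.take (m + 1 + (j + 1))).sum = 1 := by
                  rw [← Nat.add_assoc] at h7 ⊢
                  omega
                refine hmax (m + 1 + (j + 1)) (by omega) (by omega) ⟨fun i h1 h2 => ?_, h8⟩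
                rcases Nat.lt_or_ge m i with h9 | h9
                · rcases h2.eq_or_lt with h10 | h10
                  · rw [h10, h8]
                  · have := ih (i - (m + 1)) (by omega)
                    rw [show m + 1 + (i - (m + 1)) = i by omega] at this
                    omega
                · exact hpos i h1 h9
              · exact ih i h3
          have := key j (by omega) j le_rfl
          omega
      · rcases ha p[m] (List.getElem_mem _) with hs | hs | hs
        · exact Or.inl hs
        · exfalso
          refine hmax (m + 1) (by omega) (by omega) ⟨fun i h1 h2 => ?_, by omega⟩
          rcases Nat.lt_or_ge m i with h3 | h3
          · obtain rfl : i = m + 1 := by omega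
            omega
          · exact hpos i h1 h3
        · exact Or.inr hs

/-! ### Where the recursions cut a concatenated word -/

theorem firstReturn_append {p : List ℤ} (q : List ℤ) (hp : IsMotzkinWord p) :
    firstReturn (reverseNeg p ++ -1 :: q) = p.length + 1 := by
  have hs := hp.sum_reverseNeg
  have hmem : p.length + 1 ∈ {k : ℕ | 1 ≤ k ∧ ((reverseNeg p ++ -1 :: q).take k).sum = 0} := by
    refine ⟨by omega, ?_⟩
    rw [sum_take_append_cons _ _ _ _ (by simp), hs]
    simp
  refine le_antisymm (Nat.sInf_le hmem) (le_csInf ⟨_, hmem⟩ ?_)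
  rintro k ⟨h1, h2⟩
  by_contra h3
  rw [sum_take_append_of_le _ _ _ (by simp; omega)] at h2
  have := hp.one_le_sum_take_reverseNeg h1
  omega

theorem lastPassage_eq {p : List ℤ} {n k : ℕ} (hkn : k ≤ n)
    (hk : (∀ j ∈ Finset.Icc 2 (k - 1), 1 ≤ (p.take (j - 1)).sum) ∧ (p.take (k - 1)).sum = 1)
    (h : ∀ j, k < j → j ≤ n → ¬ ((∀ i ∈ Finset.Icc 2 (j - 1), 1 ≤ (p.take (i - 1)).sum) ∧
      (p.take (j - 1)).sum = 1)) : lastPassage p n = k := by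
  -- The decidability instance is a variable so that the statement unifies with the classical
  -- instance inside `lastPassage`.
  have aux : ∀ (Q : ℕ → Prop) (inst : DecidablePred Q), Q k → (∀ j, k < j → j ≤ n → ¬ Q j) →
      Nat.findGreatest Q n = k := fun Q inst h1 h2 =>
    Nat.findGreatest_eq_iff.2 ⟨hkn, fun _ => h1, fun j => h2 j⟩
  exact aux _ _ hk h

theorem lastPassage_reverseNeg {p : List ℤ} (hp : IsMotzkinWord p) :
    lastPassage (reverseNeg p) (p.length + 1) = p.length + 1 := by
  refine lastPassage_eq le_rfl ⟨?_, ?_⟩ (fun j h1 h2 => by omega)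
  · intro j hj
    rw [Finset.mem_Icc] at hj
    exact hp.one_le_sum_take_reverseNeg (by omega)
  · rw [Nat.add_sub_cancel, List.take_of_length_le (by simp), hp.sum_reverseNeg]

/-- No later candidate qualifies: after an up step the height stays at least 2 because `q` is
positive, and after a down step the height 0 spoils the positivity condition. -/
theorem lastPassage_append {p q : List ℤ} {s : ℤ} {n : ℕ} (hp : IsMotzkinWord p)
    (hq : IsPositiveWord q) (hs : s = -1 ∨ s = 1) (hn : n = p.length + q.length + 2) :
    lastPassage (reverseNeg p ++ s :: q) n = p.length + 1 := by
  have hsum := hp.sum_reverseNeg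
  refine lastPassage_eq (by omega) ⟨?_, ?_⟩ (fun j h1 h2 => ?_)
  · intro j hj
    rw [Finset.mem_Icc] at hj
    rw [sum_take_append_of_le _ _ _ (by simp; omega)]
    exact hp.one_le_sum_take_reverseNeg (by omega)
  · rw [Nat.add_sub_cancel, sum_take_append_of_le _ _ _ (by simp),
      List.take_of_length_le (by simp), hsum]
  · rintro ⟨h3, h4⟩
    rw [sum_take_append_cons _ _ _ _ (by simp; omega), hsum] at h4
    have h5 := hq (j - 1 - ((reverseNeg p).length + 1)) (by simp; omega)
    obtain rfl : s = -1 := by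
      rcases hs with hs | hs
      · exact hs
      · omega
    -- For the very next candidate the positivity condition does not yet reach the height 0; there
    -- it is the required final height 1 that fails.
    have h6 : j ≠ p.length + 2 := by
      rintro rfl
      simp at h4
    have h7 := h3 (p.length + 2) (by rw [Finset.mem_Icc]; omega)
    rw [sum_take_append_cons _ _ _ _ (by simp), hsum] at h7
    simp at h7

theorem reverseSteps_append {p q : List ℤ} {k : ℕ} (hk : k = p.length + 1) :
    reverseSteps (reverseNeg p ++ q) k = p := by
  subst hk
  have h : (reverseNeg p ++ q).take p.length = reverseNeg p := by
    rw [List.take_append_of_le_length (by simp), List.take_of_length_le (by simp)]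
  rw [reverseSteps, Nat.add_sub_cancel, h]
  exact reverseNeg_reverseNeg p

/-! ### Labellings of words by words -/

/-- The labels `a`, `b` may stand before and after the step `s`. -/
def StepFits (s : ℤ) (a b : ℕ) : Prop := (s = -1 ∧ a < b) ∨ s = 0 ∨ (s = 1 ∧ b < a)

theorem StepFits.neg {s : ℤ} {a b : ℕ} (h : StepFits s a b) : StepFits (-s) b a := by
  unfold StepFits at *
  omega

/-- The word of labels `w` fits the word of steps `p`. -/
inductive IsLabelling : List ℤ → List ℕ → Prop
  | single (a : ℕ) : IsLabelling [] [a]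
  | cons {s : ℤ} {p : List ℤ} {a b : ℕ} {w : List ℕ} :
      StepFits s a b → IsLabelling p (b :: w) → IsLabelling (s :: p) (a :: b :: w)

theorem IsLabelling.length_eq {p : List ℤ} {w : List ℕ} (h : IsLabelling p w) :
    w.length = p.length + 1 := by
  induction h with
  | single a => rfl
  | cons _ _ ih => simpa using ih

theorem IsLabelling.alphabet {p : List ℤ} {w : List ℕ} (h : IsLabelling p w) :
    ∀ s ∈ p, s = -1 ∨ s = 0 ∨ s = 1 := by
  induction h with
  | single a => simp
  | @cons s p a b w hs _ ih =>
    intro x hx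
    rcases List.mem_cons.1 hx with rfl | hx
    · unfold StepFits at hs
      omega
    · exact ih x hx

theorem IsLabelling.append {p q : List ℤ} {s : ℤ} {u v : List ℕ} {a b : ℕ}
    (hp : IsLabelling p (u ++ [a])) (hs : StepFits s a b) (hq : IsLabelling q (b :: v)) :
    IsLabelling (p ++ s :: q) (u ++ a :: b :: v) := by
  generalize hw : u ++ [a] = w at hp
  induction hp generalizing u with
  | single c =>
    obtain ⟨rfl, h⟩ : u = [] ∧ a = c := by
      rcases u with _ | ⟨x, u⟩ <;> simp_all
    exact .cons hs hq
  | @cons t p c d w ht _ ih =>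
    rcases u with _ | ⟨x, u⟩
    · simp at hw
    · simp only [List.cons_append, List.cons.injEq] at hw
      obtain ⟨rfl, hw⟩ := hw
      have h := ih hw
      rcases u with _ | ⟨y, u⟩
      · simp only [List.nil_append, List.cons.injEq] at hw
        obtain ⟨rfl, -⟩ := hw
        exact .cons ht h
      · simp only [List.cons_append, List.cons.injEq] at hw
        obtain ⟨rfl, -⟩ := hw
        exact .cons ht h

theorem IsLabelling.reverse {p : List ℤ} {w : List ℕ} (h : IsLabelling p w) :
    IsLabelling (reverseNeg p) w.reverse := by
  induction h with
  | single a => exact .single a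
  | @cons s p a b w hs _ ih =>
    rw [List.reverse_cons] at ih
    have := ih.append hs.neg (.single a)
    simpa [reverseNeg] using this

theorem IsLabelling.exists_append {p q : List ℤ} {s : ℤ} {w : List ℕ}
    (h : IsLabelling (p ++ s :: q) w) :
    ∃ u a b v, w = u ++ a :: b :: v ∧ IsLabelling p (u ++ [a]) ∧ StepFits s a b ∧
      IsLabelling q (b :: v) := by
  induction p generalizing w with
  | nil =>
    cases h with
    | @cons _ _ a b w hs hq => exact ⟨[], a, b, w, rfl, .single a, hs, hq⟩
  | cons t p ih =>
    cases h with
    | @cons _ _ a b w ht hq =>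
      obtain ⟨u, c, d, v, hw, h1, h2, h3⟩ := ih hq
      refine ⟨a :: u, c, d, v, by rw [hw]; rfl, ?_, h2, h3⟩
      rcases u with _ | ⟨y, u⟩
      · simp only [List.nil_append, List.cons.injEq] at hw
        obtain ⟨rfl, -⟩ := hw
        exact .cons ht h1
      · simp only [List.cons_append, List.cons.injEq] at hw
        obtain ⟨rfl, -⟩ := hw
        exact .cons ht h1

/-- The inductive form allows words to be cut, glued and reversed together with their labels,
without index arithmetic. -/
theorem LabelledPath.isWellLabelled_iff (P : LabelledPath) (n : ℕ) :
    P.IsWellLabelled n ↔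
      IsLabelling P.steps P.labels ∧ P.labels.Perm (List.range' 1 n) := by
  obtain ⟨p, w⟩ := P
  constructor
  · rintro ⟨h1, h2, h3, h4, h5⟩
    refine ⟨?_, h3⟩
    have hl : w.length = p.length + 1 := by
      have := h3.length_eq
      simp only [List.length_range'] at this h1
      omega
    clear h3 h1
    simp only at h2 h4 h5
    induction p generalizing w with
    | nil =>
      obtain ⟨a, rfl⟩ := List.length_eq_one_iff.1 hl
      exact .single a
    | cons s p ih =>
      rcases w with _ | ⟨a, _ | ⟨b, w⟩⟩
      · simp at hl
      · simp at hl
      · refine .cons ?_ (ih (b :: w) (fun x hx => h2 x (List.mem_cons_of_mem _ hx)) ?_ ?_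
          (by simpa using hl))
        · have h6 := h4 0 (by simp) (by simp)
          have h7 := h5 0 (by simp) (by simp)
          simp only [List.getElem_cons_zero, List.getElem_cons_succ, Nat.zero_add] at h6 h7
          rcases h2 s (by simp) with h | h | h
          · exact Or.inl ⟨h, h6 h⟩
          · exact Or.inr (Or.inl h)
          · exact Or.inr (Or.inr ⟨h, h7 h⟩)
        · intro i hp hs h
          exact h4 (i + 1) (by simpa using hp) (by simpa using hs) h
        · intro i hp hs h
          exact h5 (i + 1) (by simpa using hp) (by simpa using hs) h
  · rintro ⟨h, hperm⟩
    have key : ∀ (i : ℕ) (hp : i < p.length) (hs : i + 1 < w.length),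
        StepFits p[i] w[i] w[i + 1] := by
      clear hperm
      simp only at h
      induction h with
      | single a => intro i hp; simp at hp
      | @cons s p a b w hst _ ih =>
        intro i hp hs
        rcases i with _ | i
        · exact hst
        · exact ih i (by simpa using hp) (by simpa using hs)
    refine ⟨?_, h.alphabet, hperm, fun i hp hs h0 => ?_, fun i hp hs h0 => ?_⟩
    · have := hperm.length_eq
      rw [h.length_eq, List.length_range'] at this
      exact this
    · have := key i hp hs
      simp only at h0 hp hs
      change w[i] < w[i + 1]
      unfold StepFits at this
      omega
    · have := key i hp hs
      simp only at h0 hp hs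
      change w[i + 1] < w[i]
      unfold StepFits at this
      omega

theorem reverse_append_cons_perm {α : Type*} {w v : List α} {a b : α} :
    (w.reverse ++ a :: b :: v).Perm (a :: w ++ b :: v) := by
  rw [List.append_cons, ← List.reverse_cons]
  exact (List.reverse_perm _).append_right _

namespace PlaneTree

@[simp] theorem rootInternal_leaf (m : Bool) (a : ℕ) : (leaf m a).rootInternal = false := rfl

@[simp] theorem rootInternal_node (m : Bool) (x : Option ℕ) (l r : PlaneTree) :
    (node m x l r).rootInternal = true := rfl

@[simp] theorem rootMarked_leaf (m : Bool) (a : ℕ) : (leaf m a).rootMarked = m := rfl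

@[simp] theorem rootMarked_node (m : Bool) (x : Option ℕ) (l r : PlaneTree) :
    (node m x l r).rootMarked = m := rfl

end PlaneTree

/-! ### Paths and trees with arbitrary distinct labels -/

/-- The tree encoded by a Motzkin word labelled by arbitrary integers. -/
inductive MotzkinTree : List ℤ → List ℕ → PlaneTree → Prop
  | cherry {a b : ℕ} : a < b →
      MotzkinTree [-1] [a, b] (.node false none (.leaf false a) (.leaf false b))
  | flat (a : ℕ) {p : List ℤ} {w : List ℕ} {t : PlaneTree} : MotzkinTree p w t →
      MotzkinTree (0 :: p) (a :: w) (.node false none (.leaf false a) t)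
  | up {p q : List ℤ} {w v : List ℕ} {a b : ℕ} {t u : PlaneTree} : MotzkinTree p (a :: w) t →
      MotzkinTree q (b :: v) u → a < b →
      MotzkinTree (reverseNeg p ++ -1 :: q) (w.reverse ++ a :: b :: v) (.node false none t u)

/-- The marked tree encoded by a positive word labelled by arbitrary integers. -/
inductive PositiveTree : List ℤ → List ℕ → PlaneTree → Prop
  | single (a : ℕ) : PositiveTree [] [a] (.leaf true a)
  | flat (a : ℕ) {p : List ℤ} {w : List ℕ} {t : PlaneTree} : PositiveTree p w t →
      PositiveTree (0 :: p) (a :: w) (.node false none (.leaf false a) t)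
  | root {p : List ℤ} {w : List ℕ} {t : PlaneTree} : MotzkinTree p w t →
      PositiveTree (reverseNeg p) w.reverse t.markRoot
  | up {p q : List ℤ} {w v : List ℕ} {a b : ℕ} {s : ℤ} {t u : PlaneTree} :
      MotzkinTree p (a :: w) t → PositiveTree q (b :: v) u → StepFits s a b → s ≠ 0 →
      PositiveTree (reverseNeg p ++ s :: q) (w.reverse ++ a :: b :: v) (.node false none t u)

/-! ### Unmarked trees: invariants and uniqueness of the code -/

namespace MotzkinTree

variable {p : List ℤ} {w : List ℕ} {t : PlaneTree}

theorem isLabelling (h : MotzkinTree p w t) : IsLabelling p w := by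
  induction h with
  | cherry h => exact .cons (Or.inl ⟨rfl, h⟩) (.single _)
  | @flat a p w t _ ih =>
    rcases w with _ | ⟨b, w⟩
    · simpa using ih.length_eq
    · exact .cons (Or.inr (Or.inl rfl)) ih
  | up _ _ hab ih₁ ih₂ =>
    exact IsLabelling.append (by simpa using ih₁.reverse) (Or.inl ⟨rfl, hab⟩) ih₂

theorem isMotzkinWord (h : MotzkinTree p w t) : IsMotzkinWord p := by
  induction h with
  | cherry h => exact ⟨fun j hj => by simp at hj; simp [hj], rfl⟩
  | flat a _ ih => exact isMotzkinWord_zero_cons.2 ih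
  | up _ _ _ ih₁ ih₂ => exact ih₁.append ih₂

theorem leafLabels_eq (h : MotzkinTree p w t) : t.leafLabels = ↑w := by
  induction h with
  | cherry h => rfl
  | flat a _ ih => rw [PlaneTree.leafLabels, PlaneTree.leafLabels, ih]; rfl
  | up _ _ _ ih₁ ih₂ =>
    rw [PlaneTree.leafLabels, ih₁, ih₂, Multiset.coe_add, Multiset.coe_eq_coe]
    exact reverse_append_cons_perm.symm

theorem rootInternal_eq (h : MotzkinTree p w t) : t.rootInternal = true := by
  cases h <;> rfl

theorem rootMarked_eq (h : MotzkinTree p w t) : t.rootMarked = false := by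
  cases h <;> rfl

theorem markCount_eq (h : MotzkinTree p w t) : t.markCount = 0 := by
  induction h with
  | cherry h => rfl
  | flat a _ ih => simp [PlaneTree.markCount, ih]
  | up _ _ _ ih₁ ih₂ => simp [PlaneTree.markCount, ih₁, ih₂]

theorem internalLabels_eq (h : MotzkinTree p w t) : t.internalLabels = 0 := by
  induction h with
  | cherry h => rfl
  | flat a _ ih => simp [PlaneTree.internalLabels, ih]
  | up _ _ _ ih₁ ih₂ => simp [PlaneTree.internalLabels, ih₁, ih₂]

/-- Only a level step puts a leaf beside an internal vertex: in a cherry both siblings are unmarked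
leaves, and a first return joins two internal subtrees. -/
theorem quasiSingleCount_eq (h : MotzkinTree p w t) : t.quasiSingleCount = p.count 0 := by
  induction h with
  | cherry h => rfl
  | flat a h ih =>
    simp [PlaneTree.quasiSingleCount, PlaneTree.quasiSingleBeside, ih, h.rootInternal_eq,
      add_comm]
  | up h₁ h₂ _ ih₁ ih₂ =>
    simp [PlaneTree.quasiSingleCount, PlaneTree.quasiSingleBeside, ih₁, ih₂, h₁.rootInternal_eq,
      h₂.rootInternal_eq]

/-- The kinds of the two root children (leaf or internal) determine the constructor. Only two
children of the same kind could be exchanged, and the inequality between the first labels of their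
codes forbids it. -/
theorem eq_of_equiv (h : MotzkinTree p w t) {p' : List ℤ} {w' : List ℕ} {t' : PlaneTree}
    (h' : MotzkinTree p' w' t') (he : t.Equiv t') : p = p' ∧ w = w' := by
  induction h generalizing p' w' t' with
  | cherry hab =>
    cases h' with
    | cherry hab' =>
      cases he with
      | node _ _ h1 h2 => cases h1; cases h2; exact ⟨rfl, rfl⟩
      | swap _ _ h1 h2 => cases h1; cases h2; omega
    | flat c h' =>
      have := h'.rootInternal_eq
      cases he with
      | node _ _ h1 h2 => cases h2; cases this
      | swap _ _ h1 h2 => cases h1; cases this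
    | up h1' h2' _ =>
      have := h1'.rootInternal_eq
      cases he with
      | node _ _ h1 h2 => cases h1; cases this
      | swap _ _ h1 h2 => cases h2; cases this
  | flat a h ih =>
    have hi := h.rootInternal_eq
    cases h' with
    | cherry hab' =>
      cases he with
      | node _ _ h1 h2 => cases h2; cases hi
      | swap _ _ h1 h2 => cases h2; cases hi
    | flat c h' =>
      cases he with
      | node _ _ h1 h2 =>
        obtain ⟨rfl, rfl⟩ := ih h' h2
        cases h1
        exact ⟨rfl, rfl⟩
      | swap _ _ h1 h2 => cases h2; cases hi
    | up h1' h2' _ =>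
      have h3 := h1'.rootInternal_eq
      have h4 := h2'.rootInternal_eq
      cases he with
      | node _ _ h1 h2 => cases h1; cases h3
      | swap _ _ h1 h2 => cases h1; cases h4
  | up h₁ h₂ hab ih₁ ih₂ =>
    have hi₁ := h₁.rootInternal_eq
    have hi₂ := h₂.rootInternal_eq
    cases h' with
    | cherry hab' =>
      cases he with
      | node _ _ h1 h2 => cases h2; cases hi₂
      | swap _ _ h1 h2 => cases h2; cases hi₂
    | flat c h' =>
      cases he with
      | node _ _ h1 h2 => cases h1; cases hi₁
      | swap _ _ h1 h2 => cases h2; cases hi₂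
    | up h1' h2' hab' =>
      cases he with
      | node _ _ h1 h2 =>
        obtain ⟨rfl, e1⟩ := ih₁ h1' h1
        obtain ⟨rfl, e2⟩ := ih₂ h2' h2
        cases e1
        cases e2
        exact ⟨rfl, rfl⟩
      -- By induction the codes of the subtrees agree crosswise, so their first labels would satisfy
      -- both a < b and b < a.
      | swap _ _ h1 h2 =>
        obtain ⟨rfl, e1⟩ := ih₁ h2' h1
        obtain ⟨rfl, e2⟩ := ih₂ h1' h2
        cases e1
        cases e2
        omega

end MotzkinTree

/-! ### Every labelled word has a tree -/

theorem exists_motzkinTree {p : List ℤ} {w : List ℕ} (hp : IsMotzkinWord p)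
    (hw : IsLabelling p w) : ∃ t, MotzkinTree p w t := by
  induction hl : p.length using Nat.strong_induction_on generalizing p w with
  | _ n ih =>
  subst hl
  rcases p with _ | ⟨s, p⟩
  · simpa using hp.length_pos
  · rcases hw.alphabet s (by simp) with rfl | rfl | rfl
    -- Height -1 is allowed only at the end, so a Motzkin word starting with -1 stops there.
    · obtain rfl : p = [] := by
        rcases p with _ | ⟨s, p⟩
        · rfl
        · have := hp.1 1 (by simp)
          simp at this
      cases hw with
      | @cons _ _ a b w hs hw =>
        cases hw
        exact ⟨_, .cherry (by unfold StepFits at hs; omega)⟩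
    · cases hw with
      | @cons _ _ a b w hs hw =>
        obtain ⟨t, ht⟩ := ih p.length (by simp) (isMotzkinWord_zero_cons.1 hp) hw rfl
        exact ⟨_, .flat a ht⟩
    · obtain ⟨p₁, p₂, he, h₁, h₂⟩ := hp.exists_append
        (fun s hs => by rcases hw.alphabet s hs with h | h | h <;> omega)
      rw [he] at hw
      obtain ⟨u, a, b, v, rfl, hu, hs, hv⟩ := hw.exists_append
      have hlen := congrArg List.length he
      simp only [List.length_append, List.length_cons, length_reverseNeg] at hlen
      have hu' := hu.reverse
      rw [reverseNeg_reverseNeg, List.reverse_append, List.reverse_singleton,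
        List.singleton_append] at hu'
      obtain ⟨t₁, ht₁⟩ := ih p₁.length (by simp; omega) h₁ hu' rfl
      obtain ⟨t₂, ht₂⟩ := ih p₂.length (by simp; omega) h₂ hv rfl
      have := ht₁.up ht₂ (by unfold StepFits at hs; omega)
      rw [List.reverse_reverse] at this
      exact ⟨_, he ▸ this⟩

theorem exists_positiveTree {p : List ℤ} {w : List ℕ} (hp : IsPositiveWord p)
    (hw : IsLabelling p w) : ∃ t, PositiveTree p w t := by
  induction hl : p.length using Nat.strong_induction_on generalizing p w with
  | _ n ih =>
  subst hl
  rcases p with _ | ⟨s, p⟩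
  · cases hw
    exact ⟨_, .single _⟩
  · rcases hw.alphabet s (by simp) with rfl | rfl | rfl
    · have := hp 1 (by simp)
      simp at this
    · cases hw with
      | @cons _ _ a b w hs hw =>
        obtain ⟨t, ht⟩ := ih p.length (by simp) (isPositiveWord_zero_cons.1 hp) hw rfl
        exact ⟨_, .flat a ht⟩
    · obtain ⟨p₁, h₁, he | ⟨s, p₂, he, h₂, hs1⟩⟩ := hp.exists_append hw.alphabet
      · rw [he] at hw
        have hw' := hw.reverse
        rw [reverseNeg_reverseNeg] at hw'
        obtain ⟨t, ht⟩ := exists_motzkinTree h₁ hw'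
        have := PositiveTree.root ht
        rw [List.reverse_reverse] at this
        exact ⟨_, he ▸ this⟩
      · rw [he] at hw
        obtain ⟨u, a, b, v, rfl, hu, hs, hv⟩ := hw.exists_append
        have hlen := congrArg List.length he
        simp only [List.length_append, List.length_cons, length_reverseNeg] at hlen
        have hu' := hu.reverse
        rw [reverseNeg_reverseNeg, List.reverse_append, List.reverse_singleton,
        List.singleton_append] at hu'
        obtain ⟨t₁, ht₁⟩ := exists_motzkinTree h₁ hu'
        obtain ⟨t₂, ht₂⟩ := ih p₂.length (by simp; omega) h₂ hv rfl
        have := PositiveTree.up ht₁ ht₂ hs (by omega)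
        rw [List.reverse_reverse] at this
        exact ⟨_, he ▸ this⟩

/-! ### Marked trees: invariants of the code -/

namespace PositiveTree

variable {p : List ℤ} {w : List ℕ} {t : PlaneTree}

theorem isLabelling (h : PositiveTree p w t) : IsLabelling p w := by
  induction h with
  | single a => exact .single a
  | @flat a p w t _ ih =>
    rcases w with _ | ⟨b, w⟩
    · simpa using ih.length_eq
    · exact .cons (Or.inr (Or.inl rfl)) ih
  | root h => exact h.isLabelling.reverse
  | up h₁ _ hs _ ih =>
    exact IsLabelling.append (by simpa using h₁.isLabelling.reverse) hs ih

theorem isPositiveWord (h : PositiveTree p w t) : IsPositiveWord p := by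
  induction h with
  | single a => intro j _; simp
  | flat a _ ih => exact isPositiveWord_zero_cons.2 ih
  | root h => exact h.isMotzkinWord.isPositiveWord_reverseNeg
  | up h₁ _ hs _ ih => exact IsPositiveWord.append h₁.isMotzkinWord ih (by unfold StepFits at hs; omega)

theorem markCount_eq (h : PositiveTree p w t) : t.markCount = 1 := by
  induction h with
  | single a => rfl
  | flat a _ ih => simp [PlaneTree.markCount, ih]
  | root h =>
    have h0 := h.markCount_eq
    cases h <;> simp_all [PlaneTree.markCount, PlaneTree.markRoot]
  | up h₁ _ _ _ ih => simp [PlaneTree.markCount, h₁.markCount_eq, ih]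

/-- This has two uses in counting: the leaf beside such a tree is quasi-single, and the root of such
a tree never is a quasi-single leaf itself. -/
theorem rootMarked_or (h : PositiveTree p w t) : t.rootMarked = true ∨ t.rootInternal = true := by
  cases h with
  | single a => exact Or.inl rfl
  | flat a _ => exact Or.inr rfl
  | root h => cases h <;> exact Or.inr rfl
  | up => exact Or.inr rfl

end PositiveTree

@[simp] theorem PlaneTree.leafLabels_markRoot (t : PlaneTree) :
    t.markRoot.leafLabels = t.leafLabels := by
  cases t <;> rfl

@[simp] theorem PlaneTree.internalLabels_markRoot (t : PlaneTree) :
    t.markRoot.internalLabels = t.internalLabels := by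
  cases t <;> rfl

@[simp] theorem PlaneTree.quasiSingleCount_markRoot (t : PlaneTree) :
    t.markRoot.quasiSingleCount = t.quasiSingleCount := by
  cases t <;> rfl

namespace PositiveTree

variable {p : List ℤ} {w : List ℕ} {t : PlaneTree}

theorem leafLabels_eq (h : PositiveTree p w t) : t.leafLabels = ↑w := by
  induction h with
  | single a => rfl
  | flat a _ ih => rw [PlaneTree.leafLabels, PlaneTree.leafLabels, ih]; rfl
  | root h => rw [PlaneTree.leafLabels_markRoot, h.leafLabels_eq, Multiset.coe_reverse]
  | up h₁ _ _ _ ih =>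
    rw [PlaneTree.leafLabels, h₁.leafLabels_eq, ih, Multiset.coe_add, Multiset.coe_eq_coe]
    exact reverse_append_cons_perm.symm

theorem internalLabels_eq (h : PositiveTree p w t) : t.internalLabels = 0 := by
  induction h with
  | single a => rfl
  | flat a _ ih => simp [PlaneTree.internalLabels, ih]
  | root h => rw [PlaneTree.internalLabels_markRoot, h.internalLabels_eq]
  | up h₁ _ _ _ ih => simp [PlaneTree.internalLabels, h₁.internalLabels_eq, ih]

theorem quasiSingleCount_eq (h : PositiveTree p w t) : t.quasiSingleCount = p.count 0 := by
  induction h with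
  | single a => rfl
  | flat a h ih =>
    have := h.rootMarked_or
    simp [PlaneTree.quasiSingleCount, PlaneTree.quasiSingleBeside, ih, this,
      add_comm]
  | root h => rw [PlaneTree.quasiSingleCount_markRoot, h.quasiSingleCount_eq, count_zero_reverseNeg]
  | up h₁ h₂ _ hs ih =>
    have := h₂.rootMarked_or
    simp [PlaneTree.quasiSingleCount, PlaneTree.quasiSingleBeside, h₁.quasiSingleCount_eq, ih,
      h₁.rootInternal_eq, hs]
    intro h3
    simpa [h3] using this

end PositiveTree

/-! ### Every tree has a code, up to exchanging children -/

theorem exists_equiv_motzkinTree {t : PlaneTree} (hm : t.markCount = 0)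
    (hx : t.internalLabels = 0) (hn : t.leafLabels.Nodup) (hi : t.rootInternal = true) :
    ∃ p w t', t.Equiv t' ∧ MotzkinTree p w t' := by
  induction t with
  | leaf m a => simp at hi
  | node m x l r ihl ihr =>
    simp only [PlaneTree.markCount, Nat.add_eq_zero_iff, Bool.toNat_eq_zero] at hm
    obtain ⟨rfl, hml, hmr⟩ := hm
    simp only [PlaneTree.internalLabels, add_eq_zero] at hx
    obtain ⟨hx, hxl, hxr⟩ := hx
    obtain rfl : x = none := by cases x <;> simp_all
    rw [PlaneTree.leafLabels, Multiset.nodup_add] at hn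
    obtain ⟨hnl, hnr, hd⟩ := hn
    rcases hl : l.rootInternal with _ | _
    · rcases l with ⟨ml, a⟩ | _
      swap; · simp at hl
      obtain rfl : ml = false := by simpa [PlaneTree.markCount] using hml
      rcases hr : r.rootInternal with _ | _
      · rcases r with ⟨mr, b⟩ | _
        swap; · simp at hr
        obtain rfl : mr = false := by simpa [PlaneTree.markCount] using hmr
        have hab : a ≠ b := by
          rintro rfl
          simp [PlaneTree.leafLabels] at hd
        rcases hab.lt_or_gt with h | h
        · exact ⟨_, _, _, .refl _, .cherry h⟩
        · exact ⟨_, _, _, .swap _ _ (.refl _) (.refl _), .cherry h⟩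
      · obtain ⟨p, w, t', he, ht⟩ := ihr hmr hxr hnr hr
        exact ⟨_, _, _, .node _ _ (.refl _) he, .flat a ht⟩
    · obtain ⟨p, w, t', he, ht⟩ := ihl hml hxl hnl hl
      rcases hr : r.rootInternal with _ | _
      · rcases r with ⟨mr, b⟩ | _
        swap; · simp at hr
        obtain rfl : mr = false := by simpa [PlaneTree.markCount] using hmr
        exact ⟨_, _, _, .swap _ _ he (.refl _), .flat b ht⟩
      · obtain ⟨q, v, u', hf, hu⟩ := ihr hmr hxr hnr hr
        have h1 := ht.isLabelling.length_eq
        have h2 := hu.isLabelling.length_eq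
        rcases w with _ | ⟨a, w⟩
        · simp at h1
        rcases v with _ | ⟨b, v⟩
        · simp at h2
        -- The first labels of the two codes are leaf labels of disjoint subtrees; their order
        -- decides which subtree is written first.
        have hab : a ≠ b := by
          rintro rfl
          rw [he.leafLabels_eq, hf.leafLabels_eq, ht.leafLabels_eq, hu.leafLabels_eq] at hd
          simp at hd
        rcases hab.lt_or_gt with h | h
        · exact ⟨_, _, _, .node _ _ he hf, .up ht hu h⟩
        · exact ⟨_, _, _, .swap _ _ he hf, .up hu ht h⟩

/-- The marked subtree has to come second, so the children cannot be sorted by their first labels;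
instead the order of these labels is stored in the cutting step. -/
theorem exists_positiveTree_node {l r : PlaneTree} (hl : l.markCount = 0) (hxl : l.internalLabels = 0)
    (hnl : l.leafLabels.Nodup) (hd : Disjoint l.leafLabels r.leafLabels) {q : List ℤ} {v : List ℕ}
    {u : PlaneTree} (he : r.Equiv u) (hu : PositiveTree q v u) :
    ∃ p w t', (PlaneTree.node false none l r).Equiv t' ∧ PositiveTree p w t' := by
  rcases hi : l.rootInternal with _ | _
  · rcases l with ⟨ml, a⟩ | _
    · obtain rfl : ml = false := by simpa [PlaneTree.markCount] using hl
      exact ⟨_, _, _, .node _ _ (.refl _) he, .flat a hu⟩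
    · simp at hi
  · obtain ⟨p, w, t, hf, ht⟩ := exists_equiv_motzkinTree hl hxl hnl hi
    have h1 := ht.isLabelling.length_eq
    have h2 := hu.isLabelling.length_eq
    rcases w with _ | ⟨a, w⟩
    · simp at h1
    rcases v with _ | ⟨b, v⟩
    · simp at h2
    have hab : a ≠ b := by
      rintro rfl
      rw [he.leafLabels_eq, hf.leafLabels_eq, ht.leafLabels_eq, hu.leafLabels_eq] at hd
      simp at hd
    refine ⟨_, _, _, .node _ _ hf he, .up (s := if a < b then -1 else 1) ht hu ?_ ?_⟩
    · unfold StepFits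
      split <;> omega
    · split <;> simp

theorem exists_equiv_positiveTree {t : PlaneTree} (hm : t.markCount = 1)
    (hx : t.internalLabels = 0) (hn : t.leafLabels.Nodup) :
    ∃ p w t', t.Equiv t' ∧ PositiveTree p w t' := by
  induction t with
  | leaf m a =>
    obtain rfl : m = true := by cases m <;> simp [PlaneTree.markCount] at hm ⊢
    exact ⟨_, _, _, .refl _, .single a⟩
  | node m x l r ihl ihr =>
    rcases m with _ | _
    · simp only [PlaneTree.markCount, Bool.toNat_false, zero_add] at hm
      simp only [PlaneTree.internalLabels, add_eq_zero] at hx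
      obtain ⟨hx, hxl, hxr⟩ := hx
      obtain rfl : x = none := by cases x <;> simp_all
      rw [PlaneTree.leafLabels, Multiset.nodup_add] at hn
      obtain ⟨hnl, hnr, hd⟩ := hn
      have hcases : (l.markCount = 0 ∧ r.markCount = 1) ∨ (l.markCount = 1 ∧ r.markCount = 0) := by
        omega
      rcases hcases with ⟨hl, hr⟩ | ⟨hl, hr⟩
      · obtain ⟨q, v, u, he, hu⟩ := ihr hr hxr hnr
        exact exists_positiveTree_node hl hxl hnl hd he hu
      · obtain ⟨q, v, u, he, hu⟩ := ihl hl hxl hnl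
        obtain ⟨p, w, t', hf, ht⟩ := exists_positiveTree_node hr hxr hnr hd.symm he hu
        exact ⟨p, w, t', .trans (.swap _ _ (.refl _) (.refl _)) hf, ht⟩
    · simp only [PlaneTree.markCount, Bool.toNat_true] at hm
      -- A marked root carries the only mark; without it the tree is unmarked, and its code is that
      -- of the marked tree up to reversal.
      obtain ⟨p, w, t', he, ht⟩ := exists_equiv_motzkinTree (t := .node false x l r)
        (by simp only [PlaneTree.markCount, Bool.toNat_false]; omega) hx hn rfl
      have : (PlaneTree.node true x l r).Equiv t'.markRoot := by
        cases he with
        | node _ _ h1 h2 => exact .node _ _ h1 h2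
        | swap _ _ h1 h2 => exact .swap _ _ h1 h2
      exact ⟨_, _, _, this, .root ht⟩

theorem PlaneTree.Equiv.of_markRoot {t u : PlaneTree} (ht : t.rootInternal = true)
    (hu : u.rootInternal = true) (hm : t.rootMarked = u.rootMarked)
    (h : t.markRoot.Equiv u.markRoot) : t.Equiv u := by
  rcases t with _ | ⟨m, x, l, r⟩
  · simp at ht
  rcases u with _ | ⟨m', x', l', r'⟩
  · simp at hu
  simp only [rootMarked_node] at hm
  subst hm
  cases h with
  | node _ _ h1 h2 => exact .node _ _ h1 h2
  | swap _ _ h1 h2 => exact .swap _ _ h1 h2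

theorem PlaneTree.rootMarked_markRoot (t : PlaneTree) : t.markRoot.rootMarked = true := by
  cases t <;> rfl

theorem PlaneTree.rootInternal_markRoot (t : PlaneTree) :
    t.markRoot.rootInternal = t.rootInternal := by
  cases t <;> rfl

/-- The constructor is visible on the tree: whether the root is marked, whether it is internal, and
whether the child without the mark is a leaf. Exchanging children is impossible because exactly one
of the two subtrees contains the mark. -/
theorem PositiveTree.eq_of_equiv {p : List ℤ} {w : List ℕ} {t : PlaneTree}
    (h : PositiveTree p w t) {p' : List ℤ} {w' : List ℕ} {t' : PlaneTree}
    (h' : PositiveTree p' w' t') (he : t.Equiv t') : p = p' ∧ w = w' := by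
  induction h generalizing p' w' t' with
  | single a =>
    cases h' with
    | single b => cases he; exact ⟨rfl, rfl⟩
    | flat => cases he
    | root h =>
      have h1 := he.rootInternal_eq
      rw [PlaneTree.rootInternal_markRoot, h.rootInternal_eq] at h1
      simp at h1
    | up => cases he
  | flat a h ih =>
    have hm := h.markCount_eq
    cases h' with
    | single b => cases he
    | flat c h' =>
      cases he with
      | node _ _ h1 h2 =>
        obtain ⟨rfl, rfl⟩ := ih h' h2
        cases h1
        exact ⟨rfl, rfl⟩
      | swap _ _ h1 h2 =>
        rw [h2.markCount_eq] at hm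
        simp [PlaneTree.markCount] at hm
    | root h' =>
      have h1 := he.rootMarked_eq
      rw [PlaneTree.rootMarked_markRoot] at h1
      simp at h1
    | up h1' h2' _ _ =>
      cases he with
      | node _ _ h1 h2 =>
        have := h1.rootInternal_eq
        rw [h1'.rootInternal_eq] at this
        simp at this
      | swap _ _ h1 h2 =>
        rw [h2.markCount_eq, h1'.markCount_eq] at hm
        omega
  | root h =>
    cases h' with
    | single b =>
      have h1 := he.rootInternal_eq
      rw [PlaneTree.rootInternal_markRoot, h.rootInternal_eq] at h1
      simp at h1
    | flat =>
      have h1 := he.rootMarked_eq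
      rw [PlaneTree.rootMarked_markRoot] at h1
      simp at h1
    | root h' =>
      obtain ⟨rfl, rfl⟩ := h.eq_of_equiv h' (.of_markRoot h.rootInternal_eq h'.rootInternal_eq
        (h.rootMarked_eq.trans h'.rootMarked_eq.symm) he)
      exact ⟨rfl, rfl⟩
    | up =>
      have h1 := he.rootMarked_eq
      rw [PlaneTree.rootMarked_markRoot] at h1
      simp at h1
  | up h₁ h₂ hs hs0 ih =>
    have hm := h₂.markCount_eq
    cases h' with
    | single b => cases he
    | flat c h' =>
      cases he with
      | node _ _ h1 h2 =>
        have := h1.rootInternal_eq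
        rw [h₁.rootInternal_eq] at this
        simp at this
      | swap _ _ h1 h2 =>
        rw [h2.markCount_eq] at hm
        simp [PlaneTree.markCount] at hm
    | root h' =>
      have h1 := he.rootMarked_eq
      rw [PlaneTree.rootMarked_markRoot] at h1
      simp at h1
    | up h1' h2' hs' hs0' =>
      cases he with
      | node _ _ h1 h2 =>
        obtain ⟨rfl, e1⟩ := h₁.eq_of_equiv h1' h1
        obtain ⟨rfl, e2⟩ := ih h2' h2
        cases e1
        cases e2
        -- Both cutting steps are nonzero and fit the same two labels, hence they agree.
        unfold StepFits at hs hs'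
        refine ⟨?_, rfl⟩
        congr 2
        omega
      | swap _ _ h1 h2 =>
        rw [h2.markCount_eq, h1'.markCount_eq] at hm
        omega

/-! ### Standardisation of labels -/

theorem lam_lamInv {I : Finset ℕ} {x : ℕ} (hx : x ∈ I) : lam I (lamInv I x) = x := by
  rw [lam, lamInv, Nat.add_sub_cancel]
  exact Nat.nth_count hx

theorem lamInv_lt_lamInv {I : Finset ℕ} {x y : ℕ} (hx : x ∈ I) (hxy : x < y) :
    lamInv I x < lamInv I y :=
  Nat.succ_lt_succ (Nat.count_strict_mono hx hxy)

theorem lamInv_mem_Icc {I : Finset ℕ} {x : ℕ} (hx : x ∈ I) : lamInv I x ∈ Finset.Icc 1 I.card := by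
  rw [Finset.mem_Icc, lamInv]
  refine ⟨by omega, ?_⟩
  rw [Nat.count_eq_card_filter_range, Nat.succ_le_iff]
  refine Finset.card_lt_card (Finset.ssubset_iff_of_subset ?_ |>.2 ⟨x, hx, by simp⟩)
  exact fun y hy => (Finset.mem_filter.1 hy).2

theorem lamInv_Icc_one {n x : ℕ} (hx : x ∈ Finset.Icc 1 n) : lamInv (Finset.Icc 1 n) x = x := by
  rw [Finset.mem_Icc] at hx
  rw [lamInv, Nat.count_eq_card_filter_range]
  have : (Finset.range x).filter (· ∈ Finset.Icc 1 n) = Finset.Ico 1 x := by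
    ext y
    simp only [Finset.mem_filter, Finset.mem_range, Finset.mem_Icc, Finset.mem_Ico]
    omega
  rw [this, Nat.card_Ico]
  omega

theorem perm_range'_of_nodup {w : List ℕ} (hn : w.Nodup) (h : ∀ a ∈ w, a ∈ Finset.Icc 1 w.length) :
    w.Perm (List.range' 1 w.length) := by
  refine List.Subperm.perm_of_length_le (hn.subperm fun a ha => ?_) (by simp)
  have := Finset.mem_Icc.1 (h a ha)
  rw [List.mem_range'_1]
  omega

theorem perm_range'_iff {w : List ℕ} {n : ℕ} :
    w.Perm (List.range' 1 n) ↔ (w : Multiset ℕ) = (Finset.Icc 1 n).val := by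
  rw [← Multiset.coe_eq_coe]
  have : ((List.range' 1 n : List ℕ) : Multiset ℕ) = (Finset.Icc 1 n).val := by
    have h := (Finset.Icc 1 n).nodup
    refine (Multiset.Nodup.ext (Multiset.coe_nodup.2 List.nodup_range') h).2 fun a => ?_
    rw [Multiset.mem_coe, List.mem_range'_1, Finset.mem_val, Finset.mem_Icc]
    omega
  rw [this]

theorem toFinset_of_perm_range' {w : List ℕ} {n : ℕ} (h : w.Perm (List.range' 1 n)) :
    w.toFinset = Finset.Icc 1 n := by
  rw [List.toFinset_eq_of_perm _ _ h]
  ext a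
  rw [List.mem_toFinset, List.mem_range'_1, Finset.mem_Icc]
  omega

namespace PlaneTree

theorem relabel_relabel (f g : ℕ → ℕ) (t : PlaneTree) :
    (t.relabel f).relabel g = t.relabel (g ∘ f) := by
  induction t with
  | leaf m a => rfl
  | node m x l r hl hr => simp only [relabel, hl, hr]

theorem relabel_congr {f g : ℕ → ℕ} {t : PlaneTree} (h : ∀ a ∈ t.leafLabels, f a = g a) :
    t.relabel f = t.relabel g := by
  induction t with
  | leaf m a => simp only [relabel, h a (by simp [leafLabels])]
  | node m x l r hl hr =>
    simp only [relabel, hl fun a ha => h a (Multiset.mem_add.2 (Or.inl ha)),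
      hr fun a ha => h a (Multiset.mem_add.2 (Or.inr ha))]

theorem relabel_eq_self {f : ℕ → ℕ} {t : PlaneTree} (h : ∀ a ∈ t.leafLabels, f a = a) :
    t.relabel f = t := by
  induction t with
  | leaf m a => simp only [relabel, h a (by simp [leafLabels])]
  | node m x l r hl hr =>
    simp only [relabel, hl fun a ha => h a (Multiset.mem_add.2 (Or.inl ha)),
      hr fun a ha => h a (Multiset.mem_add.2 (Or.inr ha))]

theorem relabel_markRoot (f : ℕ → ℕ) (t : PlaneTree) :
    t.markRoot.relabel f = (t.relabel f).markRoot := by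
  cases t <;> rfl

end PlaneTree

/-- For every order preserving relabelling of `w` by `1, …, |w|`, the map `φ` sends the word `p` with
the new labels to the relabelled tree. -/
def Represents (φ : List ℤ → List ℕ → PlaneTree) (p : List ℤ) (w : List ℕ) (t : PlaneTree) : Prop :=
  ∀ f : ℕ → ℕ, StrictMonoOn f {a | a ∈ w} → (w.map f).Perm (List.range' 1 w.length) →
    φ p (w.map f) = t.relabel f

section Represents

variable {φ : List ℤ → List ℕ → PlaneTree} {p : List ℤ} {w : List ℕ} {t : PlaneTree} {f : ℕ → ℕ}

theorem lamInv_comp_strictMonoOn (hf : StrictMonoOn f {a | a ∈ w}) :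
    StrictMonoOn (lamInv (w.map f).toFinset ∘ f) {a | a ∈ w} := by
  intro a ha b hb hab
  exact lamInv_lt_lamInv (by simpa using ⟨a, ha, rfl⟩) (hf ha hb hab)

theorem map_lamInv_perm (hn : w.Nodup) (hf : StrictMonoOn f {a | a ∈ w}) :
    (w.map (lamInv (w.map f).toFinset ∘ f)).Perm (List.range' 1 w.length) := by
  have h := perm_range'_of_nodup (w := w.map (lamInv (w.map f).toFinset ∘ f))
    (hn.map_on fun a ha b hb => (lamInv_comp_strictMonoOn hf).injOn ha hb) ?_
  · rwa [List.length_map] at h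
  · intro b hb
    obtain ⟨a, ha, rfl⟩ := List.mem_map.1 hb
    have h1 : f a ∈ (w.map f).toFinset := by simpa using ⟨a, ha, rfl⟩
    have h2 := Finset.mem_Icc.1 (lamInv_mem_Icc h1)
    have h3 := List.toFinset_card_le (w.map f)
    rw [List.length_map] at h3 ⊢
    rw [Finset.mem_Icc]
    exact ⟨h2.1, h2.2.trans h3⟩

theorem Represents.standardize (h : Represents φ p w t) (hn : w.Nodup)
    (hf : StrictMonoOn f {a | a ∈ w}) :
    φ p ((w.map f).map (lamInv (w.map f).toFinset)) =
      t.relabel (lamInv (w.map f).toFinset ∘ f) := by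
  rw [List.map_map]
  exact h _ (lamInv_comp_strictMonoOn hf) (map_lamInv_perm hn hf)

/-- The left side is the shape of every recursive call whose result is placed in a subtree:
standardise the labels, apply the map, restore the labels. On the labels actually present `lam`
undoes `lamInv`, so the subtree comes out with the labels given by `f`. -/
theorem Represents.relabel_standardize (h : Represents φ p w t) (ht : t.leafLabels = ↑w)
    (hn : w.Nodup) (hf : StrictMonoOn f {a | a ∈ w}) :
    (φ p ((w.map f).map (lamInv (w.map f).toFinset))).relabel (lam (w.map f).toFinset) =
      t.relabel f := by
  rw [h.standardize hn hf, PlaneTree.relabel_relabel]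
  refine PlaneTree.relabel_congr fun a ha => ?_
  rw [ht, Multiset.mem_coe] at ha
  exact lam_lamInv (by simpa using ⟨a, ha, rfl⟩)

end Represents

/-! ### The maps `phi` and `phiMarked` on encoded trees -/

theorem phi_zero_cons (q : List ℤ) (a : ℕ) (w : List ℕ) :
    phi (0 :: q) (a :: w) = .node false none (.leaf false a)
      ((phi q (w.map (lamInv ((Finset.Icc 1 (a :: w).length).erase a)))).relabel
        (lam ((Finset.Icc 1 (a :: w).length).erase a))) := by
  rw [phi]
  simp

theorem phiMarked_zero_cons (q : List ℤ) (a : ℕ) (w : List ℕ) :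
    phiMarked (0 :: q) (a :: w) = .node false none (.leaf false a)
      ((phiMarked q (w.map (lamInv ((Finset.Icc 1 (a :: w).length).erase a)))).relabel
        (lam ((Finset.Icc 1 (a :: w).length).erase a))) := by
  rw [phiMarked]
  simp

theorem phi_of_firstReturn {p : List ℤ} {w : List ℕ} {k : ℕ} (hp : p.head? = some 1)
    (hw : w ≠ []) (hk : firstReturn p = k) (h1 : 1 ≤ k) (h2 : k ≤ p.length) :
    phi p w = .node false none
      ((phi (reverseSteps p k) ((w.take k).reverse.map (lamInv (w.take k).toFinset))).relabel
        (lam (w.take k).toFinset))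
      ((phi (p.drop k) ((w.drop k).map (lamInv (w.drop k).toFinset))).relabel
        (lam (w.drop k).toFinset)) := by
  rcases p with _ | ⟨s, q⟩
  · simp at hp
  rcases w with _ | ⟨a, w⟩
  · simp at hw
  obtain rfl : s = 1 := by simpa using hp
  rw [phi, if_neg (by norm_num), if_neg (by norm_num)]
  simp only [hk]
  rw [dif_pos ⟨h1, h2⟩]

theorem phiMarked_of_lastPassage_eq {p : List ℤ} {w : List ℕ} (hp : p.head? = some 1)
    (hw : w ≠ []) (hk : lastPassage p w.length = w.length) :
    phiMarked p w =
      (phi (reverseSteps p w.length) (w.reverse.map (lamInv w.toFinset))).markRoot := by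
  rcases p with _ | ⟨s, q⟩
  · simp at hp
  rcases w with _ | ⟨a, w⟩
  · simp at hw
  obtain rfl : s = 1 := by simpa using hp
  rw [phiMarked, if_neg (by norm_num)]
  simp only [hk, if_true, List.take_length]

theorem phiMarked_of_lastPassage {p : List ℤ} {w : List ℕ} {k : ℕ} (hp : p.head? = some 1)
    (hw : w ≠ []) (hk : lastPassage p w.length = k) (h1 : 1 ≤ k) (h2 : k ≠ w.length) :
    phiMarked p w = .node false none
      ((phi (reverseSteps p k) ((w.take k).reverse.map (lamInv (w.take k).toFinset))).relabel
        (lam (w.take k).toFinset))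
      ((phiMarked (p.drop k) ((w.drop k).map (lamInv (w.drop k).toFinset))).relabel
        (lam (w.drop k).toFinset)) := by
  rcases p with _ | ⟨s, q⟩
  · simp at hp
  rcases w with _ | ⟨a, w⟩
  · simp at hw
  obtain rfl : s = 1 := by simpa using hp
  rw [phiMarked, if_neg (by norm_num)]
  simp only [hk]
  rw [if_neg h2, dif_pos h1]

theorem MotzkinTree.head?_reverseNeg {p : List ℤ} {w : List ℕ} {t : PlaneTree}
    (h : MotzkinTree p w t) (q : List ℤ) : (reverseNeg p ++ q).head? = some 1 := by
  have h1 := h.isMotzkinWord.one_le_sum_take_reverseNeg le_rfl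
  have h2 := h.isLabelling.reverse.alphabet
  rcases hp : reverseNeg p with _ | ⟨s, r⟩
  · rw [hp] at h1
    simp at h1
  · rw [hp] at h1 h2
    have h3 := h2 s (by simp)
    simp at h1
    obtain rfl : s = 1 := by omega
    rfl

/-- At a level step the definitions standardise with respect to an interval without one point; this
is the set of the remaining labels. -/
theorem erase_eq_toFinset {a : ℕ} {w : List ℕ} {n : ℕ} (hn : (a :: w).Nodup)
    (h : (a :: w).Perm (List.range' 1 n)) :
    (Finset.Icc 1 (a :: w).length).erase a = w.toFinset := by
  have hl : (a :: w).length = n := by rw [h.length_eq, List.length_range']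
  rw [hl, ← toFinset_of_perm_range' h, List.toFinset_cons, Finset.erase_insert]
  simpa using (List.nodup_cons.1 hn).1

/-- Quantifying over all order preserving relabellings makes the induction close: a recursive call
on the labels `f` is an instance of the hypothesis for `lamInv _ ∘ f`. -/
theorem MotzkinTree.represents_phi {p : List ℤ} {w : List ℕ} {t : PlaneTree}
    (h : MotzkinTree p w t) (hn : w.Nodup) : Represents phi p w t := by
  induction h with
  | @cherry a b hab =>
    intro f hf hp
    have h1 : f a < f b := hf (by simp) (by simp) hab
    have h2 : f a ∈ List.range' 1 2 := hp.subset (by simp)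
    have h3 : f b ∈ List.range' 1 2 := hp.subset (by simp)
    rw [List.mem_range'_1] at h2 h3
    obtain ⟨h4, h5⟩ : f a = 1 ∧ f b = 2 := by omega
    simp [phi, PlaneTree.relabel, h4, h5]
  | @flat a p w t ht ih =>
    intro f hf hp
    have hn' : w.Nodup := (List.nodup_cons.1 hn).2
    have hf' : StrictMonoOn f {a | a ∈ w} := hf.mono fun b hb => List.mem_cons_of_mem _ hb
    have hnm : ((a :: w).map f).Nodup := hn.map_on fun a ha b hb => hf.injOn ha hb
    rw [List.map_cons] at hp hnm ⊢
    rw [phi_zero_cons, erase_eq_toFinset hnm hp,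
      (ih hn').relabel_standardize ht.leafLabels_eq hn' hf']
    rfl
  | @up p q w v a b t u ht hu hab iht ihu =>
    intro f hf hp
    have hn' := reverse_append_cons_perm.nodup_iff.1 hn
    rw [List.nodup_append] at hn'
    have hlen := ht.isLabelling.length_eq
    have hft : StrictMonoOn f {c | c ∈ a :: w} := hf.mono fun c hc => by simp at hc ⊢; tauto
    have hfu : StrictMonoOn f {c | c ∈ b :: v} := hf.mono fun c hc => by simp at hc ⊢; tauto
    -- The label word splits after |p| + 1 letters, which is the position found by `firstReturn`.
    have hmap : (w.reverse ++ a :: b :: v).map f = ((a :: w).map f).reverse ++ (b :: v).map f := by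
      simp
    rw [hmap, phi_of_firstReturn (ht.head?_reverseNeg _) (by simp)
      (firstReturn_append _ ht.isMotzkinWord) (by omega) (by simp), reverseSteps_append rfl,
      List.take_left' (by rw [List.length_reverse, List.length_map, hlen]),
      List.drop_left' (by rw [List.length_reverse, List.length_map, hlen]),
      List.reverse_reverse, List.toFinset_reverse,
      (iht hn'.1).relabel_standardize ht.leafLabels_eq hn'.1 hft, List.append_cons,
      List.drop_left' (by simp),
      (ihu hn'.2.1).relabel_standardize hu.leafLabels_eq hn'.2.1 hfu]
    rfl

theorem PositiveTree.represents_phiMarked {p : List ℤ} {w : List ℕ} {t : PlaneTree}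
    (h : PositiveTree p w t) (hn : w.Nodup) : Represents phiMarked p w t := by
  induction h with
  | single a =>
    intro f hf hp
    have h2 : f a ∈ List.range' 1 1 := hp.subset (by simp)
    rw [List.mem_range'_1] at h2
    have h4 : f a = 1 := by omega
    simp [phiMarked, PlaneTree.relabel, h4]
  | @flat a p w t ht ih =>
    intro f hf hp
    have hn' : w.Nodup := (List.nodup_cons.1 hn).2
    have hf' : StrictMonoOn f {a | a ∈ w} := hf.mono fun b hb => List.mem_cons_of_mem _ hb
    have hnm : ((a :: w).map f).Nodup := hn.map_on fun a ha b hb => hf.injOn ha hb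
    rw [List.map_cons] at hp hnm ⊢
    rw [phiMarked_zero_cons, erase_eq_toFinset hnm hp,
      (ih hn').relabel_standardize ht.leafLabels_eq hn' hf']
    rfl
  | @root p w t ht =>
    intro f hf hp
    have hn' := List.nodup_reverse.1 hn
    have hf' : StrictMonoOn f {c | c ∈ w} := hf.mono fun c hc => by simpa using hc
    have hlen := ht.isLabelling.length_eq
    have hhead := ht.head?_reverseNeg []
    rw [List.append_nil] at hhead
    have hl : (w.map f).reverse.length = p.length + 1 := by simp [hlen]
    have hset : (w.map f).toFinset = Finset.Icc 1 w.reverse.length := by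
      rw [← toFinset_of_perm_range' hp, List.map_reverse, List.toFinset_reverse]
    rw [List.map_reverse, phiMarked_of_lastPassage_eq hhead (by rw [← List.length_pos_iff]; omega)
      (by rw [hl, lastPassage_reverseNeg ht.isMotzkinWord]), ← List.append_nil (reverseNeg p),
      reverseSteps_append hl, List.reverse_reverse, List.toFinset_reverse,
      (ht.represents_phi hn').standardize hn' hf', PlaneTree.relabel_markRoot]
    congr 1
    -- When k = n the recursion does not restore labels with `lam`. Nothing is lost: all of 1, ...,
    -- n occur, so standardising is the identity.
    refine PlaneTree.relabel_congr fun a ha => ?_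
    rw [ht.leafLabels_eq, Multiset.mem_coe] at ha
    rw [hset]
    refine lamInv_Icc_one ?_
    rw [← hset, List.mem_toFinset]
    exact List.mem_map_of_mem ha
  | @up p q w v a b s t u ht hu hs hs0 ihu =>
    intro f hf hp
    have hn' := reverse_append_cons_perm.nodup_iff.1 hn
    rw [List.nodup_append] at hn'
    have hlen := ht.isLabelling.length_eq
    have hlen2 := hu.isLabelling.length_eq
    have hft : StrictMonoOn f {c | c ∈ a :: w} := hf.mono fun c hc => by simp at hc ⊢; tauto
    have hfu : StrictMonoOn f {c | c ∈ b :: v} := hf.mono fun c hc => by simp at hc ⊢; tauto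
    have hmap : (w.reverse ++ a :: b :: v).map f = ((a :: w).map f).reverse ++ (b :: v).map f := by
      simp
    rw [hmap, phiMarked_of_lastPassage (ht.head?_reverseNeg _) (by simp)
      (lastPassage_append ht.isMotzkinWord hu.isPositiveWord (by unfold StepFits at hs; omega)
        (by simp at *; omega)) (by omega) (by simp at *; omega), reverseSteps_append rfl,
      List.take_left' (by rw [List.length_reverse, List.length_map, hlen]),
      List.drop_left' (by rw [List.length_reverse, List.length_map, hlen]),
      List.reverse_reverse, List.toFinset_reverse,
      (ht.represents_phi hn'.1).relabel_standardize ht.leafLabels_eq hn'.1 hft, List.append_cons,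
      List.drop_left' (by simp),
      (ihu hn'.2.1).relabel_standardize hu.leafLabels_eq hn'.2.1 hfu]
    rfl

theorem PositiveTree.phiMarked_eq {p : List ℤ} {w : List ℕ} {t : PlaneTree} {n : ℕ}
    (h : PositiveTree p w t) (hw : w.Perm (List.range' 1 n)) : phiMarked p w = t := by
  have hn : w.Nodup := hw.nodup_iff.2 List.nodup_range'
  have hl : w.length = n := by rw [hw.length_eq, List.length_range']
  have := h.represents_phiMarked hn id (strictMono_id.strictMonoOn _) (by rw [List.map_id, hl]; exact hw)
  rw [List.map_id] at this
  rw [this, PlaneTree.relabel_eq_self (f := id) fun a _ => rfl]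

theorem exists_positiveTree_of_mem {n k : ℕ} {P : LabelledPath} (hP : P ∈ positivePaths n k) :
    P.labels.Perm (List.range' 1 n) ∧ P.steps.count 0 = k ∧
      ∃ t, PositiveTree P.steps P.labels t ∧ P.toMarkedTree = Quotient.mk PlaneTree.setoid t := by
  obtain ⟨h1, h2, h3⟩ := hP
  obtain ⟨h4, h5⟩ := (P.isWellLabelled_iff n).1 h1
  obtain ⟨t, ht⟩ := exists_positiveTree h2 h4
  exact ⟨h5, h3, t, ht, by rw [LabelledPath.toMarkedTree, ht.phiMarked_eq h5]⟩

/-! ### The bijection from paths to marked trees -/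

theorem bijOn_toMarkedTree (n k : ℕ) :
    Set.BijOn LabelledPath.toMarkedTree (positivePaths n k) (markedTrees n k) := by
  refine ⟨fun P hP => ?_, fun P hP Q hQ h => ?_, fun T hT => ?_⟩
  · obtain ⟨h1, h2, t, ht, he⟩ := exists_positiveTree_of_mem hP
    rw [he]
    exact ⟨⟨ht.leafLabels_eq.trans (perm_range'_iff.1 h1), ht.internalLabels_eq, ht.markCount_eq⟩,
      ht.quasiSingleCount_eq.trans h2⟩
  · obtain ⟨-, -, t, ht, he⟩ := exists_positiveTree_of_mem hP
    obtain ⟨-, -, u, hu, hf⟩ := exists_positiveTree_of_mem hQ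
    rw [he, hf] at h
    obtain ⟨h1, h2⟩ := ht.eq_of_equiv hu (Quotient.exact h)
    cases P
    cases Q
    exact congrArg₂ _ h1 h2
  · induction T using Quotient.inductionOn with
    | h t =>
    obtain ⟨⟨h1, h2, h3⟩, h4⟩ := hT
    change t.leafLabels = _ at h1
    obtain ⟨p, w, t', he, ht⟩ := exists_equiv_positiveTree h3 h2 (h1 ▸ Finset.nodup _)
    have hw : w.Perm (List.range' 1 n) := by
      rw [perm_range'_iff, ← h1, he.leafLabels_eq, ht.leafLabels_eq]
    refine ⟨⟨p, w⟩, ⟨(LabelledPath.isWellLabelled_iff _ n).2 ⟨ht.isLabelling, hw⟩,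
      ht.isPositiveWord, ?_⟩, ?_⟩
    · change t.quasiSingleCount = k at h4
      rw [← h4, he.quasiSingleCount_eq, ht.quasiSingleCount_eq]
      rfl
    · rw [LabelledPath.toMarkedTree, ht.phiMarked_eq hw]
      exact Quotient.sound he.symm

/-! ### Replacing a leaf by a pair of leaves -/

namespace PlaneTree

/-- Replace every leaf with label `c` by an internal vertex with label `y` and two leaves `a`, `b`. -/
def replaceLeaf (c : ℕ) (y : Option ℕ) (a b : ℕ) : PlaneTree → PlaneTree
  | leaf m x => if x = c then node m y (leaf false a) (leaf false b) else leaf m x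
  | node m x l r => node m x (replaceLeaf c y a b l) (replaceLeaf c y a b r)

/-- No internal vertex has a label. -/
def Unlabelled (t : PlaneTree) : Prop := t.internalLabels = 0

theorem unlabelled_node {m : Bool} {x : Option ℕ} {l r : PlaneTree} :
    (node m x l r).Unlabelled ↔ x = none ∧ l.Unlabelled ∧ r.Unlabelled := by
  unfold Unlabelled
  rw [internalLabels, add_eq_zero, add_eq_zero]
  cases x <;> simp

@[simp] theorem rootLabel_leaf (m : Bool) (a : ℕ) : (leaf m a).rootLabel = some a := rfl

@[simp] theorem rootLabel_node (m : Bool) (x : Option ℕ) (l r : PlaneTree) :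
    (node m x l r).rootLabel = x := rfl

theorem mem_readyKey {p : ℕ} {x : Option ℕ} {l r : PlaneTree} :
    p ∈ readyKey x l r ↔ x = none ∧ ∃ a b, l.rootLabel = some a ∧ r.rootLabel = some b ∧
      p = min a b := by
  unfold readyKey
  cases x <;> cases l.rootLabel <;> cases r.rootLabel <;> simp

theorem mem_readyKeys_node {p : ℕ} {m : Bool} {x : Option ℕ} {l r : PlaneTree} :
    p ∈ (node m x l r).readyKeys ↔ p ∈ readyKey x l r ∨ p ∈ l.readyKeys ∨ p ∈ r.readyKeys := by
  simp [readyKeys]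

section Graft

variable (c a b : ℕ)

@[simp] theorem rootLabel_replaceLeaf_some (t : PlaneTree) :
    (t.replaceLeaf c (some c) a b).rootLabel = t.rootLabel := by
  cases t with
  | leaf m x =>
    by_cases h : x = c
    · simp [replaceLeaf, h]
    · simp [replaceLeaf, h]
  | node => rfl

theorem readyKey_replaceLeaf_some (x : Option ℕ) (l r : PlaneTree) :
    readyKey x (l.replaceLeaf c (some c) a b) (r.replaceLeaf c (some c) a b) = readyKey x l r := by
  simp [readyKey]

theorem readyKeys_replaceLeaf_some (t : PlaneTree) :
    (t.replaceLeaf c (some c) a b).readyKeys = t.readyKeys := by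
  induction t with
  | leaf m x =>
    by_cases h : x = c
    · simp [replaceLeaf, h, readyKeys, readyKey]
    · simp [replaceLeaf, h]
  | node m x l r hl hr =>
    simp only [replaceLeaf, readyKeys, hl, hr, readyKey_replaceLeaf_some]

theorem assign_replaceLeaf_some (key d : ℕ) (t : PlaneTree) :
    (t.replaceLeaf c (some c) a b).assign key d = (t.assign key d).replaceLeaf c (some c) a b := by
  induction t with
  | leaf m x =>
    by_cases h : x = c
    · simp [replaceLeaf, h, assign, readyKey]
    · simp [replaceLeaf, h, assign]
  | node m x l r hl hr =>
    simp only [replaceLeaf, assign, hl, hr, readyKey_replaceLeaf_some]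

/-- The grafted vertex bears the label of the leaf it replaces. Being labelled it is never ready,
and its parent sees the same label as before, so the procedure runs identically on both trees. -/
theorem labelStep_replaceLeaf_some (d : ℕ) (t : PlaneTree) :
    (t.replaceLeaf c (some c) a b).labelStep d = (t.labelStep d).replaceLeaf c (some c) a b := by
  cases t with
  | leaf m x =>
    by_cases h : x = c
    · simp [replaceLeaf, h, labelStep, readyKeys]
    · simp [replaceLeaf, h, labelStep]
  | node m x l r =>
    simp only [replaceLeaf, labelStep, readyKeys_replaceLeaf_some, assign_replaceLeaf_some]
    split <;> rfl

theorem foldl_labelStep_replaceLeaf_some (L : List ℕ) (t : PlaneTree) :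
    L.foldl (fun u d => labelStep d u) (t.replaceLeaf c (some c) a b) =
      (L.foldl (fun u d => labelStep d u) t).replaceLeaf c (some c) a b := by
  induction L generalizing t with
  | nil => rfl
  | cons d L ih => rw [List.foldl_cons, List.foldl_cons, labelStep_replaceLeaf_some, ih]

theorem siblings_replaceLeaf_some (t : PlaneTree) (x y : ℕ) :
    (t.replaceLeaf c (some c) a b).Siblings x y ↔
      t.Siblings x y ∨ (c ∈ t.leafLabels ∧ ((x = a ∧ y = b) ∨ (x = b ∧ y = a))) := by
  induction t with
  | leaf m z =>
    by_cases h : z = c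
    · simp [replaceLeaf, h, Siblings, leafLabels, eq_comm]
    · simp [replaceLeaf, h, Siblings, leafLabels, Ne.symm h]
  | node m z l r hl hr =>
    simp only [replaceLeaf, Siblings, hl, hr, rootLabel_replaceLeaf_some, leafLabels,
      Multiset.mem_add]
    grind

end Graft

section ReplaceLeaf

variable {c a b : ℕ} {y : Option ℕ} {t : PlaneTree}

theorem replaceLeaf_of_notMem (h : c ∉ t.leafLabels) : t.replaceLeaf c y a b = t := by
  induction t with
  | leaf m x =>
    have : x ≠ c := by rintro rfl; simp [leafLabels] at h
    simp [replaceLeaf, this]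
  | node m x l r hl hr =>
    rw [leafLabels, Multiset.mem_add, not_or] at h
    rw [replaceLeaf, hl h.1, hr h.2]

theorem markCount_replaceLeaf : (t.replaceLeaf c y a b).markCount = t.markCount := by
  induction t with
  | leaf m x => rw [replaceLeaf]; split <;> simp [markCount]
  | node m x l r hl hr => rw [replaceLeaf, markCount, markCount, hl, hr]

theorem leafLabels_replaceLeaf (hn : t.leafLabels.Nodup) (hc : c ∈ t.leafLabels) :
    (t.replaceLeaf c y a b).leafLabels + {c} = t.leafLabels + {a, b} := by
  induction t with
  | leaf m x =>
    obtain rfl : c = x := by simpa [leafLabels] using hc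
    simp only [replaceLeaf, if_true, leafLabels]
    rw [add_comm]
    rfl
  | node m x l r hl hr =>
    rw [leafLabels, Multiset.nodup_add] at hn
    obtain ⟨hnl, hnr, hd⟩ := hn
    rw [leafLabels, Multiset.mem_add] at hc
    rcases hc with hc | hc
    · have hr' : c ∉ r.leafLabels := Multiset.disjoint_left.1 hd hc
      rw [replaceLeaf, leafLabels, leafLabels, replaceLeaf_of_notMem hr', add_right_comm,
        hl hnl hc, add_right_comm]
    · have hl' : c ∉ l.leafLabels := Multiset.disjoint_right.1 hd hc
      rw [replaceLeaf, leafLabels, leafLabels, replaceLeaf_of_notMem hl', add_assoc, hr hnr hc,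
        add_assoc]

theorem internalLabels_replaceLeaf_some (hn : t.leafLabels.Nodup) (hc : c ∈ t.leafLabels) :
    (t.replaceLeaf c (some c) a b).internalLabels = t.internalLabels + {c} := by
  induction t with
  | leaf m x =>
    obtain rfl : c = x := by simpa [leafLabels] using hc
    simp [replaceLeaf, internalLabels]
  | node m x l r hl hr =>
    rw [leafLabels, Multiset.nodup_add] at hn
    obtain ⟨hnl, hnr, hd⟩ := hn
    rw [leafLabels, Multiset.mem_add] at hc
    rcases hc with hc | hc
    · have hr' : c ∉ r.leafLabels := Multiset.disjoint_left.1 hd hc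
      rw [replaceLeaf, internalLabels, internalLabels, replaceLeaf_of_notMem hr', hl hnl hc,
        add_right_comm, add_assoc, add_assoc, add_assoc]
    · have hl' : c ∉ l.leafLabels := Multiset.disjoint_right.1 hd hc
      rw [replaceLeaf, internalLabels, internalLabels, replaceLeaf_of_notMem hl', hr hnr hc,
        add_assoc, add_assoc]

theorem unlabelled_replaceLeaf_none : (t.replaceLeaf c none a b).Unlabelled ↔ t.Unlabelled := by
  induction t with
  | leaf m x => rw [replaceLeaf]; split <;> simp [Unlabelled, internalLabels]
  | node m x l r hl hr => rw [replaceLeaf, unlabelled_node, unlabelled_node, hl, hr]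

theorem Equiv.replaceLeaf {u : PlaneTree} (h : t.Equiv u) (c : ℕ) (y : Option ℕ) (a b : ℕ) :
    (t.replaceLeaf c y a b).Equiv (u.replaceLeaf c y a b) := by
  induction h with
  | leaf m a => exact .refl _
  | node m x _ _ hl hr => exact .node m x hl hr
  | swap m x _ _ hl hr => exact .swap m x hl hr

theorem replaceLeaf_swap (t : PlaneTree) (c : ℕ) (y : Option ℕ) (a b : ℕ) :
    (t.replaceLeaf c y a b).Equiv (t.replaceLeaf c y b a) := by
  induction t with
  | leaf m x =>
    rw [PlaneTree.replaceLeaf, PlaneTree.replaceLeaf]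
    split
    · exact .swap _ _ (.refl _) (.refl _)
    · exact .refl _
  | node m x l r hl hr => exact .node m x hl hr

/-- There is no converse: a pair of `t` containing c is lost when the leaf c becomes an unlabelled
vertex. -/
theorem siblings_replaceLeaf_none {p q : ℕ} (h : (t.replaceLeaf c none a b).Siblings p q) :
    t.Siblings p q ∨ (p = a ∧ q = b) ∨ (p = b ∧ q = a) := by
  have aux : ∀ (u : PlaneTree) (z : ℕ), (u.replaceLeaf c none a b).rootLabel = some z →
      u.rootLabel = some z := by
    intro u z hz
    cases u with
    | leaf m x =>
      by_cases hx : x = c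
      · simp [replaceLeaf, hx] at hz
      · simpa [replaceLeaf, hx] using hz
    | node => exact hz
  induction t with
  | leaf m x =>
    by_cases hx : x = c
    · simp [replaceLeaf, hx, Siblings] at h
      omega
    · simp [replaceLeaf, hx, Siblings] at h
  | node m x l r hl hr =>
    rw [replaceLeaf, Siblings] at h
    rw [Siblings]
    rcases h with (⟨h1, h2⟩ | ⟨h1, h2⟩) | h | h
    · exact Or.inl (Or.inl (Or.inl ⟨aux _ _ h1, aux _ _ h2⟩))
    · exact Or.inl (Or.inl (Or.inr ⟨aux _ _ h1, aux _ _ h2⟩))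
    · rcases hl h with h | h
      · exact Or.inl (Or.inr (Or.inl h))
      · exact Or.inr h
    · rcases hr h with h | h
      · exact Or.inl (Or.inr (Or.inr h))
      · exact Or.inr h

end ReplaceLeaf

/-! ### One step of the labelling procedure -/

theorem Unlabelled.mem_leafLabels_of_rootLabel {t : PlaneTree} (h : t.Unlabelled) {a : ℕ}
    (ha : t.rootLabel = some a) : a ∈ t.leafLabels := by
  cases t with
  | leaf m x =>
    simp only [rootLabel_leaf, Option.some.injEq] at ha
    simp [leafLabels, ha]
  | node m x l r =>
    obtain ⟨rfl, -⟩ := unlabelled_node.1 h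
    simp at ha

theorem Unlabelled.siblings_mem {t : PlaneTree} (h : t.Unlabelled) {a b : ℕ}
    (hab : t.Siblings a b) : a ∈ t.leafLabels ∧ b ∈ t.leafLabels := by
  induction t with
  | leaf m x => exact hab.elim
  | node m x l r hl hr =>
    obtain ⟨rfl, h1, h2⟩ := unlabelled_node.1 h
    rw [leafLabels, Multiset.mem_add, Multiset.mem_add]
    rcases hab with (⟨h3, h4⟩ | ⟨h3, h4⟩) | h | h
    · exact ⟨Or.inl (h1.mem_leafLabels_of_rootLabel h3), Or.inr (h2.mem_leafLabels_of_rootLabel h4)⟩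
    · exact ⟨Or.inr (h2.mem_leafLabels_of_rootLabel h3), Or.inl (h1.mem_leafLabels_of_rootLabel h4)⟩
    · exact ⟨Or.inl (hl h1 h).1, Or.inl (hl h1 h).2⟩
    · exact ⟨Or.inr (hr h2 h).1, Or.inr (hr h2 h).2⟩

/-- As long as only leaves are labelled, a vertex is ready exactly when its children are two leaves.
This turns readiness into a property of the sibling relation, hence of the matching. -/
theorem Unlabelled.mem_readyKeys {t : PlaneTree} (h : t.Unlabelled) {p : ℕ} :
    p ∈ t.readyKeys ↔ ∃ q, p ≤ q ∧ t.Siblings p q := by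
  induction t with
  | leaf m x => simp [readyKeys, Siblings]
  | node m x l r hl hr =>
    obtain ⟨rfl, h1, h2⟩ := unlabelled_node.1 h
    rw [mem_readyKeys_node, hl h1, hr h2, mem_readyKey]
    simp only [Siblings]
    constructor
    · rintro (⟨-, a, b, h3, h4, h5⟩ | ⟨q, h3, h4⟩ | ⟨q, h3, h4⟩)
      · rcases le_total a b with h6 | h6
        · rw [min_eq_left h6] at h5
          subst h5
          exact ⟨b, h6, Or.inl (Or.inl ⟨h3, h4⟩)⟩
        · rw [min_eq_right h6] at h5
          subst h5
          exact ⟨a, h6, Or.inl (Or.inr ⟨h4, h3⟩)⟩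
      · exact ⟨q, h3, Or.inr (Or.inl h4)⟩
      · exact ⟨q, h3, Or.inr (Or.inr h4)⟩
    · rintro ⟨q, h3, (⟨h4, h5⟩ | ⟨h4, h5⟩) | h4 | h4⟩
      · exact Or.inl ⟨trivial, p, q, h4, h5, (min_eq_left h3).symm⟩
      · exact Or.inl ⟨trivial, q, p, h5, h4, (min_eq_right h3).symm⟩
      · exact Or.inr (Or.inl ⟨q, h3, h4⟩)
      · exact Or.inr (Or.inr ⟨q, h3, h4⟩)

/-- The smaller of the two new labels is not a label of `t`, so no vertex other than the grafted one
can have it as key. -/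
theorem assign_replaceLeaf_none {t : PlaneTree} (h : t.Unlabelled) {a b c : ℕ}
    (ha : a ∉ t.leafLabels) (hb : b ∉ t.leafLabels) :
    (t.replaceLeaf c none a b).assign (min a b) c = t.replaceLeaf c (some c) a b := by
  have hmin : min a b ∉ t.leafLabels := by
    rcases min_choice a b with h | h <;> rw [h] <;> assumption
  clear ha hb
  induction t with
  | leaf m x =>
    by_cases hx : x = c
    · simp [replaceLeaf, hx, assign, readyKey]
    · simp [replaceLeaf, hx, assign]
  | node m x l r hl hr =>
    obtain ⟨rfl, h1, h2⟩ := unlabelled_node.1 h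
    rw [leafLabels, Multiset.mem_add, not_or] at hmin
    have hk : min a b ∉ readyKey none (l.replaceLeaf c none a b) (r.replaceLeaf c none a b) := by
      have aux : ∀ (u : PlaneTree) (z : ℕ), u.Unlabelled →
          (u.replaceLeaf c none a b).rootLabel = some z → z ∈ u.leafLabels := by
        intro u z hu hz
        cases u with
        | leaf m x =>
          by_cases hx : x = c
          · simp [replaceLeaf, hx] at hz
          · simp [replaceLeaf, hx] at hz
            simp [leafLabels, hz]
        | node => exact hu.mem_leafLabels_of_rootLabel hz
      rw [mem_readyKey]
      rintro ⟨-, x, y, hx, hy, hxy⟩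
      rcases min_choice x y with h3 | h3 <;> rw [h3] at hxy
      · exact hmin.1 (hxy ▸ aux _ _ h1 hx)
      · exact hmin.2 (hxy ▸ aux _ _ h2 hy)
    rw [replaceLeaf, assign, if_neg hk, hl h1 hmin.1, hr h2 hmin.2, replaceLeaf]

theorem size_node (m : Bool) (x : Option ℕ) (l r : PlaneTree) :
    (node m x l r).size = l.size + r.size := by
  simp [size, leafLabels]

theorem size_leaf (m : Bool) (x : ℕ) : (leaf m x).size = 1 := rfl

/-- The procedure leaves out the root. With at least three leaves the root is not ready before the
first step anyway, so the exclusion has no effect. -/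
theorem labelStep_eq_assign {t : PlaneTree} (h : t.Unlabelled) (hs : 3 ≤ t.size) {a : ℕ} (c : ℕ)
    (ha : IsLeast (t.readyKeys : Set ℕ) a) : t.labelStep c = t.assign a c := by
  cases t with
  | leaf m x => rfl
  | node m x l r =>
    obtain ⟨rfl, h1, h2⟩ := unlabelled_node.1 h
    have hk : readyKey none l r = ∅ := by
      rw [Finset.eq_empty_iff_forall_notMem]
      intro p hp
      obtain ⟨-, u, v, hu, hv, -⟩ := mem_readyKey.1 hp
      rcases l with ⟨ml, y⟩ | ⟨ml, y, _, _⟩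
      · rcases r with ⟨mr, z⟩ | ⟨mr, z, _, _⟩
        · rw [size_node, size_leaf, size_leaf] at hs
          omega
        · obtain ⟨rfl, -⟩ := unlabelled_node.1 h2
          simp at hv
      · obtain ⟨rfl, -⟩ := unlabelled_node.1 h1
        simp at hu
    rw [readyKeys, hk, Finset.empty_union] at ha
    have hne : (l.readyKeys ∪ r.readyKeys).Nonempty := ⟨a, ha.1⟩
    have hmin : (l.readyKeys ∪ r.readyKeys).min' hne = a :=
      (Finset.isLeast_min' _ hne).unique ha
    rw [labelStep, dif_pos hne, hmin, assign, hk]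
    simp

theorem Unlabelled.readyKeys_nonempty {t : PlaneTree} (h : t.Unlabelled)
    (hi : t.rootInternal = true) : t.readyKeys.Nonempty := by
  induction t with
  | leaf m x => simp at hi
  | node m x l r hl hr =>
    obtain ⟨rfl, h1, h2⟩ := unlabelled_node.1 h
    rcases l with ⟨ml, y⟩ | ⟨ml, y, _, _⟩
    · rcases r with ⟨mr, z⟩ | ⟨mr, z, _, _⟩
      · exact ⟨min y z, mem_readyKeys_node.2 (Or.inl (mem_readyKey.2 ⟨rfl, _, _, rfl, rfl, rfl⟩))⟩
      · obtain ⟨p, hp⟩ := hr h2 rfl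
        exact ⟨p, mem_readyKeys_node.2 (Or.inr (Or.inr hp))⟩
    · obtain ⟨p, hp⟩ := hl h1 rfl
      exact ⟨p, mem_readyKeys_node.2 (Or.inr (Or.inl hp))⟩

/-- A ready vertex is the parent of two leaves, and contracting it to a leaf c gives `t'`. Marks
must be absent because grafting creates unmarked leaves. -/
theorem exists_eq_replaceLeaf {t : PlaneTree} (h : t.Unlabelled) (hm : t.markCount = 0) {a c : ℕ}
    (hn : t.leafLabels.Nodup) (hc : c ∉ t.leafLabels) (ha : a ∈ t.readyKeys) :
    ∃ (x y : ℕ) (t' : PlaneTree), min x y = a ∧ t = t'.replaceLeaf c none x y ∧ c ∈ t'.leafLabels ∧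
      t.leafLabels + {c} = t'.leafLabels + {x, y} := by
  induction t with
  | leaf m x => simp [readyKeys] at ha
  | node m x l r hl hr =>
    obtain ⟨rfl, h1, h2⟩ := unlabelled_node.1 h
    rw [leafLabels, Multiset.nodup_add] at hn
    obtain ⟨hnl, hnr, hd⟩ := hn
    rw [leafLabels, Multiset.mem_add, not_or] at hc
    rw [markCount, Nat.add_eq_zero_iff, Nat.add_eq_zero_iff] at hm
    rcases mem_readyKeys_node.1 ha with ha | ha | ha
    · obtain ⟨-, u, v, hu, hv, rfl⟩ := mem_readyKey.1 ha
      rcases l with ⟨ml, y⟩ | ⟨ml, y, _, _⟩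
      swap
      · obtain ⟨rfl, -⟩ := unlabelled_node.1 h1
        simp at hu
      rcases r with ⟨mr, z⟩ | ⟨mr, z, _, _⟩
      swap
      · obtain ⟨rfl, -⟩ := unlabelled_node.1 h2
        simp at hv
      obtain rfl : y = u := by simpa using hu
      obtain rfl : z = v := by simpa using hv
      simp only [markCount, Bool.toNat_eq_zero] at hm
      obtain ⟨-, rfl, rfl⟩ := hm
      refine ⟨y, z, leaf m c, rfl, by simp [replaceLeaf], by simp [leafLabels], ?_⟩
      simp only [leafLabels]
      rw [add_comm]
      rfl
    · obtain ⟨x, y, l', h3, h4, h5, h6⟩ := hl h1 hm.2.1 hnl hc.1 ha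
      refine ⟨x, y, node m none l' r, h3, by rw [replaceLeaf, ← h4, replaceLeaf_of_notMem hc.2],
        Multiset.mem_add.2 (Or.inl h5), ?_⟩
      rw [leafLabels, leafLabels, add_right_comm, h6, add_right_comm]
    · obtain ⟨x, y, r', h3, h4, h5, h6⟩ := hr h2 hm.2.2 hnr hc.2 ha
      refine ⟨x, y, node m none l r', h3, by rw [replaceLeaf, ← h4, replaceLeaf_of_notMem hc.1],
        Multiset.mem_add.2 (Or.inr h5), ?_⟩
      rw [leafLabels, leafLabels, add_assoc, h6, add_assoc]

theorem rootLabel_assign_eq_some {key d : ℕ} {t : PlaneTree} {p : ℕ} (hp : p ≠ d) :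
    (t.assign key d).rootLabel = some p ↔ t.rootLabel = some p := by
  cases t with
  | leaf m x => rfl
  | node m x l r =>
    rw [assign, rootLabel_node, rootLabel_node]
    split
    · rename_i hk
      obtain ⟨rfl, -⟩ := mem_readyKey.1 hk
      simp [Ne.symm hp]
    · rfl

theorem siblings_assign {key d : ℕ} {t : PlaneTree} {p q : ℕ} (hp : p ≠ d) (hq : q ≠ d) :
    (t.assign key d).Siblings p q ↔ t.Siblings p q := by
  induction t with
  | leaf m x => rfl
  | node m x l r hl hr =>
    rw [assign]
    simp only [Siblings, rootLabel_assign_eq_some hp, rootLabel_assign_eq_some hq, hl, hr]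

theorem siblings_labelStep {d : ℕ} {t : PlaneTree} {p q : ℕ} (hp : p ≠ d) (hq : q ≠ d) :
    (t.labelStep d).Siblings p q ↔ t.Siblings p q := by
  cases t with
  | leaf m x => rfl
  | node m x l r =>
    rw [labelStep]
    split
    · simp only [Siblings, rootLabel_assign_eq_some hp, rootLabel_assign_eq_some hq,
        siblings_assign hp hq]
    · rfl

theorem leafLabels_assign (key d : ℕ) (t : PlaneTree) :
    (t.assign key d).leafLabels = t.leafLabels := by
  induction t with
  | leaf m x => rfl
  | node m x l r hl hr => rw [assign, leafLabels, leafLabels, hl, hr]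

theorem leafLabels_labelStep (d : ℕ) (t : PlaneTree) :
    (t.labelStep d).leafLabels = t.leafLabels := by
  cases t with
  | leaf m x => rfl
  | node m x l r =>
    rw [labelStep]
    split
    · rw [leafLabels, leafLabels, leafLabels_assign, leafLabels_assign]
    · rfl

/-- Attribute the labels `c, …, c + m - 1` in this order. -/
def labelFrom (c m : ℕ) (t : PlaneTree) : PlaneTree :=
  (List.range' c m).foldl (fun u d => labelStep d u) t

theorem labelFrom_succ (c m : ℕ) (t : PlaneTree) :
    t.labelFrom c (m + 1) = (t.labelStep c).labelFrom (c + 1) m := by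
  rw [labelFrom, List.range'_succ, List.foldl_cons, labelFrom]

theorem labelFrom_zero (c : ℕ) (t : PlaneTree) : t.labelFrom c 0 = t := rfl

theorem leafLabels_labelFrom (c m : ℕ) (t : PlaneTree) :
    (t.labelFrom c m).leafLabels = t.leafLabels := by
  induction m generalizing c t with
  | zero => rfl
  | succ m ih => rw [labelFrom_succ, ih, leafLabels_labelStep]

/-- The procedure only introduces labels at least c, so pairs of older labels can be read off before
or after it. -/
theorem siblings_labelFrom {c m : ℕ} {t : PlaneTree} {p q : ℕ} (hp : p < c) (hq : q < c) :
    (t.labelFrom c m).Siblings p q ↔ t.Siblings p q := by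
  induction m generalizing c t with
  | zero => rfl
  | succ m ih =>
    rw [labelFrom_succ, ih (by omega) (by omega), siblings_labelStep (by omega) (by omega)]

/-- The recursion behind Ψ: the first label goes to the grafted vertex, and from then on labelling
commutes with grafting. -/
theorem labelFrom_replaceLeaf_none {t : PlaneTree} (h : t.Unlabelled) {a b c : ℕ} (m : ℕ)
    (ha : a ∉ t.leafLabels) (hb : b ∉ t.leafLabels)
    (hs : 3 ≤ (t.replaceLeaf c none a b).size)
    (hl : IsLeast ((t.replaceLeaf c none a b).readyKeys : Set ℕ) (min a b)) :
    (t.replaceLeaf c none a b).labelFrom c (m + 1) =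
      (t.labelFrom (c + 1) m).replaceLeaf c (some c) a b := by
  rw [labelFrom_succ, labelStep_eq_assign (unlabelled_replaceLeaf_none.2 h) hs c hl,
    assign_replaceLeaf_none h ha hb, labelFrom, foldl_labelStep_replaceLeaf_some, labelFrom]

end PlaneTree

/-! ### Perfect matchings as relations -/

/-- The relation `R` is a fixed-point free involution of `S`. -/
structure IsPairing (R : ℕ → ℕ → Prop) (S : Finset ℕ) : Prop where
  symm : ∀ {x y}, R x y → R y x
  mem : ∀ {x y}, R x y → x ∈ S
  exists_of_mem : ∀ {x}, x ∈ S → ∃ y, R x y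
  unique : ∀ {x y z}, R x y → R x z → y = z
  ne : ∀ {x y}, R x y → x ≠ y

/-- `{x, y}` is the pair `{a, b}`. -/
def IsPair (a b x y : ℕ) : Prop := (x = a ∧ y = b) ∨ (x = b ∧ y = a)

theorem IsPairing.insert {R : ℕ → ℕ → Prop} {S : Finset ℕ} {a b : ℕ} (h : IsPairing R S)
    (hab : a ≠ b) (ha : a ∉ S) (hb : b ∉ S) :
    IsPairing (fun x y => R x y ∨ IsPair a b x y) (insert a (insert b S)) := by
  have h1 : ∀ {x y}, R x y → x ≠ a ∧ x ≠ b := fun hxy =>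
    ⟨fun e => ha (e ▸ h.mem hxy), fun e => hb (e ▸ h.mem hxy)⟩
  refine ⟨?_, ?_, ?_, ?_, ?_⟩
  · rintro x y (hxy | hxy)
    · exact Or.inl (h.symm hxy)
    · exact Or.inr (by unfold IsPair at *; tauto)
  · rintro x y (hxy | hxy)
    · simp [h.mem hxy]
    · unfold IsPair at hxy
      simp only [Finset.mem_insert]
      tauto
  · intro x hx
    simp only [Finset.mem_insert] at hx
    rcases hx with rfl | rfl | hx
    · exact ⟨b, Or.inr (Or.inl ⟨rfl, rfl⟩)⟩
    · exact ⟨a, Or.inr (Or.inr ⟨rfl, rfl⟩)⟩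
    · obtain ⟨y, hy⟩ := h.exists_of_mem hx
      exact ⟨y, Or.inl hy⟩
  · rintro x y z (hxy | hxy) (hxz | hxz)
    · exact h.unique hxy hxz
    · have := h1 hxy
      unfold IsPair at hxz
      tauto
    · have := h1 hxz
      unfold IsPair at hxy
      tauto
    · unfold IsPair at hxy hxz
      omega
  · rintro x y (hxy | hxy)
    · exact h.ne hxy
    · unfold IsPair at hxy
      omega

theorem IsPairing.erase {R : ℕ → ℕ → Prop} {S : Finset ℕ} {a b : ℕ} (h : IsPairing R S)
    (hab : R a b) :
    IsPairing (fun x y => R x y ∧ ¬ IsPair a b x y) ((S.erase a).erase b) := by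
  have hba := h.symm hab
  refine ⟨?_, ?_, ?_, ?_, ?_⟩
  · rintro x y ⟨hxy, hn⟩
    exact ⟨h.symm hxy, by unfold IsPair at *; tauto⟩
  · rintro x y ⟨hxy, hn⟩
    simp only [Finset.mem_erase]
    refine ⟨?_, ?_, h.mem hxy⟩
    · rintro rfl
      exact hn (Or.inr ⟨rfl, h.unique hxy hba⟩)
    · rintro rfl
      exact hn (Or.inl ⟨rfl, h.unique hxy hab⟩)
  · intro x hx
    simp only [Finset.mem_erase] at hx
    obtain ⟨y, hy⟩ := h.exists_of_mem hx.2.2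
    refine ⟨y, hy, ?_⟩
    unfold IsPair
    tauto
  · rintro x y z ⟨hxy, -⟩ ⟨hxz, -⟩
    exact h.unique hxy hxz
  · rintro x y ⟨hxy, -⟩
    exact h.ne hxy

theorem IsPairing.mem_right {R : ℕ → ℕ → Prop} {S : Finset ℕ} {x y : ℕ} (h : IsPairing R S)
    (hxy : R x y) : y ∈ S :=
  h.mem (h.symm hxy)

theorem IsPairing.congr {R R' : ℕ → ℕ → Prop} {S S' : Finset ℕ} (h : IsPairing R S)
    (hR : ∀ x y, R' x y ↔ R x y) (hS : S' = S) : IsPairing R' S' := by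
  obtain rfl : R' = R := by
    funext x y
    exact propext (hR x y)
  rwa [hS]

/-! ### The labelling procedure produces all perfect matchings -/

namespace PlaneTree

/-- Unmarked trees without labels on internal vertices, whose leaves bear the labels in `A`. -/
structure IsPlain (t : PlaneTree) (A : Finset ℕ) : Prop where
  leafLabels_eq : t.leafLabels = A.val
  unlabelled : t.Unlabelled
  markCount_eq : t.markCount = 0

/-- All vertices except possibly the root have a label. -/
def AllLabelled : PlaneTree → Prop
  | leaf _ _ => True
  | node _ _ l r => (l.rootLabel.isSome ∧ r.rootLabel.isSome) ∧ (AllLabelled l ∧ AllLabelled r)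

theorem allLabelled_replaceLeaf_some {c a b : ℕ} {t : PlaneTree} :
    (t.replaceLeaf c (some c) a b).AllLabelled ↔ t.AllLabelled := by
  induction t with
  | leaf m x =>
    rw [replaceLeaf]
    split <;> simp [AllLabelled]
  | node m x l r hl hr => simp only [replaceLeaf, AllLabelled, rootLabel_replaceLeaf_some, hl, hr]

theorem Equiv.allLabelled_iff {t u : PlaneTree} (h : t.Equiv u) :
    t.AllLabelled ↔ u.AllLabelled := by
  induction h with
  | leaf m a => rfl
  | node m x a b hl hr => simp only [AllLabelled, hl, hr, a.rootLabel_eq, b.rootLabel_eq]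
  | swap m x a b hl hr =>
    simp only [AllLabelled, hl, hr, a.rootLabel_eq, b.rootLabel_eq]
    tauto

variable {t u : PlaneTree} {A : Finset ℕ} {c m : ℕ}

theorem IsPlain.size_eq (h : t.IsPlain A) : t.size = A.card := by
  rw [size, h.leafLabels_eq]
  rfl

theorem IsPlain.mem_leafLabels (h : t.IsPlain A) {x : ℕ} : x ∈ t.leafLabels ↔ x ∈ A := by
  rw [h.leafLabels_eq, Finset.mem_val]

theorem IsPlain.nodup (h : t.IsPlain A) : t.leafLabels.Nodup := by
  rw [h.leafLabels_eq]
  exact A.nodup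

theorem IsPlain.exists_cherry (h : t.IsPlain A) (hA : A.card = 2) :
    ∃ a b, a < b ∧ A = {a, b} ∧ t.Equiv (node false none (leaf false a) (leaf false b)) := by
  have hs := h.size_eq
  have hpos : ∀ u : PlaneTree, 1 ≤ u.size := by
    intro u
    induction u with
    | leaf m x => exact le_rfl
    | node m x l r hl hr =>
      rw [size_node]
      omega
  have hpos2 : ∀ m x l r, 2 ≤ (node m x l r).size := by
    intro m x l r
    rw [size_node]
    exact Nat.add_le_add (hpos l) (hpos r)
  rcases t with ⟨m, x⟩ | ⟨m, x, l, r⟩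
  · rw [size_leaf] at hs
    omega
  · have h1 := hpos l
    have h2 := hpos r
    rw [size_node] at hs
    rcases l with ⟨ml, a⟩ | ⟨ml, y, l₁, l₂⟩
    swap
    · have := hpos2 ml y l₁ l₂
      omega
    rcases r with ⟨mr, b⟩ | ⟨mr, y, r₁, r₂⟩
    swap
    · have := hpos2 mr y r₁ r₂
      omega
    have hm := h.markCount_eq
    simp only [markCount, Nat.add_eq_zero_iff, Bool.toNat_eq_zero] at hm
    obtain ⟨rfl, rfl, rfl⟩ := hm
    obtain ⟨rfl, -⟩ := unlabelled_node.1 h.unlabelled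
    have hn := h.nodup
    have hab : a ≠ b := by
      rintro rfl
      simp [leafLabels] at hn
    have hAe : A = {a, b} := by
      ext z
      rw [← h.mem_leafLabels]
      simp [leafLabels]
    rcases hab.lt_or_gt with h3 | h3
    · exact ⟨a, b, h3, hAe, .refl _⟩
    · exact ⟨b, a, h3, by rw [hAe, Finset.pair_comm], .swap _ _ (.refl _) (.refl _)⟩

/-- One unfolding of the recursion, at the least key. Writing the two leaves with a < b may require
exchanging them, whence `Equiv` in place of equality. -/
theorem IsPlain.exists_equiv_replaceLeaf (h : t.IsPlain A) (hA : A.card = m + 3)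
    (hc : ∀ x ∈ A, x < c) :
    ∃ (a b : ℕ) (t' : PlaneTree), a < b ∧ a ∈ A ∧ b ∈ A ∧
      t'.IsPlain (insert c ((A.erase a).erase b)) ∧ t.Equiv (t'.replaceLeaf c none a b) ∧
      IsLeast (t.readyKeys : Set ℕ) a ∧
      (t.labelFrom c (m + 1)).Equiv ((t'.labelFrom (c + 1) m).replaceLeaf c (some c) a b) := by
  have hi : t.rootInternal = true := by
    cases t with
    | leaf m x =>
      have := h.size_eq
      rw [size_leaf] at this
      omega
    | node => rfl
  have hne := h.unlabelled.readyKeys_nonempty hi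
  have hleast := Finset.isLeast_min' _ hne
  have hcA : c ∉ A := fun hcA => (hc c hcA).ne rfl
  obtain ⟨x, y, t', h1, h2, h3, h4⟩ := exists_eq_replaceLeaf h.unlabelled h.markCount_eq (c := c)
    h.nodup (by rwa [h.mem_leafLabels]) hleast.1
  rw [← h1] at hleast
  have hn : (t'.leafLabels + {x, y}).Nodup := by
    rw [← h4, Multiset.nodup_add]
    refine ⟨h.nodup, Multiset.nodup_singleton c, ?_⟩
    rw [Multiset.disjoint_singleton, h.mem_leafLabels]
    exact hcA
  rw [Multiset.nodup_add] at hn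
  obtain ⟨hn', hxy, hd⟩ := hn
  have hxy' : x ≠ y := by simpa using hxy
  have hx : x ∉ t'.leafLabels := fun hx => Multiset.disjoint_left.1 hd hx (by simp)
  have hy : y ∉ t'.leafLabels := fun hy => Multiset.disjoint_left.1 hd hy (by simp)
  have hmem : ∀ z, (z ∈ A ∨ z = c) ↔ (z ∈ t'.leafLabels ∨ z = x ∨ z = y) := by
    intro z
    have := congrArg (fun s => z ∈ s) h4
    simp only [Multiset.mem_add, h.mem_leafLabels, Multiset.mem_singleton, Multiset.insert_eq_cons,
      Multiset.mem_cons, eq_iff_iff] at this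
    exact this
  have hxc : x ≠ c := fun e => hx (e ▸ h3)
  have hyc : y ≠ c := fun e => hy (e ▸ h3)
  have hxA : x ∈ A := by have := hmem x; tauto
  have hyA : y ∈ A := by have := hmem y; tauto
  have hp : t'.IsPlain (insert c ((A.erase x).erase y)) := by
    refine ⟨(Multiset.Nodup.ext hn' (Finset.nodup _)).2 fun z => ?_, ?_, ?_⟩
    · have := hmem z
      simp only [Finset.mem_val, Finset.mem_insert, Finset.mem_erase]
      constructor
      · intro hz
        have hzx : z ≠ x := fun e => hx (e ▸ hz)
        have hzy : z ≠ y := fun e => hy (e ▸ hz)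
        tauto
      · rintro (rfl | hz)
        · exact h3
        · tauto
    · exact unlabelled_replaceLeaf_none.1 (h2 ▸ h.unlabelled)
    · rw [← markCount_replaceLeaf, ← h2, h.markCount_eq]
  have hlab : t.labelFrom c (m + 1) = (t'.labelFrom (c + 1) m).replaceLeaf c (some c) x y := by
    have hs := h.size_eq
    rw [h2] at hs hleast ⊢
    exact labelFrom_replaceLeaf_none hp.unlabelled m hx hy (by omega) hleast
  rcases hxy'.lt_or_gt with hlt | hlt
  · rw [min_eq_left hlt.le] at hleast
    exact ⟨x, y, t', hlt, hxA, hyA, hp, h2 ▸ .refl _, hleast, hlab ▸ .refl _⟩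
  · rw [min_eq_right hlt.le] at hleast
    refine ⟨y, x, t', hlt, hyA, hxA, by rwa [Finset.erase_right_comm], ?_, hleast, ?_⟩
    · rw [h2]
      exact replaceLeaf_swap _ _ _ _ _
    · rw [hlab]
      exact replaceLeaf_swap _ _ _ _ _

theorem siblings_of_equiv_replaceLeaf {t' : PlaneTree} {a b : ℕ} (hc : c ∈ t'.leafLabels)
    (h : (t.labelFrom c (m + 1)).Equiv ((t'.labelFrom (c + 1) m).replaceLeaf c (some c) a b))
    (x y : ℕ) : (t.labelFrom c (m + 1)).Siblings x y ↔
      (t'.labelFrom (c + 1) m).Siblings x y ∨ IsPair a b x y := by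
  rw [h.siblings_eq, siblings_replaceLeaf_some, leafLabels_labelFrom]
  simp only [hc, true_and]
  rfl

theorem union_Ico_eq {a b : ℕ} (ha : a ∈ A) (hb : b ∈ A) :
    A ∪ Finset.Ico c (c + (m + 1)) = insert a (insert b
      (insert c ((A.erase a).erase b) ∪ Finset.Ico (c + 1) (c + 1 + m))) := by
  ext z
  simp only [Finset.mem_union, Finset.mem_insert, Finset.mem_erase, Finset.mem_Ico]
  constructor
  · rintro (h | h)
    · tauto
    · by_cases hz : z = c
      · simp [hz]
      · have : c + 1 ≤ z ∧ z < c + 1 + m := by omega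
        simp [this]
  · rintro (rfl | rfl | (rfl | h) | h)
    · exact Or.inl ha
    · exact Or.inl hb
    · exact Or.inr (by omega)
    · exact Or.inl h.2.2
    · exact Or.inr (by omega)

theorem notMem_insert_union {a b x : ℕ} (hc : ∀ x ∈ A, x < c) (hx : x = a ∨ x = b) (hxA : x ∈ A) :
    x ∉ insert c ((A.erase a).erase b) ∪ Finset.Ico (c + 1) (c + 1 + m) := by
  have := hc x hxA
  simp only [Finset.mem_union, Finset.mem_insert, Finset.mem_erase, Finset.mem_Ico]
  omega

theorem card_insert_erase {a b : ℕ} (hA : A.card = m + 3) (hc : ∀ x ∈ A, x < c) (ha : a ∈ A)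
    (hb : b ∈ A) (hab : a < b) : (insert c ((A.erase a).erase b)).card = m + 2 := by
  rw [Finset.card_insert_of_notMem, Finset.card_erase_of_mem (by simp [hb, hab.ne']),
    Finset.card_erase_of_mem ha, hA]
  · rfl
  · intro h
    have := hc c (Finset.mem_of_mem_erase (Finset.mem_of_mem_erase h))
    omega

theorem lt_of_mem_insert_erase {a b : ℕ} (hc : ∀ x ∈ A, x < c) :
    ∀ x ∈ insert c ((A.erase a).erase b), x < c + 1 := by
  intro x hx
  rcases Finset.mem_insert.1 hx with rfl | hx
  · omega
  · have := hc x (Finset.mem_of_mem_erase (Finset.mem_of_mem_erase hx))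
    omega

/-- Contract the first labelled vertex: the smaller tree has the leaf labels without a, b but with
c, the next new label is c + 1, and the pair {a, b} is disjoint from everything that remains. -/
theorem IsPlain.isPairing (h : t.IsPlain A) (hA : A.card = m + 2) (hc : ∀ x ∈ A, x < c) :
    IsPairing (t.labelFrom c m).Siblings (A ∪ Finset.Ico c (c + m)) ∧
      (t.labelFrom c m).internalLabels = (Finset.Ico c (c + m)).val ∧
      (t.labelFrom c m).AllLabelled := by
  induction m generalizing t A c with
  | zero =>
    obtain ⟨a, b, hab, rfl, he⟩ := h.exists_cherry hA
    rw [labelFrom_zero, he.siblings_eq, he.internalLabels_eq, he.allLabelled_iff]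
    refine ⟨?_, by simp [internalLabels], by simp [AllLabelled]⟩
    have h0 : IsPairing (fun _ _ => False) ∅ :=
      ⟨fun h => h, fun h => h.elim, fun h => by simp at h, fun h => h.elim, fun h => h.elim⟩
    refine (h0.insert hab.ne (by simp) (by simp)).congr (fun x y => ?_) (by simp)
    simp [Siblings, IsPair, eq_comm]
  | succ m ih =>
    obtain ⟨a, b, t', hab, ha, hb, hp, -, -, hl⟩ := h.exists_equiv_replaceLeaf hA hc
    obtain ⟨h1, h2, h3⟩ := ih hp (card_insert_erase hA hc ha hb hab) (lt_of_mem_insert_erase hc)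
    have hct : c ∈ t'.leafLabels := hp.mem_leafLabels.2 (Finset.mem_insert_self _ _)
    refine ⟨?_, ?_, ?_⟩
    · exact (h1.insert hab.ne (notMem_insert_union hc (Or.inl rfl) ha)
        (notMem_insert_union hc (Or.inr rfl) hb)).congr
        (fun x y => siblings_of_equiv_replaceLeaf hct hl x y) (union_Ico_eq ha hb)
    · rw [hl.internalLabels_eq, internalLabels_replaceLeaf_some
        (by rw [leafLabels_labelFrom]; exact hp.nodup) (by rwa [leafLabels_labelFrom]), h2]
      have hcI : c ∉ Finset.Ico (c + 1) (c + 1 + m) := by simp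
      rw [add_comm, Multiset.singleton_add, ← Finset.insert_val_of_notMem hcI]
      congr 1
      ext z
      simp only [Finset.mem_insert, Finset.mem_Ico]
      omega
    · rw [hl.allLabelled_iff, allLabelled_replaceLeaf_some]
      exact h3

/-- The labels below c are old ones, so the initially ready vertices can be recovered from the final
sibling relation alone. -/
theorem IsPlain.mem_readyKeys_iff (h : t.IsPlain A) (hc : ∀ x ∈ A, x < c) {p : ℕ} :
    p ∈ t.readyKeys ↔ ∃ q, p ≤ q ∧ p < c ∧ q < c ∧ (t.labelFrom c m).Siblings p q := by
  rw [h.unlabelled.mem_readyKeys]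
  constructor
  · rintro ⟨q, h1, h2⟩
    obtain ⟨h3, h4⟩ := h.unlabelled.siblings_mem h2
    rw [h.mem_leafLabels] at h3 h4
    exact ⟨q, h1, hc p h3, hc q h4, (siblings_labelFrom (hc p h3) (hc q h4)).2 h2⟩
  · rintro ⟨q, h1, h2, h3, h4⟩
    exact ⟨q, h1, (siblings_labelFrom h2 h3).1 h4⟩

/-- The relation determines the keys, hence the least key a, hence its partner b. Removing the pair
{a, b} leaves equal relations for the contracted trees, to which induction applies. -/
theorem IsPlain.equiv_of_siblings_eq (ht : t.IsPlain A) (hu : u.IsPlain A) (hA : A.card = m + 2)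
    (hc : ∀ x ∈ A, x < c)
    (h : ∀ x y, (t.labelFrom c m).Siblings x y ↔ (u.labelFrom c m).Siblings x y) : t.Equiv u := by
  induction m generalizing t u A c with
  | zero =>
    obtain ⟨a, b, hab, rfl, he⟩ := ht.exists_cherry hA
    obtain ⟨a', b', hab', hA', hf⟩ := hu.exists_cherry hA
    have h1 : ∀ z, (z = a ∨ z = b) ↔ (z = a' ∨ z = b') := by
      intro z
      have := congrArg (fun s => z ∈ s) hA'
      simpa using this
    obtain ⟨rfl, rfl⟩ : a = a' ∧ b = b' := by
      have h2 := h1 a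
      have h3 := h1 b
      have h4 := h1 a'
      omega
    exact he.trans hf.symm
  | succ m ih =>
    have hR := (ht.isPairing hA hc).1
    obtain ⟨a, b, t', hab, ha, hb, hp, he, hk, hl⟩ := ht.exists_equiv_replaceLeaf hA hc
    obtain ⟨a', b', u', hab', ha', hb', hp', he', hk', hl'⟩ := hu.exists_equiv_replaceLeaf hA hc
    have hkeys : t.readyKeys = u.readyKeys := by
      ext p
      rw [ht.mem_readyKeys_iff (m := m + 1) hc, hu.mem_readyKeys_iff (m := m + 1) hc]
      simp only [h]
    rw [← hkeys] at hk'
    obtain rfl := hk.unique hk'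
    have hct : c ∈ t'.leafLabels := hp.mem_leafLabels.2 (Finset.mem_insert_self _ _)
    have hcu : c ∈ u'.leafLabels := hp'.mem_leafLabels.2 (Finset.mem_insert_self _ _)
    have h1 := siblings_of_equiv_replaceLeaf hct hl
    have h2 := siblings_of_equiv_replaceLeaf hcu hl'
    obtain rfl : b = b' := hR.unique ((h1 a b).2 (Or.inr (Or.inl ⟨rfl, rfl⟩)))
      ((h a b').2 ((h2 a b').2 (Or.inr (Or.inl ⟨rfl, rfl⟩))))
    have hcard := card_insert_erase hA hc ha hb hab
    have hlt := lt_of_mem_insert_erase (a := a) (b := b) hc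
    -- The labels a and b no longer occur in the contracted trees, so the pair can be cancelled from
    -- both relations.
    have hrem : ∀ {s : PlaneTree}, s.IsPlain (insert c ((A.erase a).erase b)) → ∀ x y,
        (s.labelFrom (c + 1) m).Siblings x y → ¬ IsPair a b x y := by
      rintro s hs x y hxy hpair
      have hx := (hs.isPairing hcard hlt).1.mem hxy
      rcases hpair with ⟨rfl, -⟩ | ⟨rfl, -⟩
      · exact notMem_insert_union hc (Or.inl rfl) ha hx
      · exact notMem_insert_union hc (Or.inr rfl) hb hx
    have heq := ih hp hp' hcard hlt fun x y => by
      have h3 := h1 x y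
      have h4 := h2 x y
      have h5 := h x y
      have h6 := hrem hp x y
      have h7 := hrem hp' x y
      tauto
    exact (he.trans (heq.replaceLeaf _ _ _ _)).trans he'.symm

/-- The recursion run backwards: take the pair inside A with least minimum, realise the rest of the
matching by a smaller tree in which c is a leaf, and graft the pair at c. -/
theorem exists_isPlain_siblings_iff {R : ℕ → ℕ → Prop} (hA : A.card = m + 2)
    (hc : ∀ x ∈ A, x < c) (hR : IsPairing R (A ∪ Finset.Ico c (c + m))) :
    ∃ t : PlaneTree, t.IsPlain A ∧ ∀ x y, (t.labelFrom c m).Siblings x y ↔ R x y := by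
  induction m generalizing A c R with
  | zero =>
    obtain ⟨a, b, hab, rfl⟩ := Finset.card_eq_two.1 hA
    refine ⟨node false none (leaf false a) (leaf false b), ⟨?_, rfl, rfl⟩, fun x y => ?_⟩
    · rw [leafLabels, Finset.insert_val_of_notMem (by simpa using hab)]
      rfl
    · simp only [add_zero, Finset.Ico_self, Finset.union_empty] at hR
      have hpair : ∀ {z w}, R z w → (z = a ∨ z = b) ∧ (w = a ∨ w = b) ∧ z ≠ w := fun hzw =>
        ⟨by simpa using hR.mem hzw, by simpa using hR.mem_right hzw, hR.ne hzw⟩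
      obtain ⟨w, hw⟩ := hR.exists_of_mem (x := a) (by simp)
      obtain rfl : w = b := by have := hpair hw; omega
      have hw' := hR.symm hw
      rw [labelFrom_zero]
      simp only [Siblings, rootLabel_leaf, Option.some.injEq, or_false]
      constructor
      · rintro (⟨rfl, rfl⟩ | ⟨rfl, rfl⟩) <;> assumption
      · intro h
        have := hpair h
        omega
  | succ m ih =>
    -- Otherwise `R` would inject the m + 3 elements of A into the m + 1 new labels.
    have hex : ∃ a, a ∈ A ∧ ∃ b ∈ A, a < b ∧ R a b := by
      by_contra! hno
      have hmaps : ∀ x ∈ A, ∃ y ∈ Finset.Ico c (c + (m + 1)), R x y := by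
        intro x hx
        obtain ⟨y, hy⟩ := hR.exists_of_mem (Finset.mem_union_left _ hx)
        rcases Finset.mem_union.1 (hR.mem_right hy) with h1 | h1
        · rcases (hR.ne hy).lt_or_gt with h2 | h2
          · exact (hno x hx y h1 h2 hy).elim
          · exact (hno y h1 x hx h2 (hR.symm hy)).elim
        · exact ⟨y, h1, hy⟩
      choose! f hf1 hf2 using hmaps
      have := Finset.card_le_card_of_injOn f hf1 fun x hx y hy hxy =>
        hR.unique (hR.symm (hf2 x hx)) (hxy ▸ hR.symm (hf2 y hy))
      rw [Nat.card_Ico] at this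
      omega
    classical
    obtain ⟨a, ⟨ha, b, hb, hab, hRab⟩, hmin⟩ : ∃ a, (a ∈ A ∧ ∃ b ∈ A, a < b ∧ R a b) ∧
        ∀ z < a, ¬ (z ∈ A ∧ ∃ b ∈ A, z < b ∧ R z b) :=
      ⟨Nat.find hex, Nat.find_spec hex, fun z hz => Nat.find_min hex hz⟩
    have hcard := card_insert_erase hA hc ha hb hab
    have hlt := lt_of_mem_insert_erase (a := a) (b := b) hc
    have hna := notMem_insert_union (m := m) (a := a) (b := b) hc (Or.inl rfl) ha
    have hnb := notMem_insert_union (m := m) (a := a) (b := b) hc (Or.inr rfl) hb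
    have hR' := (hR.erase hRab).congr (fun x y => Iff.rfl)
      (S' := insert c ((A.erase a).erase b) ∪ Finset.Ico (c + 1) (c + 1 + m)) (by
        rw [union_Ico_eq ha hb, Finset.erase_insert, Finset.erase_insert hnb]
        simp only [Finset.mem_insert, not_or]
        exact ⟨hab.ne, hna⟩)
    obtain ⟨t', ht', hsib⟩ := ih hcard hlt hR'
    have hat : a ∉ t'.leafLabels := fun h =>
      hna (Finset.mem_union_left _ (ht'.mem_leafLabels.1 h))
    have hbt : b ∉ t'.leafLabels := fun h =>
      hnb (Finset.mem_union_left _ (ht'.mem_leafLabels.1 h))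
    have hct : c ∈ t'.leafLabels := ht'.mem_leafLabels.2 (Finset.mem_insert_self _ _)
    have hcA : c ∉ A := fun h => (hc c h).ne rfl
    have hleaf : (t'.replaceLeaf c none a b).leafLabels = A.val := by
      have h1 := leafLabels_replaceLeaf (a := a) (b := b) (y := none) ht'.nodup hct
      refine Multiset.add_left_inj.1 (h1.trans ?_)
      rw [ht'.leafLabels_eq, Finset.insert_val_of_notMem (by simp [hcA]), Finset.erase_val,
        Finset.erase_val]
      change c ::ₘ ((A.val.erase a).erase b) + a ::ₘ b ::ₘ 0 = A.val + c ::ₘ 0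
      rw [Multiset.add_cons, Multiset.add_cons, add_zero, Multiset.add_cons, add_zero,
        Multiset.cons_swap b c, Multiset.cons_swap a c, Multiset.cons_erase, Multiset.cons_erase]
      · exact ha
      · exact (Multiset.mem_erase_of_ne hab.ne').2 hb
    have ht : (t'.replaceLeaf c none a b).IsPlain A :=
      ⟨hleaf, unlabelled_replaceLeaf_none.2 ht'.unlabelled,
        markCount_replaceLeaf.trans ht'.markCount_eq⟩
    -- A pair of sibling leaves of the grafted tree is either {a, b} or comes from `t'`. In the
    -- second case it is an `R`-pair inside A, so by the choice of a its minimum is not below a.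
    have hleast : IsLeast ((t'.replaceLeaf c none a b).readyKeys : Set ℕ) (min a b) := by
      have hsub : ∀ p q, p ∈ A → q ∈ A → t'.Siblings p q → R p q := by
        intro p q hp hq hpq
        have h1 := hc p hp
        have h2 := hc q hq
        exact ((hsib p q).1 ((siblings_labelFrom (by omega) (by omega)).2 hpq)).1
      rw [min_eq_left hab.le]
      have hlow : a ∈ lowerBounds ((t'.replaceLeaf c none a b).readyKeys : Set ℕ) := by
        intro p hp
        obtain ⟨q, hpq, hs⟩ := ht.unlabelled.mem_readyKeys.1 hp
        obtain ⟨h1, h2⟩ := ht.unlabelled.siblings_mem hs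
        rw [ht.mem_leafLabels] at h1 h2
        rcases siblings_replaceLeaf_none hs with h3 | h3
        · have h4 := hsub p q h1 h2 h3
          by_contra h5
          exact hmin p (by omega) ⟨h1, q, h2, lt_of_le_of_ne hpq (hR.ne h4), h4⟩
        · omega
      refine ⟨?_, hlow⟩
      have haux : ∀ s : PlaneTree, c ∈ s.leafLabels → a ∈ (s.replaceLeaf c none a b).readyKeys := by
        intro s hs
        induction s with
        | leaf m x =>
          obtain rfl : c = x := by simpa [leafLabels] using hs
          simp [replaceLeaf, readyKeys, readyKey, hab.le]
        | node m x l r hl hr =>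
          rw [replaceLeaf, mem_readyKeys_node]
          rcases Multiset.mem_add.1 hs with h | h
          · exact Or.inr (Or.inl (hl h))
          · exact Or.inr (Or.inr (hr h))
      exact haux t' hct
    refine ⟨_, ht, fun x y => ?_⟩
    rw [siblings_of_equiv_replaceLeaf hct (a := a) (b := b)]
    · rw [hsib]
      constructor
      · rintro (h | ⟨rfl, rfl⟩ | ⟨rfl, rfl⟩)
        · exact h.1
        · exact hRab
        · exact hR.symm hRab
      · intro h
        by_cases hxy : IsPair a b x y
        · exact Or.inr hxy
        · exact Or.inl ⟨h, hxy⟩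
    · rw [labelFrom_replaceLeaf_none ht'.unlabelled m hat hbt (by rw [ht.size_eq]; omega) hleast]
      exact .refl _

end PlaneTree

/-! ### Marks and labels -/

namespace PlaneTree

/-- Remove all marks. -/
def unmark : PlaneTree → PlaneTree
  | leaf _ a => leaf false a
  | node _ x l r => node false x (unmark l) (unmark r)

/-- Mark exactly the vertices labelled `k`. -/
def markAt (k : ℕ) : PlaneTree → PlaneTree
  | leaf _ a => leaf (a == k) a
  | node _ x l r => node (x == some k) x (markAt k l) (markAt k r)

/-- Remove the labels of all internal vertices. -/
def eraseLabels : PlaneTree → PlaneTree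
  | leaf m a => leaf m a
  | node m _ l r => node m none (eraseLabels l) (eraseLabels r)

/-- The labels of all vertices, with multiplicity. -/
def allLabels (t : PlaneTree) : Multiset ℕ := t.leafLabels + t.internalLabels

/-- Some marked vertex has the label `k`. -/
def IsMarkedAt (k : ℕ) : PlaneTree → Prop
  | leaf m a => m = true ∧ a = k
  | node m x l r => (m = true ∧ x = some k) ∨ (IsMarkedAt k l ∨ IsMarkedAt k r)

theorem mem_allLabels_node {k : ℕ} {m : Bool} {x : Option ℕ} {l r : PlaneTree} :
    k ∈ (node m x l r).allLabels ↔ x = some k ∨ k ∈ l.allLabels ∨ k ∈ r.allLabels := by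
  simp only [allLabels, leafLabels, internalLabels, Multiset.mem_add]
  have : k ∈ (x.elim 0 fun a => {a} : Multiset ℕ) ↔ x = some k := by
    cases x <;> simp [eq_comm]
  rw [this]
  tauto

theorem allLabels_node (m : Bool) (x : Option ℕ) (l r : PlaneTree) :
    (node m x l r).allLabels = (x.elim 0 fun a => {a}) + (l.allLabels + r.allLabels) := by
  simp only [allLabels, leafLabels, internalLabels]
  abel

theorem nodup_allLabels_node {m : Bool} {x : Option ℕ} {l r : PlaneTree}
    (h : (node m x l r).allLabels.Nodup) : l.allLabels.Nodup ∧ r.allLabels.Nodup ∧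
      (∀ k ∈ l.allLabels, k ∉ r.allLabels) ∧
      ∀ k, x = some k → k ∉ l.allLabels ∧ k ∉ r.allLabels := by
  rw [allLabels_node, Multiset.nodup_add, Multiset.nodup_add] at h
  obtain ⟨-, ⟨hl, hr, hd⟩, hd'⟩ := h
  refine ⟨hl, hr, fun k hk => Multiset.disjoint_left.1 hd hk, ?_⟩
  rintro k rfl
  have : k ∉ l.allLabels + r.allLabels := Multiset.disjoint_left.1 hd' (by simp)
  rwa [Multiset.mem_add, not_or] at this

theorem mem_allLabels_of_rootLabel {k : ℕ} {t : PlaneTree} (h : t.rootLabel = some k) :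
    k ∈ t.allLabels := by
  cases t with
  | leaf m a =>
    obtain rfl : a = k := by simpa using h
    simp [allLabels, leafLabels]
  | node m x l r => exact mem_allLabels_node.2 (Or.inl h)

theorem IsMarkedAt.mem_allLabels {k : ℕ} {t : PlaneTree} (h : t.IsMarkedAt k) :
    k ∈ t.allLabels := by
  induction t with
  | leaf m a => exact mem_allLabels_of_rootLabel (congrArg some h.2)
  | node m x l r hl hr =>
    rw [mem_allLabels_node]
    rcases h with h | h | h
    · exact Or.inl h.2
    · exact Or.inr (Or.inl (hl h))
    · exact Or.inr (Or.inr (hr h))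

theorem IsMarkedAt.one_le_markCount {k : ℕ} {t : PlaneTree} (h : t.IsMarkedAt k) :
    1 ≤ t.markCount := by
  induction t with
  | leaf m a => simp [markCount, h.1]
  | node m x l r hl hr =>
    rw [markCount]
    rcases h with h | h | h
    · simp [h.1]
    · have := hl h
      omega
    · have := hr h
      omega

theorem one_le_markCount_of_rootMarked {t : PlaneTree} (h : t.rootMarked = true) :
    1 ≤ t.markCount := by
  cases t with
  | leaf m a =>
    obtain rfl : m = true := h
    simp [markCount]
  | node m x l r =>
    obtain rfl : m = true := h
    simp [markCount]

theorem markAt_eq_self_of_markCount_eq_zero {k : ℕ} {t : PlaneTree} (h : t.markCount = 0)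
    (hk : k ∉ t.allLabels) : t.markAt k = t := by
  induction t with
  | leaf m a =>
    obtain rfl : m = false := by simpa [markCount] using h
    have : a ≠ k := fun e => hk (mem_allLabels_of_rootLabel (congrArg some e))
    simp [markAt, this]
  | node m x l r hl hr =>
    rw [mem_allLabels_node, not_or, not_or] at hk
    simp only [markCount, Nat.add_eq_zero_iff, Bool.toNat_eq_zero] at h
    obtain ⟨rfl, h1, h2⟩ := h
    rw [markAt, hl h1 hk.2.1, hr h2 hk.2.2]
    congr 1
    simpa using hk.1

/-- With distinct labels k belongs to one vertex only, and this vertex has the only mark; so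
position and label of the mark carry the same information. -/
theorem IsMarkedAt.markAt_eq_self {k : ℕ} {t : PlaneTree} (h : t.IsMarkedAt k)
    (hm : t.markCount = 1) (hn : t.allLabels.Nodup) : t.markAt k = t := by
  induction t with
  | leaf m a =>
    obtain ⟨rfl, rfl⟩ := h
    simp [markAt]
  | node m x l r hl hr =>
    obtain ⟨hnl, hnr, hd, hx⟩ := nodup_allLabels_node hn
    rw [markCount] at hm
    rcases h with ⟨rfl, rfl⟩ | h | h
    · obtain ⟨h1, h2⟩ := hx k rfl
      rw [Bool.toNat_true] at hm
      rw [markAt, markAt_eq_self_of_markCount_eq_zero (by omega) h1,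
        markAt_eq_self_of_markCount_eq_zero (by omega) h2]
      simp
    · have h1 := h.one_le_markCount
      have h2 := h.mem_allLabels
      have hxk : x ≠ some k := fun e => (hx k e).1 h2
      obtain rfl : m = false := by rw [← Bool.toNat_eq_zero]; omega
      rw [markAt, hl h (by omega) hnl, markAt_eq_self_of_markCount_eq_zero (by omega) (hd k h2)]
      simpa using hxk
    · have h1 := h.one_le_markCount
      have h2 := h.mem_allLabels
      have hxk : x ≠ some k := fun e => (hx k e).2 h2
      obtain rfl : m = false := by rw [← Bool.toNat_eq_zero]; omega
      rw [markAt, hr h (by omega) hnr,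
        markAt_eq_self_of_markCount_eq_zero (by omega) fun h3 => hd k h3 h2]
      simpa using hxk

theorem IsMarkedAt.eq_of_markAt {k k' : ℕ} {t : PlaneTree} (h : (t.markAt k).IsMarkedAt k') :
    k' = k := by
  induction t with
  | leaf m a =>
    obtain ⟨h1, rfl⟩ := h
    simpa using h1
  | node m x l r hl hr =>
    rcases h with ⟨h1, rfl⟩ | h | h
    · simpa using h1
    · exact hl h
    · exact hr h

theorem isMarkedAt_of_rootMarked {k : ℕ} {t : PlaneTree} (h : t.rootMarked = true)
    (hk : t.rootLabel = some k) : t.IsMarkedAt k := by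
  cases t with
  | leaf m a => exact ⟨h, by simpa using hk⟩
  | node m x l r => exact Or.inl ⟨h, hk⟩

theorem MarkedSiblings.isMarkedAt {k j : ℕ} {t : PlaneTree} (h : t.MarkedSiblings k j) :
    t.IsMarkedAt k := by
  induction t with
  | leaf m a => exact h.elim
  | node m x l r hl hr =>
    rcases h with (h | h) | h | h
    · exact Or.inr (Or.inl (isMarkedAt_of_rootMarked h.1 h.2.1))
    · exact Or.inr (Or.inr (isMarkedAt_of_rootMarked h.1 h.2.1))
    · exact Or.inr (Or.inl (hl h))
    · exact Or.inr (Or.inr (hr h))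

theorem MarkedSiblings.siblings {k j : ℕ} {t : PlaneTree} (h : t.MarkedSiblings k j) :
    t.Siblings k j := by
  induction t with
  | leaf m a => exact h
  | node m x l r hl hr =>
    rcases h with (h | h) | h | h
    · exact Or.inl (Or.inl h.2)
    · exact Or.inl (Or.inr h.2)
    · exact Or.inr (Or.inl (hl h))
    · exact Or.inr (Or.inr (hr h))

theorem AllLabelled.exists_markedSiblings {t : PlaneTree} (h : t.AllLabelled)
    (hm : t.markCount = 1) (hr : t.rootMarked = false) : ∃ k j, t.MarkedSiblings k j := by
  induction t with
  | leaf m a =>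
    obtain rfl : m = false := hr
    simp [markCount] at hm
  | node m x l r ihl ihr =>
    obtain rfl : m = false := hr
    obtain ⟨⟨h1, h2⟩, h3, h4⟩ := h
    obtain ⟨a, ha⟩ := Option.isSome_iff_exists.1 h1
    obtain ⟨b, hb⟩ := Option.isSome_iff_exists.1 h2
    rw [markCount, Bool.toNat_false, zero_add] at hm
    rcases hl : l.rootMarked with _ | _
    · rcases hr : r.rootMarked with _ | _
      · rcases (by omega : l.markCount = 1 ∨ r.markCount = 1) with h5 | h5
        · obtain ⟨k, j, h⟩ := ihl h3 h5 hl
          exact ⟨k, j, Or.inr (Or.inl h)⟩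
        · obtain ⟨k, j, h⟩ := ihr h4 h5 hr
          exact ⟨k, j, Or.inr (Or.inr h)⟩
      · exact ⟨b, a, Or.inl (Or.inr ⟨hr, hb, ha⟩)⟩
    · exact ⟨a, b, Or.inl (Or.inl ⟨hl, ha, hb⟩)⟩

/-! ### The labelling procedure ignores marks -/

section Unmark

variable (t : PlaneTree)

@[simp] theorem rootLabel_unmark : t.unmark.rootLabel = t.rootLabel := by cases t <;> rfl

@[simp] theorem leafLabels_unmark : t.unmark.leafLabels = t.leafLabels := by
  induction t with
  | leaf m a => rfl
  | node m x l r hl hr => rw [unmark, leafLabels, leafLabels, hl, hr]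

@[simp] theorem internalLabels_unmark : t.unmark.internalLabels = t.internalLabels := by
  induction t with
  | leaf m a => rfl
  | node m x l r hl hr => rw [unmark, internalLabels, internalLabels, hl, hr]

@[simp] theorem markCount_unmark : t.unmark.markCount = 0 := by
  induction t with
  | leaf m a => rfl
  | node m x l r hl hr => rw [unmark, markCount, hl, hr]; rfl

theorem siblings_unmark : t.unmark.Siblings = t.Siblings := by
  funext i j
  induction t with
  | leaf m a => rfl
  | node m x l r hl hr => rw [unmark, Siblings, Siblings, hl, hr, rootLabel_unmark, rootLabel_unmark]

theorem allLabelled_unmark : t.unmark.AllLabelled ↔ t.AllLabelled := by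
  induction t with
  | leaf m a => rfl
  | node m x l r hl hr =>
    rw [unmark, AllLabelled, AllLabelled, hl, hr, rootLabel_unmark, rootLabel_unmark]

theorem readyKey_unmark (x : Option ℕ) (l r : PlaneTree) :
    readyKey x l.unmark r.unmark = readyKey x l r := by
  simp [readyKey]

theorem readyKeys_unmark : t.unmark.readyKeys = t.readyKeys := by
  induction t with
  | leaf m a => rfl
  | node m x l r hl hr => rw [unmark, readyKeys, readyKeys, hl, hr, readyKey_unmark]

theorem assign_unmark (key c : ℕ) : t.unmark.assign key c = (t.assign key c).unmark := by
  induction t with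
  | leaf m a => rfl
  | node m x l r hl hr => rw [unmark, assign, assign, unmark, hl, hr, readyKey_unmark]

theorem labelStep_unmark (c : ℕ) : t.unmark.labelStep c = (t.labelStep c).unmark := by
  cases t with
  | leaf m a => rfl
  | node m x l r =>
    simp only [unmark, labelStep, readyKeys_unmark, assign_unmark]
    split <;> rfl

theorem labelFrom_unmark (c m : ℕ) : t.unmark.labelFrom c m = (t.labelFrom c m).unmark := by
  induction m generalizing c t with
  | zero => rfl
  | succ m ih => rw [labelFrom_succ, labelFrom_succ, labelStep_unmark, ih]

theorem size_unmark : t.unmark.size = t.size := by rw [size, size, leafLabels_unmark]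

theorem fullLabelling_unmark : t.unmark.fullLabelling = t.fullLabelling.unmark := by
  rw [fullLabelling, size_unmark]
  exact labelFrom_unmark _ _ _

theorem psi_unmark : t.unmark.psi = t.psi := by
  funext i
  unfold psi
  rw [fullLabelling_unmark, siblings_unmark]

theorem unmark_markAt (k : ℕ) : (t.markAt k).unmark = t.unmark := by
  induction t with
  | leaf m a => rfl
  | node m x l r hl hr => rw [markAt, unmark, unmark, hl, hr]

theorem markAt_unmark (k : ℕ) : t.unmark.markAt k = t.markAt k := by
  induction t with
  | leaf m a => rfl
  | node m x l r hl hr => rw [unmark, markAt, markAt, hl, hr]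

theorem unmark_markRoot : t.markRoot.unmark = t.unmark := by cases t <;> rfl

variable {t}

theorem unmark_eq_self (h : t.markCount = 0) : t.unmark = t := by
  induction t with
  | leaf m a =>
    obtain rfl : m = false := by simpa [markCount] using h
    rfl
  | node m x l r hl hr =>
    simp only [markCount, Nat.add_eq_zero_iff, Bool.toNat_eq_zero] at h
    obtain ⟨rfl, h1, h2⟩ := h
    rw [unmark, hl h1, hr h2]

theorem markRoot_unmark (hm : t.markCount = 1) (h : t.rootMarked = true) :
    t.unmark.markRoot = t := by
  cases t with
  | leaf m a =>
    obtain rfl : m = true := h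
    rfl
  | node m x l r =>
    obtain rfl : m = true := h
    rw [markCount, Bool.toNat_true] at hm
    rw [unmark, markRoot, unmark_eq_self (by omega), unmark_eq_self (by omega)]

theorem markCount_markRoot (h : t.markCount = 0) : t.markRoot.markCount = 1 := by
  cases t with
  | leaf m a => rfl
  | node m x l r =>
    rw [markCount] at h
    rw [markRoot, markCount, Bool.toNat_true]
    omega

theorem Equiv.markRoot {u : PlaneTree} (h : t.Equiv u) : t.markRoot.Equiv u.markRoot := by
  cases h with
  | leaf m a => exact .refl _
  | node m x hl hr => exact .node _ _ hl hr
  | swap m x hl hr => exact .swap _ _ hl hr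

theorem Equiv.markAt {u : PlaneTree} (k : ℕ) (h : t.Equiv u) :
    (t.markAt k).Equiv (u.markAt k) := by
  induction h with
  | leaf m a => exact .refl _
  | node m x _ _ hl hr => exact .node _ _ hl hr
  | swap m x _ _ hl hr => exact .swap _ _ hl hr

theorem Equiv.eraseLabels {u : PlaneTree} (h : t.Equiv u) : t.eraseLabels.Equiv u.eraseLabels := by
  induction h with
  | leaf m a => exact .refl _
  | node m x _ _ hl hr => exact .node _ _ hl hr
  | swap m x _ _ hl hr => exact .swap _ _ hl hr

end Unmark

/-! ### Recovering a tree from its labelled version -/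

section EraseLabels

variable (t : PlaneTree)

@[simp] theorem rootMarked_eraseLabels : t.eraseLabels.rootMarked = t.rootMarked := by
  cases t <;> rfl

@[simp] theorem rootInternal_eraseLabels : t.eraseLabels.rootInternal = t.rootInternal := by
  cases t <;> rfl

@[simp] theorem leafLabels_eraseLabels : t.eraseLabels.leafLabels = t.leafLabels := by
  induction t with
  | leaf m a => rfl
  | node m x l r hl hr => rw [eraseLabels, leafLabels, leafLabels, hl, hr]

theorem unlabelled_eraseLabels : t.eraseLabels.Unlabelled := by
  induction t with
  | leaf m a => rfl
  | node m x l r hl hr => exact unlabelled_node.2 ⟨rfl, hl, hr⟩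

@[simp] theorem markCount_eraseLabels : t.eraseLabels.markCount = t.markCount := by
  induction t with
  | leaf m a => rfl
  | node m x l r hl hr => rw [eraseLabels, markCount, markCount, hl, hr]

@[simp] theorem quasiSingleCount_eraseLabels :
    t.eraseLabels.quasiSingleCount = t.quasiSingleCount := by
  induction t with
  | leaf m a => rfl
  | node m x l r hl hr => simp [eraseLabels, quasiSingleCount, hl, hr, quasiSingleBeside]

theorem eraseLabels_assign (key c : ℕ) : (t.assign key c).eraseLabels = t.eraseLabels := by
  induction t with
  | leaf m a => rfl
  | node m x l r hl hr => rw [assign, eraseLabels, eraseLabels, hl, hr]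

theorem eraseLabels_labelStep (c : ℕ) : (t.labelStep c).eraseLabels = t.eraseLabels := by
  cases t with
  | leaf m a => rfl
  | node m x l r =>
    rw [labelStep]
    split
    · rw [eraseLabels, eraseLabels, eraseLabels_assign, eraseLabels_assign]
    · rfl

theorem eraseLabels_labelFrom (c m : ℕ) : (t.labelFrom c m).eraseLabels = t.eraseLabels := by
  induction m generalizing c t with
  | zero => rfl
  | succ m ih => rw [labelFrom_succ, ih, eraseLabels_labelStep]

theorem rootLabel_labelFrom (c m : ℕ) : (t.labelFrom c m).rootLabel = t.rootLabel := by
  induction m generalizing c t with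
  | zero => rfl
  | succ m ih =>
    rw [labelFrom_succ, ih]
    cases t with
    | leaf m a => rfl
    | node m x l r =>
      rw [labelStep]
      split <;> rfl

theorem eraseLabels_unmark : t.unmark.eraseLabels = t.eraseLabels.unmark := by
  induction t with
  | leaf m a => rfl
  | node m x l r hl hr => rw [eraseLabels, unmark, unmark, eraseLabels, hl, hr]

variable {t}

theorem Unlabelled.eraseLabels_eq (h : t.Unlabelled) : t.eraseLabels = t := by
  induction t with
  | leaf m a => rfl
  | node m x l r hl hr =>
    obtain ⟨rfl, h1, h2⟩ := unlabelled_node.1 h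
    rw [eraseLabels, hl h1, hr h2]

theorem Unlabelled.eraseLabels_fullLabelling (h : t.Unlabelled) :
    t.fullLabelling.eraseLabels = t :=
  (eraseLabels_labelFrom _ _ _).trans h.eraseLabels_eq

/-- Marks and internal labels are independent decorations of one plane tree; each of the two
operations forgets just one of them. -/
theorem eq_of_unmark_eq_of_eraseLabels_eq {u : PlaneTree} (h1 : t.unmark = u.unmark)
    (h2 : t.eraseLabels = u.eraseLabels) : t = u := by
  induction t generalizing u with
  | leaf m a =>
    cases u with
    | leaf m' a' => exact h2
    | node => simp [eraseLabels] at h2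
  | node m x l r hl hr =>
    cases u with
    | leaf => simp [eraseLabels] at h2
    | node m' x' l' r' =>
      simp only [unmark, eraseLabels, node.injEq, true_and] at h1 h2
      rw [h1.1, h2.1, hl h1.2.1 h2.2.1, hr h1.2.2 h2.2.2]

theorem leafLabels_markAt (k : ℕ) (t : PlaneTree) : (t.markAt k).leafLabels = t.leafLabels := by
  rw [← leafLabels_unmark, unmark_markAt, leafLabels_unmark]

theorem markCount_markAt (k : ℕ) (t : PlaneTree) :
    (t.markAt k).markCount = t.allLabels.count k := by
  induction t with
  | leaf m a =>
    by_cases h : a = k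
    · simp [markAt, markCount, allLabels, leafLabels, internalLabels, h]
    · simp [markAt, markCount, allLabels, leafLabels, internalLabels, h,
        Ne.symm h]
  | node m x l r hl hr =>
    rw [markAt, markCount, hl, hr, allLabels_node, Multiset.count_add, Multiset.count_add]
    congr 1
    cases x with
    | none => simp
    | some a =>
      by_cases h : a = k
      · simp [h]
      · simp [h, Ne.symm h]

end EraseLabels

/-! ### Sibling subtrees -/

/-- `Adjacent v t u`: the trees `t` and `u` are the subtrees of `v` below two sibling vertices. -/
def Adjacent : PlaneTree → PlaneTree → PlaneTree → Prop
  | leaf _ _, _, _ => False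
  | node _ _ l r, t, u =>
      ((l = t ∧ r = u) ∨ (r = t ∧ l = u)) ∨ (Adjacent l t u ∨ Adjacent r t u)

section Adjacent

variable {t u v : PlaneTree}

theorem siblings_iff {a b : ℕ} : v.Siblings a b ↔
    ∃ t u, v.Adjacent t u ∧ t.rootLabel = some a ∧ u.rootLabel = some b := by
  induction v with
  | leaf m x => simp [Siblings, Adjacent]
  | node m x l r hl hr =>
    simp only [Siblings, hl, hr, Adjacent]
    constructor
    · rintro ((⟨h1, h2⟩ | ⟨h1, h2⟩) | ⟨t, u, h, h'⟩ | ⟨t, u, h, h'⟩)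
      · exact ⟨l, r, Or.inl (Or.inl ⟨rfl, rfl⟩), h1, h2⟩
      · exact ⟨r, l, Or.inl (Or.inr ⟨rfl, rfl⟩), h1, h2⟩
      · exact ⟨t, u, Or.inr (Or.inl h), h'⟩
      · exact ⟨t, u, Or.inr (Or.inr h), h'⟩
    · rintro ⟨t, u, (⟨rfl, rfl⟩ | ⟨rfl, rfl⟩) | h | h, h'⟩
      · exact Or.inl (Or.inl h')
      · exact Or.inl (Or.inr h')
      · exact Or.inr (Or.inl ⟨t, u, h, h'⟩)
      · exact Or.inr (Or.inr ⟨t, u, h, h'⟩)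

theorem Adjacent.symm (h : v.Adjacent t u) : v.Adjacent u t := by
  induction v with
  | leaf m x => exact h
  | node m x l r hl hr =>
    rcases h with (h | h) | h | h
    · exact Or.inl (Or.inr h.symm)
    · exact Or.inl (Or.inl h.symm)
    · exact Or.inr (Or.inl (hl h))
    · exact Or.inr (Or.inr (hr h))

theorem Adjacent.mem_allLabels {a : ℕ} (h : v.Adjacent t u) (ha : t.rootLabel = some a) :
    a ∈ v.allLabels := by
  induction v with
  | leaf m x => exact h.elim
  | node m x l r hl hr =>
    rw [mem_allLabels_node]
    rcases h with (⟨rfl, rfl⟩ | ⟨rfl, rfl⟩) | h | h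
    · exact Or.inr (Or.inl (mem_allLabels_of_rootLabel ha))
    · exact Or.inr (Or.inr (mem_allLabels_of_rootLabel ha))
    · exact Or.inr (Or.inl (hl h))
    · exact Or.inr (Or.inr (hr h))

theorem Adjacent.rootLabel_mem {a : ℕ} (h : v.Adjacent t u) (ha : t.rootLabel = some a) :
    (t.rootInternal = true → a ∈ v.internalLabels) ∧
      (t.rootInternal = false → a ∈ v.leafLabels) := by
  induction v with
  | leaf m x => exact h.elim
  | node m x l r hl hr =>
    have key : (t.rootInternal = true → a ∈ t.internalLabels) ∧
        (t.rootInternal = false → a ∈ t.leafLabels) := by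
      cases t with
      | leaf m x =>
        obtain rfl : x = a := by simpa using ha
        simp [leafLabels]
      | node m x l r =>
        obtain rfl : x = some a := ha
        simp [internalLabels]
    simp only [internalLabels, leafLabels, Multiset.mem_add]
    rcases h with (⟨rfl, rfl⟩ | ⟨rfl, rfl⟩) | h | h
    · tauto
    · tauto
    · have := hl h
      tauto
    · have := hr h
      tauto

theorem Adjacent.exists_rootLabel (h : v.Adjacent t u) (hv : v.AllLabelled) :
    ∃ a, t.rootLabel = some a := by
  induction v with
  | leaf m x => exact h.elim
  | node m x l r hl hr =>
    obtain ⟨⟨h1, h2⟩, h3, h4⟩ := hv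
    rcases h with (⟨rfl, rfl⟩ | ⟨rfl, rfl⟩) | h | h
    · exact Option.isSome_iff_exists.1 h1
    · exact Option.isSome_iff_exists.1 h2
    · exact hl h h3
    · exact hr h h4

theorem Adjacent.not_mem_of_child {a : ℕ} {s : PlaneTree} (hn : s.allLabels.Nodup)
    (ha : s.rootLabel = some a) (h : s.Adjacent t u) : t.rootLabel ≠ some a := by
  intro ht
  cases s with
  | leaf m x => exact h
  | node m x l r =>
    obtain rfl : x = some a := ha
    obtain ⟨-, -, -, hx⟩ := nodup_allLabels_node hn
    obtain ⟨h1, h2⟩ := hx a rfl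
    rcases h with (⟨rfl, rfl⟩ | ⟨rfl, rfl⟩) | h | h
    · exact h1 (mem_allLabels_of_rootLabel ht)
    · exact h2 (mem_allLabels_of_rootLabel ht)
    · exact h1 (h.mem_allLabels ht)
    · exact h2 (h.mem_allLabels ht)

/-- Distinct labels put both occurrences of a on the same side of each vertex. A vertex and one of
its proper descendants cannot share a label, so the two occurrences are one vertex, with one
sibling. -/
theorem Adjacent.eq_of_rootLabel_eq {t' u' : PlaneTree} {a : ℕ} (hn : v.allLabels.Nodup)
    (h : v.Adjacent t u) (h' : v.Adjacent t' u') (ht : t.rootLabel = some a)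
    (ht' : t'.rootLabel = some a) : t = t' ∧ u = u' := by
  induction v with
  | leaf m x => exact h.elim
  | node m x l r hl hr =>
    obtain ⟨hnl, hnr, hd, -⟩ := nodup_allLabels_node hn
    have side : ∀ {t u : PlaneTree}, t.rootLabel = some a → (node m x l r).Adjacent t u →
        (a ∈ l.allLabels ∧ ((l = t ∧ r = u) ∨ l.Adjacent t u)) ∨
          (a ∈ r.allLabels ∧ ((r = t ∧ l = u) ∨ r.Adjacent t u)) := by
      rintro t u ht ((⟨rfl, rfl⟩ | ⟨rfl, rfl⟩) | h | h)
      · exact Or.inl ⟨mem_allLabels_of_rootLabel ht, Or.inl ⟨rfl, rfl⟩⟩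
      · exact Or.inr ⟨mem_allLabels_of_rootLabel ht, Or.inl ⟨rfl, rfl⟩⟩
      · exact Or.inl ⟨h.mem_allLabels ht, Or.inr h⟩
      · exact Or.inr ⟨h.mem_allLabels ht, Or.inr h⟩
    rcases side ht h with ⟨h1, h2⟩ | ⟨h1, h2⟩ <;> rcases side ht' h' with ⟨h3, h4⟩ | ⟨h3, h4⟩
    · rcases h2 with ⟨rfl, rfl⟩ | h2 <;> rcases h4 with ⟨rfl, rfl⟩ | h4
      · exact ⟨rfl, rfl⟩
      · exact (h4.not_mem_of_child hnl ht ht').elim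
      · exact (h2.not_mem_of_child hnl ht' ht).elim
      · exact hl hnl h2 h4
    · exact (hd a h1 h3).elim
    · exact (hd a h3 h1).elim
    · rcases h2 with ⟨rfl, rfl⟩ | h2 <;> rcases h4 with ⟨rfl, rfl⟩ | h4
      · exact ⟨rfl, rfl⟩
      · exact (h4.not_mem_of_child hnr ht ht').elim
      · exact (h2.not_mem_of_child hnr ht' ht).elim
      · exact hr hnr h2 h4

/-- In a tree with one mark, this shows that a marked root excludes marks on all other vertices. -/
theorem Adjacent.markCount_le (h : v.Adjacent t u) :
    v.rootMarked.toNat + t.markCount ≤ v.markCount := by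
  induction v with
  | leaf m x => exact h.elim
  | node m x l r hl hr =>
    rw [markCount, rootMarked_node]
    rcases h with (⟨rfl, rfl⟩ | ⟨rfl, rfl⟩) | h | h
    · omega
    · omega
    · have := hl h
      omega
    · have := hr h
      omega

theorem Adjacent.rootMarked_markAt {k : ℕ} (h : (v.markAt k).Adjacent t u) :
    t.rootMarked = true ↔ t.rootLabel = some k := by
  have key : ∀ s : PlaneTree, (s.markAt k).rootMarked = true ↔ (s.markAt k).rootLabel = some k := by
    intro s
    cases s <;> simp [markAt]
  induction v with
  | leaf m x => exact h.elim
  | node m x l r hl hr =>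
    rcases h with (⟨rfl, rfl⟩ | ⟨rfl, rfl⟩) | h | h
    · exact key l
    · exact key r
    · exact hl h
    · exact hr h

/-- The labels of the quasi-single leaves, with multiplicity. -/
def quasiSingleLabels : PlaneTree → Multiset ℕ
  | leaf _ _ => 0
  | node _ _ l r => ((if quasiSingleBeside l r then l.leafLabels else 0) +
      (if quasiSingleBeside r l then r.leafLabels else 0)) +
      (quasiSingleLabels l + quasiSingleLabels r)

theorem card_quasiSingleLabels (t : PlaneTree) :
    t.quasiSingleLabels.card = t.quasiSingleCount := by
  have key : ∀ l r : PlaneTree, (if quasiSingleBeside l r then l.leafLabels else 0).card =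
      (quasiSingleBeside l r).toNat := by
    intro l r
    cases l with
    | leaf m a => split <;> simp_all [leafLabels]
    | node => simp [quasiSingleBeside]
  induction t with
  | leaf m a => rfl
  | node m x l r hl hr =>
    rw [quasiSingleLabels, quasiSingleCount, Multiset.card_add, Multiset.card_add,
      Multiset.card_add, key, key, hl, hr]

theorem quasiSingleLabels_le (t : PlaneTree) : t.quasiSingleLabels ≤ t.leafLabels := by
  induction t with
  | leaf m a => exact Multiset.zero_le _
  | node m x l r hl hr =>
    have key : ∀ l r : PlaneTree, l.quasiSingleLabels ≤ l.leafLabels →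
        (if quasiSingleBeside l r then l.leafLabels else 0) + l.quasiSingleLabels ≤
          l.leafLabels := by
      intro l r h
      cases l with
      | leaf m a =>
        rw [quasiSingleLabels, add_zero]
        split
        · exact le_rfl
        · exact Multiset.zero_le _
      | node => simpa [quasiSingleBeside] using h
    rw [quasiSingleLabels, leafLabels, add_add_add_comm]
    exact add_le_add (key l r hl) (key r l hr)

theorem mem_quasiSingleLabels {i : ℕ} : i ∈ v.quasiSingleLabels ↔
    ∃ t u, v.Adjacent t u ∧ quasiSingleBeside t u = true ∧ t.rootLabel = some i := by
  have key : ∀ l r : PlaneTree, i ∈ (if quasiSingleBeside l r then l.leafLabels else 0) ↔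
      quasiSingleBeside l r = true ∧ l.rootLabel = some i := by
    intro l r
    cases l with
    | leaf m a =>
      split <;> rename_i h
      · simp [leafLabels, h, @eq_comm _ i]
      · simp [h]
    | node => simp [quasiSingleBeside]
  induction v with
  | leaf m x => simp [quasiSingleLabels, Adjacent]
  | node m x l r hl hr =>
    simp only [quasiSingleLabels, Multiset.mem_add, key, hl, hr, Adjacent]
    constructor
    · rintro ((h | h) | ⟨t, u, h, h'⟩ | ⟨t, u, h, h'⟩)
      · exact ⟨l, r, Or.inl (Or.inl ⟨rfl, rfl⟩), h⟩
      · exact ⟨r, l, Or.inl (Or.inr ⟨rfl, rfl⟩), h⟩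
      · exact ⟨t, u, Or.inr (Or.inl h), h'⟩
      · exact ⟨t, u, Or.inr (Or.inr h), h'⟩
    · rintro ⟨t, u, (⟨rfl, rfl⟩ | ⟨rfl, rfl⟩) | h | h, h'⟩
      · exact Or.inl (Or.inl h')
      · exact Or.inl (Or.inr h')
      · exact Or.inr (Or.inl ⟨t, u, h, h'⟩)
      · exact Or.inr (Or.inr ⟨t, u, h, h'⟩)

end Adjacent

end PlaneTree

/-! ### Adding a pair to a matching -/

/-- Replace the pair `{k, π k}` by the pairs `{k, b}` and `{π k, a}`. -/
def splitPair (π : ℕ → ℕ) (k a b : ℕ) : ℕ → ℕ :=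
  PlaneTree.joinPair (PlaneTree.joinPair π k b) (π k) a

theorem joinPair_apply (π : ℕ → ℕ) (a b i : ℕ) :
    PlaneTree.joinPair π a b i = if i = b then a else if i = a then b else π i := by
  simp only [PlaneTree.joinPair, Function.update_apply]

theorem splitPair_apply (π : ℕ → ℕ) (k a b i : ℕ) :
    splitPair π k a b i = if i = a then π k else if i = π k then a else if i = b then k else
      if i = k then b else π i := by
  simp only [splitPair, joinPair_apply]

/-! ### From matchings of [N] to matchings of [N + 2] -/

section Matchings

variable {N : ℕ} {π ρ : ℕ → ℕ}

theorem IsMatchingOn.joinPair (h : IsMatchingOn N π) :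
    IsMatchingOn (N + 2) (PlaneTree.joinPair π (N + 1) (N + 2)) := by
  obtain ⟨h1, h2, h3, h4⟩ := h
  simp only [Finset.mem_Icc] at h1 h2 h3 h4
  constructor <;> intro i hi <;> simp only [Finset.mem_Icc] at hi ⊢ <;>
    have h1 := h1 i <;> have h2 := h2 i <;> have h3 := h3 i <;> have h4 := h4 i <;>
    simp only [joinPair_apply] <;> split_ifs <;> omega

theorem IsMatchingOn.splitPair (h : IsMatchingOn N π) {k : ℕ} (hk : k ∈ Finset.Icc 1 N) :
    IsMatchingOn (N + 2) (splitPair π k (N + 1) (N + 2)) := by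
  have hk1 := h.mapsTo k hk
  have hk2 := h.involutive k hk
  have hk3 := h.ne_self k hk
  obtain ⟨h1, h2, h3, h4⟩ := h
  simp only [Finset.mem_Icc] at h1 h2 h3 h4 hk hk1
  constructor <;> intro i hi <;> simp only [Finset.mem_Icc] at hi ⊢ <;>
    have h1 := h1 i <;> have h2 := h2 i <;> have h3 := h3 i <;> have h4 := h4 i <;>
    simp only [splitPair_apply] <;> split_ifs <;> first | omega | grind

theorem IsMatchingOn.exists_joinPair (h : IsMatchingOn (N + 2) ρ) (hN : ρ (N + 2) = N + 1) :
    ∃ π, IsMatchingOn N π ∧ ρ = PlaneTree.joinPair π (N + 1) (N + 2) := by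
  have ha := h.involutive (N + 2) (by simp)
  rw [hN] at ha
  obtain ⟨h1, h2, h3, h4⟩ := h
  simp only [Finset.mem_Icc] at h1 h2 h3 h4
  refine ⟨fun i => if i = N + 1 ∨ i = N + 2 then i else ρ i, ?_, ?_⟩
  · constructor <;> intro i hi <;> simp only [Finset.mem_Icc] at hi ⊢ <;>
      have h1 := h1 i <;> have h2 := h2 i <;> have h3 := h3 i <;> have h4 := h4 i <;> grind
  · funext i
    rw [joinPair_apply]
    grind

theorem IsMatchingOn.exists_splitPair (h : IsMatchingOn (N + 2) ρ) (hN : ρ (N + 2) ≠ N + 1) :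
    ∃ π k, IsMatchingOn N π ∧ k ∈ Finset.Icc 1 N ∧ ρ = _root_.splitPair π k (N + 1) (N + 2) := by
  have ha1 := h.mapsTo (N + 1) (by simp)
  have ha2 := h.involutive (N + 1) (by simp)
  have ha3 := h.ne_self (N + 1) (by simp)
  have hb1 := h.mapsTo (N + 2) (by simp)
  have hb2 := h.involutive (N + 2) (by simp)
  have hb3 := h.ne_self (N + 2) (by simp)
  obtain ⟨h1, h2, h3, h4⟩ := h
  simp only [Finset.mem_Icc] at h1 h2 h3 h4 ha1 hb1 ⊢
  generalize hl : ρ (N + 1) = l at *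
  generalize hk : ρ (N + 2) = k at *
  have hkN : 1 ≤ k ∧ k ≤ N := by omega
  have hlN : l ≠ N + 2 := by
    rintro rfl
    omega
  have hlN : 1 ≤ l ∧ l ≤ N := by omega
  have hkl : k ≠ l := by
    rintro rfl
    omega
  -- The partners k of N + 2 and l of N + 1 are joined to each other; elsewhere in [N] nothing
  -- changes, and the two last points become outside points.
  refine ⟨fun i => if i = k then l else if i = l then k else if i = N + 1 ∨ i = N + 2 then i
    else ρ i, k, ?_, hkN, ?_⟩
  · constructor <;> intro i hi <;> simp only [Finset.mem_Icc] at hi ⊢ <;>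
      have h1 := h1 i <;> have h2 := h2 i <;> have h3 := h3 i <;> have h4 := h4 i <;> grind
  · funext i
    rw [splitPair_apply]
    grind

theorem joinPair_injective {π' : ℕ → ℕ} (h : IsMatchingOn N π) (h' : IsMatchingOn N π')
    (he : PlaneTree.joinPair π (N + 1) (N + 2) = PlaneTree.joinPair π' (N + 1) (N + 2)) :
    π = π' := by
  funext i
  have h1 := congrFun he i
  rw [joinPair_apply, joinPair_apply] at h1
  by_cases hi : i ∈ Finset.Icc 1 N
  · rw [Finset.mem_Icc] at hi
    rwa [if_neg (by omega), if_neg (by omega), if_neg (by omega), if_neg (by omega)] at h1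
  · rw [h.outside i hi, h'.outside i hi]

theorem splitPair_last (h : IsMatchingOn N π) {k : ℕ} (hk : k ∈ Finset.Icc 1 N) :
    splitPair π k (N + 1) (N + 2) (N + 2) = k := by
  have hk1 := Finset.mem_Icc.1 (h.mapsTo k hk)
  rw [splitPair_apply, if_neg (by omega), if_neg (by omega), if_pos rfl]

/-- The images of N + 2 and N + 1 give back k and its former partner; all other values are those of
the original matching. -/
theorem splitPair_injective {π' : ℕ → ℕ} {k k' : ℕ} (h : IsMatchingOn N π)
    (h' : IsMatchingOn N π') (hk : k ∈ Finset.Icc 1 N) (hk' : k' ∈ Finset.Icc 1 N)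
    (he : splitPair π k (N + 1) (N + 2) = splitPair π' k' (N + 1) (N + 2)) :
    π = π' ∧ k = k' := by
  have h1 := congrFun he (N + 2)
  rw [splitPair_last h hk, splitPair_last h' hk'] at h1
  subst h1
  have h2 := congrFun he (N + 1)
  rw [splitPair_apply, splitPair_apply, if_pos rfl, if_pos rfl] at h2
  refine ⟨?_, rfl⟩
  have hk2 := h.involutive k hk
  have hk2' := h'.involutive k hk
  funext i
  have h3 := congrFun he i
  rw [splitPair_apply, splitPair_apply] at h3
  by_cases hi : i ∈ Finset.Icc 1 N
  · rw [Finset.mem_Icc] at hi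
    by_cases h4 : i = k
    · rw [h4, h2]
    · by_cases h5 : i = π k
      · rw [h5, hk2, h2, hk2']
      · rwa [if_neg (by omega), if_neg h5, if_neg (by omega), if_neg h4, if_neg (by omega),
          if_neg (h2 ▸ h5), if_neg (by omega), if_neg h4] at h3
  · rw [h.outside i hi, h'.outside i hi]

theorem IsMatchingOn.isPairing (h : IsMatchingOn N π) :
    IsPairing (fun i j => i ∈ Finset.Icc 1 N ∧ π i = j) (Finset.Icc 1 N) := by
  refine ⟨?_, fun h => h.1, fun hx => ⟨_, hx, rfl⟩, ?_, ?_⟩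
  · rintro x y ⟨hx, rfl⟩
    exact ⟨h.mapsTo x hx, h.involutive x hx⟩
  · rintro x y z ⟨-, rfl⟩ ⟨-, rfl⟩
    rfl
  · rintro x y ⟨hx, hy⟩
    exact fun e => h.ne_self x hx (hy.trans e.symm)

end Matchings

/-! ### The map `psi` on unmarked trees -/

namespace PlaneTree

/-- Uniqueness of the sibling makes the choice in `psi` immaterial. -/
theorem psi_eq_of_siblings {t : PlaneTree} {S : Finset ℕ}
    (h : IsPairing t.fullLabelling.Siblings S) (i j : ℕ) :
    t.fullLabelling.Siblings i j ↔ i ∈ S ∧ t.psi i = j := by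
  unfold psi
  constructor
  · intro hij
    have hex : ∃ j, t.fullLabelling.Siblings i j := ⟨j, hij⟩
    rw [dif_pos hex]
    exact ⟨h.mem hij, h.unique hex.choose_spec hij⟩
  · rintro ⟨hi, hj⟩
    have hex := h.exists_of_mem hi
    rw [dif_pos hex] at hj
    rw [← hj]
    exact hex.choose_spec

theorem psi_eq_self {t : PlaneTree} {S : Finset ℕ}
    (h : IsPairing t.fullLabelling.Siblings S) {i : ℕ} (hi : i ∉ S) : t.psi i = i := by
  unfold psi
  rw [dif_neg]
  rintro ⟨j, hj⟩
  exact hi (h.mem hj)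

theorem isMatchingOn_psi {t : PlaneTree} {N : ℕ}
    (h : IsPairing t.fullLabelling.Siblings (Finset.Icc 1 N)) : IsMatchingOn N t.psi := by
  have key := psi_eq_of_siblings h
  refine ⟨fun i hi => ?_, fun i hi => ?_, fun i hi => ?_, fun i hi => psi_eq_self h hi⟩
  · exact h.mem_right ((key i _).2 ⟨hi, rfl⟩)
  · exact ((key _ i).1 (h.symm ((key i _).2 ⟨hi, rfl⟩))).2
  · exact (h.ne ((key i _).2 ⟨hi, rfl⟩)).symm

/-- Labelled binary trees with marks, on plane representatives. -/
structure IsLabelledTree (t : PlaneTree) (n : ℕ) : Prop where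
  leafLabels_eq : t.leafLabels = (Finset.Icc 1 n).val
  unlabelled : t.Unlabelled

theorem IsLabelledTree.isPlain_unmark {t : PlaneTree} {n : ℕ} (h : t.IsLabelledTree n) :
    t.unmark.IsPlain (Finset.Icc 1 n) :=
  ⟨by rw [leafLabels_unmark, h.leafLabels_eq], by
    unfold Unlabelled; rw [internalLabels_unmark]; exact h.unlabelled, markCount_unmark t⟩

theorem IsLabelledTree.size_eq {t : PlaneTree} {n : ℕ} (h : t.IsLabelledTree n) : t.size = n := by
  rw [size, h.leafLabels_eq]
  exact Nat.card_Icc 1 n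

theorem IsPlain.exists_eq_leaf {t : PlaneTree} (h : t.IsPlain (Finset.Icc 1 1)) :
    t = leaf false 1 := by
  cases t with
  | leaf m a =>
    obtain rfl : m = false := by simpa [markCount] using h.markCount_eq
    have : a ∈ Finset.Icc 1 1 := h.mem_leafLabels.1 (by simp [leafLabels])
    obtain rfl : a = 1 := by simpa using this
    rfl
  | node m x l r =>
    have hi := h.unlabelled.readyKeys_nonempty (t := node m x l r) rfl
    obtain ⟨p, hp⟩ := hi
    obtain ⟨q, -, hs⟩ := h.unlabelled.mem_readyKeys.1 hp
    have h1 := h.size_eq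
    have hpos : ∀ u : PlaneTree, 1 ≤ u.size := by
      intro u
      induction u with
      | leaf m x => exact le_rfl
      | node m x l r hl hr =>
        rw [size_node]
        omega
    have h2 := hpos l
    have h3 := hpos r
    rw [size_node, Nat.card_Icc] at h1
    omega

theorem fullLabelling_eq_labelFrom {t : PlaneTree} {n : ℕ} (h : t.size = n) :
    t.fullLabelling = t.labelFrom (n + 1) (n - 2) := by
  subst h
  rfl

theorem Icc_union_Ico {n : ℕ} (hn : 2 ≤ n) :
    Finset.Icc 1 n ∪ Finset.Ico (n + 1) (n + 1 + (n - 2)) = Finset.Icc 1 (2 * n - 2) := by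
  ext i
  simp only [Finset.mem_union, Finset.mem_Icc, Finset.mem_Ico]
  omega

theorem IsPlain.fullLabelling {t : PlaneTree} {n : ℕ} (h : t.IsPlain (Finset.Icc 1 n))
    (hn : 1 ≤ n) : IsPairing t.fullLabelling.Siblings (Finset.Icc 1 (2 * n - 2)) ∧
      t.fullLabelling.internalLabels = (Finset.Ico (n + 1) (2 * n - 1)).val ∧
      t.fullLabelling.AllLabelled := by
  have hs : t.size = n := by rw [h.size_eq, Nat.card_Icc, Nat.add_sub_cancel]
  rcases hn.eq_or_lt with rfl | hn
  · obtain rfl := h.exists_eq_leaf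
    exact ⟨⟨fun h => h, fun h => h.elim, fun h => by simp at h, fun h => h.elim, fun h => h.elim⟩,
      rfl, trivial⟩
  · obtain ⟨h1, h2, h3⟩ := h.isPairing (m := n - 2) (c := n + 1)
      (by rw [Nat.card_Icc]; omega) (fun x hx => by rw [Finset.mem_Icc] at hx; omega)
    rw [fullLabelling_eq_labelFrom hs]
    rw [Icc_union_Ico hn] at h1
    refine ⟨h1, ?_, h3⟩
    rw [h2]
    congr 2
    omega

theorem IsPlain.equiv_of_psi_eq {t u : PlaneTree} {n : ℕ} (ht : t.IsPlain (Finset.Icc 1 n))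
    (hu : u.IsPlain (Finset.Icc 1 n)) (hn : 1 ≤ n) (h : t.psi = u.psi) : t.Equiv u := by
  have h1 := psi_eq_of_siblings (ht.fullLabelling hn).1
  have h2 := psi_eq_of_siblings (hu.fullLabelling hn).1
  have hst : t.size = n := by rw [ht.size_eq, Nat.card_Icc, Nat.add_sub_cancel]
  have hsu : u.size = n := by rw [hu.size_eq, Nat.card_Icc, Nat.add_sub_cancel]
  rcases hn.eq_or_lt with rfl | hn
  · rw [ht.exists_eq_leaf, hu.exists_eq_leaf]
    exact .refl _
  · refine ht.equiv_of_siblings_eq hu (m := n - 2) (c := n + 1)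
      (by rw [Nat.card_Icc]; omega) (fun x hx => by rw [Finset.mem_Icc] at hx; omega)
      fun x y => ?_
    rw [← fullLabelling_eq_labelFrom hst, ← fullLabelling_eq_labelFrom hsu, h1, h2, h]

theorem exists_isPlain_psi_eq {π : ℕ → ℕ} {n : ℕ} (hn : 1 ≤ n) (h : IsMatchingOn (2 * n - 2) π) :
    ∃ t : PlaneTree, t.IsPlain (Finset.Icc 1 n) ∧ t.psi = π := by
  rcases hn.eq_or_lt with rfl | hn'
  · refine ⟨leaf false 1, ⟨rfl, rfl, rfl⟩, ?_⟩
    funext i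
    rw [h.outside i (by simp), psi, dif_neg]
    rintro ⟨j, hj⟩
    exact hj
  · obtain ⟨t, ht, hs⟩ := exists_isPlain_siblings_iff (A := Finset.Icc 1 n) (m := n - 2)
      (c := n + 1) (by rw [Nat.card_Icc]; omega)
      (fun x hx => by rw [Finset.mem_Icc] at hx; omega)
      (h.isPairing.congr (fun _ _ => Iff.rfl) (Icc_union_Ico hn'))
    refine ⟨t, ht, ?_⟩
    have hp := (ht.fullLabelling hn).1
    have h1 := psi_eq_of_siblings hp
    have hst : t.size = n := by rw [ht.size_eq, Nat.card_Icc, Nat.add_sub_cancel]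
    funext i
    by_cases hi : i ∈ Finset.Icc 1 (2 * n - 2)
    · refine ((h1 i _).1 ?_).2
      rw [fullLabelling_eq_labelFrom hst, hs]
      exact ⟨hi, rfl⟩
    · rw [psi_eq_self hp hi, h.outside i hi]

/-! ### The map `psiMarked` on marked trees -/

/-- Marked labelled binary trees, on plane representatives. -/
structure IsMarkedTree (t : PlaneTree) (n : ℕ) : Prop extends t.IsLabelledTree n where
  markCount_eq : t.markCount = 1

variable {t u : PlaneTree} {n : ℕ}

theorem IsMarkedTree.rootMarked_fullLabelling (h : t.IsMarkedTree n) :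
    t.fullLabelling.rootMarked = t.rootMarked := by
  rw [← rootMarked_eraseLabels, h.unlabelled.eraseLabels_fullLabelling]

theorem IsMarkedTree.markCount_fullLabelling (h : t.IsMarkedTree n) :
    t.fullLabelling.markCount = 1 := by
  rw [← markCount_eraseLabels, h.unlabelled.eraseLabels_fullLabelling, h.markCount_eq]

theorem IsMarkedTree.isPairing (h : t.IsMarkedTree n) (hn : 1 ≤ n) :
    IsPairing t.fullLabelling.Siblings (Finset.Icc 1 (2 * n - 2)) := by
  have := (h.isPlain_unmark.fullLabelling hn).1
  rwa [fullLabelling_unmark, siblings_unmark] at this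

theorem IsMarkedTree.isMatchingOn_psi (h : t.IsMarkedTree n) (hn : 1 ≤ n) :
    IsMatchingOn (2 * n - 2) t.psi :=
  PlaneTree.isMatchingOn_psi (h.isPairing hn)

theorem IsMarkedTree.allLabelled (h : t.IsMarkedTree n) (hn : 1 ≤ n) :
    t.fullLabelling.AllLabelled := by
  have := (h.isPlain_unmark.fullLabelling hn).2.2
  rwa [fullLabelling_unmark, allLabelled_unmark] at this

theorem IsMarkedTree.internalLabels_fullLabelling (h : t.IsMarkedTree n) (hn : 1 ≤ n) :
    t.fullLabelling.internalLabels = (Finset.Ico (n + 1) (2 * n - 1)).val := by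
  have := (h.isPlain_unmark.fullLabelling hn).2.1
  rwa [fullLabelling_unmark, internalLabels_unmark] at this

theorem IsMarkedTree.leafLabels_fullLabelling (h : t.IsMarkedTree n) :
    t.fullLabelling.leafLabels = (Finset.Icc 1 n).val := by
  rw [fullLabelling_eq_labelFrom rfl, leafLabels_labelFrom, h.leafLabels_eq]

theorem nodup_Icc_add_Ico (n m : ℕ) :
    ((Finset.Icc 1 n).val + (Finset.Ico (n + 1) m).val).Nodup := by
  rw [Multiset.nodup_add]
  refine ⟨Finset.nodup _, Finset.nodup _, ?_⟩
  rw [Finset.disjoint_val, Finset.disjoint_left]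
  intro a ha hb
  rw [Finset.mem_Icc] at ha
  rw [Finset.mem_Ico] at hb
  omega

theorem IsMarkedTree.nodup_allLabels (h : t.IsMarkedTree n) (hn : 1 ≤ n) :
    t.fullLabelling.allLabels.Nodup := by
  rw [allLabels, h.leafLabels_fullLabelling, h.internalLabels_fullLabelling hn]
  exact nodup_Icc_add_Ico _ _

theorem IsMarkedTree.psiMarked_of_rootMarked (h : t.IsMarkedTree n) (hr : t.rootMarked = true) :
    t.psiMarked = joinPair t.psi (2 * n - 1) (2 * n) := by
  rw [psiMarked, if_pos hr, h.size_eq]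

/-- Whatever marked pair the definition chooses, its second label is the sibling of the first, hence
its image under `psi`; so the double update is a `splitPair`. -/
theorem IsMarkedTree.exists_psiMarked_eq (h : t.IsMarkedTree n) (hn : 1 ≤ n)
    (hr : t.rootMarked = false) :
    ∃ k ∈ Finset.Icc 1 (2 * n - 2), t.fullLabelling.IsMarkedAt k ∧
      t.psiMarked = splitPair t.psi k (2 * n - 1) (2 * n) := by
  obtain ⟨k, j, hkj⟩ := (h.allLabelled hn).exists_markedSiblings h.markCount_fullLabelling
    (h.rootMarked_fullLabelling.trans hr)
  have hex : ∃ q : ℕ × ℕ, t.fullLabelling.MarkedSiblings q.1 q.2 := ⟨(k, j), hkj⟩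
  have hq := hex.choose_spec
  obtain ⟨h1, h2⟩ := (psi_eq_of_siblings (h.isPairing hn) _ _).1 hq.siblings
  refine ⟨hex.choose.1, h1, hq.isMarkedAt, ?_⟩
  rw [psiMarked, if_neg (by simp [hr]), dif_pos hex, h.size_eq, splitPair, h2]

theorem IsMarkedTree.markAt_fullLabelling (h : t.IsMarkedTree n) (hn : 1 ≤ n) {k : ℕ}
    (hk : t.fullLabelling.IsMarkedAt k) : t.fullLabelling.markAt k = t.fullLabelling :=
  hk.markAt_eq_self h.markCount_fullLabelling (h.nodup_allLabels hn)

theorem IsMarkedTree.eq_eraseLabels_markAt (h : t.IsMarkedTree n) (hn : 1 ≤ n) {k : ℕ}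
    (hk : t.fullLabelling.IsMarkedAt k) :
    t = (t.unmark.fullLabelling.markAt k).eraseLabels := by
  rw [fullLabelling_unmark, markAt_unmark, h.markAt_fullLabelling hn hk,
    h.unlabelled.eraseLabels_fullLabelling]

theorem two_mul_eq {n : ℕ} (hn : 1 ≤ n) : 2 * n - 1 = 2 * n - 2 + 1 ∧ 2 * n = 2 * n - 2 + 2 := by
  omega

theorem IsMarkedTree.isMatchingOn_psiMarked (h : t.IsMarkedTree n) (hn : 1 ≤ n) :
    IsMatchingOn (2 * n) t.psiMarked := by
  have hπ := h.isMatchingOn_psi hn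
  obtain ⟨e1, e2⟩ := two_mul_eq hn
  rcases hr : t.rootMarked with _ | _
  · obtain ⟨k, hk, -, he⟩ := h.exists_psiMarked_eq hn hr
    have := hπ.splitPair hk
    rwa [← e1, ← e2, ← he] at this
  · have := hπ.joinPair
    rwa [← e1, ← e2, ← h.psiMarked_of_rootMarked hr] at this

/-- With the mark elsewhere, the partner of 2n is the label of the marked vertex, which is at most
2n - 2. -/
theorem IsMarkedTree.rootMarked_iff (h : t.IsMarkedTree n) (hn : 1 ≤ n) :
    t.rootMarked = true ↔ t.psiMarked (2 * n) = 2 * n - 1 := by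
  have hπ := h.isMatchingOn_psi hn
  obtain ⟨e1, e2⟩ := two_mul_eq hn
  rcases hr : t.rootMarked with _ | _
  · obtain ⟨k, hk, -, he⟩ := h.exists_psiMarked_eq hn hr
    have h1 := splitPair_last hπ hk
    rw [← e1, ← e2, ← he] at h1
    rw [Finset.mem_Icc] at hk
    rw [h1]
    simp only [Bool.false_eq_true, false_iff]
    omega
  · rw [h.psiMarked_of_rootMarked hr, joinPair_apply, if_pos rfl]
    simp

/-- The matching tells which case applies and returns `psi` and the label k of the marked vertex.
The former determines the tree without its mark, and labelling that tree locates k. -/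
theorem IsMarkedTree.equiv_of_psiMarked_eq (ht : t.IsMarkedTree n) (hu : u.IsMarkedTree n)
    (hn : 1 ≤ n) (h : t.psiMarked = u.psiMarked) : t.Equiv u := by
  have hπt := ht.isMatchingOn_psi hn
  have hπu := hu.isMatchingOn_psi hn
  obtain ⟨e1, e2⟩ := two_mul_eq hn
  have hunmark : t.psi = u.psi → t.unmark.Equiv u.unmark := fun he =>
    ht.isPlain_unmark.equiv_of_psi_eq hu.isPlain_unmark hn (by rw [psi_unmark, psi_unmark, he])
  rcases hrt : t.rootMarked with _ | _
  · have hru : u.rootMarked = false := by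
      rw [Bool.eq_false_iff, Ne, hu.rootMarked_iff hn, ← h, ← ht.rootMarked_iff hn, hrt]
      simp
    obtain ⟨k, hk, hmk, he⟩ := ht.exists_psiMarked_eq hn hrt
    obtain ⟨k', hk', hmk', he'⟩ := hu.exists_psiMarked_eq hn hru
    rw [he, he', e1, e2] at h
    simp only [Nat.add_sub_cancel] at h
    obtain ⟨hpsi, rfl⟩ := splitPair_injective hπt hπu hk hk' h
    rw [ht.eq_eraseLabels_markAt hn hmk, hu.eq_eraseLabels_markAt hn hmk']
    exact ((hunmark hpsi).fullLabelling.markAt k).eraseLabels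
  · have hru : u.rootMarked = true := by
      rw [hu.rootMarked_iff hn, ← h, ← ht.rootMarked_iff hn, hrt]
    rw [ht.psiMarked_of_rootMarked hrt, hu.psiMarked_of_rootMarked hru, e1, e2] at h
    simp only [Nat.add_sub_cancel] at h
    have := (hunmark (joinPair_injective hπt hπu h)).markRoot
    rwa [markRoot_unmark ht.markCount_eq hrt, markRoot_unmark hu.markCount_eq hru] at this

theorem exists_psiMarked_eq_joinPair {π : ℕ → ℕ} (hn : 1 ≤ n) (h : IsMatchingOn (2 * n - 2) π) :
    ∃ t : PlaneTree, t.IsMarkedTree n ∧ t.psiMarked = joinPair π (2 * n - 1) (2 * n) := by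
  obtain ⟨s, hs, hπ⟩ := exists_isPlain_psi_eq hn h
  have ht : s.markRoot.IsMarkedTree n := by
    refine ⟨⟨by rw [leafLabels_markRoot, hs.leafLabels_eq], ?_⟩, markCount_markRoot hs.markCount_eq⟩
    unfold Unlabelled
    rw [internalLabels_markRoot]
    exact hs.unlabelled
  refine ⟨_, ht, ?_⟩
  rw [ht.psiMarked_of_rootMarked (rootMarked_markRoot s), ← psi_unmark, unmark_markRoot,
    unmark_eq_self hs.markCount_eq, hπ]

theorem exists_psiMarked_eq_splitPair {π : ℕ → ℕ} {k : ℕ} (hn : 1 ≤ n)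
    (h : IsMatchingOn (2 * n - 2) π) (hk : k ∈ Finset.Icc 1 (2 * n - 2)) :
    ∃ t : PlaneTree, t.IsMarkedTree n ∧ t.psiMarked = splitPair π k (2 * n - 1) (2 * n) := by
  obtain ⟨s, hs, hπ⟩ := exists_isPlain_psi_eq hn h
  have hun := unmark_eq_self hs.markCount_eq
  have hfull : s.fullLabelling.unmark = s.fullLabelling := by rw [← fullLabelling_unmark, hun]
  have hleaf : s.fullLabelling.leafLabels = (Finset.Icc 1 n).val := by
    rw [fullLabelling_eq_labelFrom rfl, leafLabels_labelFrom, hs.leafLabels_eq]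
  have hall : s.fullLabelling.allLabels =
      (Finset.Icc 1 n).val + (Finset.Ico (n + 1) (2 * n - 1)).val := by
    rw [allLabels, hleaf, (hs.fullLabelling hn).2.1]
  set t := (s.fullLabelling.markAt k).eraseLabels with hdef
  have ht : t.IsMarkedTree n := by
    refine ⟨⟨by rw [leafLabels_eraseLabels, leafLabels_markAt, hleaf],
      unlabelled_eraseLabels _⟩, ?_⟩
    rw [markCount_eraseLabels, markCount_markAt, hall]
    refine Multiset.count_eq_one_of_mem (nodup_Icc_add_Ico _ _) ?_
    rw [Multiset.mem_add, Finset.mem_val, Finset.mem_val, Finset.mem_Icc, Finset.mem_Ico]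
    rw [Finset.mem_Icc] at hk
    omega
  have hunt : t.unmark = s := by
    rw [hdef, ← eraseLabels_unmark, unmark_markAt, hfull, hs.unlabelled.eraseLabels_fullLabelling]
  -- Both sides become the same tree when marks are removed, and also when internal labels are
  -- removed.
  have hfull' : t.fullLabelling = s.fullLabelling.markAt k := by
    refine eq_of_unmark_eq_of_eraseLabels_eq ?_ (ht.unlabelled.eraseLabels_fullLabelling)
    rw [← fullLabelling_unmark, hunt, unmark_markAt, hfull]
  -- The root receives no label in the procedure, so marking the vertex labelled k cannot mark it.
  have hr : t.rootMarked = false := by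
    rw [Finset.mem_Icc] at hk
    rw [← ht.rootMarked_fullLabelling, hfull']
    have h1 : s.fullLabelling.rootLabel = s.rootLabel := rootLabel_labelFrom _ _ _
    have h2 : s.rootLabel = none := by
      cases s with
      | leaf m a =>
        have := hs.size_eq
        rw [size_leaf, Nat.card_Icc] at this
        omega
      | node m x l r => exact (unlabelled_node.1 hs.unlabelled).1
    rw [h2] at h1
    generalize s.fullLabelling = v at h1
    cases v with
    | leaf m a => simp at h1
    | node m x l r =>
      obtain rfl : x = none := h1
      rfl
  refine ⟨t, ht, ?_⟩
  obtain ⟨k', -, hmk, he⟩ := ht.exists_psiMarked_eq hn hr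
  rw [hfull'] at hmk
  rw [he, hmk.eq_of_markAt, ← psi_unmark, hunt, hπ]

theorem exists_psiMarked_eq {ρ : ℕ → ℕ} (hn : 1 ≤ n) (h : IsMatchingOn (2 * n) ρ) :
    ∃ t : PlaneTree, t.IsMarkedTree n ∧ t.psiMarked = ρ := by
  obtain ⟨e1, e2⟩ := two_mul_eq hn
  rw [e2] at h
  by_cases h0 : ρ (2 * n - 2 + 2) = 2 * n - 2 + 1
  · obtain ⟨π, hπ, rfl⟩ := h.exists_joinPair h0
    rw [← e1, ← e2]
    exact exists_psiMarked_eq_joinPair hn hπ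
  · obtain ⟨π, k, hπ, hk, rfl⟩ := h.exists_splitPair h0
    rw [← e1, ← e2]
    exact exists_psiMarked_eq_splitPair hn hπ hk

/-- Quasi-singleness is read on the fully labelled tree, where a vertex is internal exactly when its
label exceeds n, and where the label i determines its vertex and the sibling of that vertex. -/
theorem IsMarkedTree.mem_quasiSingleLabels (h : t.IsMarkedTree n) (hn : 1 ≤ n) {i : ℕ} :
    i ∈ t.fullLabelling.quasiSingleLabels ↔
      i ∈ Finset.Icc 1 n ∧ t.psiMarked i ∈ Finset.Icc (n + 1) (2 * n - 1) := by
  have hp := h.isPairing hn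
  have hpsi := psi_eq_of_siblings hp
  have hall := h.allLabelled hn
  have hnd := h.nodup_allLabels hn
  have hint : ∀ {s s' : PlaneTree} {a : ℕ}, t.fullLabelling.Adjacent s s' → s.rootLabel = some a →
      (s.rootInternal = true ↔ n < a) := by
    intro s s' a hs ha
    obtain ⟨h1, h2⟩ := hs.rootLabel_mem ha
    rw [h.internalLabels_fullLabelling hn, Finset.mem_val, Finset.mem_Ico] at h1
    rw [h.leafLabels_fullLabelling, Finset.mem_val, Finset.mem_Icc] at h2
    rcases hi : s.rootInternal with _ | _
    · have := h2 hi
      simp only [Bool.false_eq_true, false_iff]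
      omega
    · have := h1 hi
      simp only [true_iff]
      omega
  rw [PlaneTree.mem_quasiSingleLabels]
  by_cases hi : i ∈ Finset.Icc 1 (2 * n - 2)
  swap
  · constructor
    · rintro ⟨s, s', hs, -, hsi⟩
      obtain ⟨j, hj⟩ := hs.symm.exists_rootLabel hall
      exact (hi (hp.mem (siblings_iff.2 ⟨s, s', hs, hsi, hj⟩))).elim
    · rintro ⟨h1, h2⟩
      simp only [Finset.mem_Icc] at hi h1 h2
      omega
  obtain ⟨s, s', hs, hsi, hsj⟩ := siblings_iff.1 ((hpsi i _).2 ⟨hi, rfl⟩)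
  have hpi := hp.mem_right ((hpsi i _).2 ⟨hi, rfl⟩)
  have hpii := ((hpsi _ _).1 (hp.symm ((hpsi i _).2 ⟨hi, rfl⟩))).2
  have h1 := hint hs hsi
  have h2 := hint hs.symm hsj
  have hex : (∃ s s', t.fullLabelling.Adjacent s s' ∧ quasiSingleBeside s s' = true ∧
      s.rootLabel = some i) ↔ quasiSingleBeside s s' = true := by
    constructor
    · rintro ⟨r, r', hr, hq, hri⟩
      obtain ⟨rfl, rfl⟩ := hs.eq_of_rootLabel_eq hnd hr hsi hri
      exact hq
    · exact fun hq => ⟨s, s', hs, hq, hsi⟩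
  have hq : quasiSingleBeside s s' = true ↔ ¬ s.rootInternal = true ∧ ¬ s.rootMarked = true ∧
      (s'.rootMarked = true ∨ s'.rootInternal = true) := by
    simp [quasiSingleBeside, and_assoc]
  rw [hex, hq, h1, h2]
  simp only [Finset.mem_Icc] at hi hpi ⊢
  rcases hr : t.rootMarked with _ | _
  · obtain ⟨k, hk, hmk, he⟩ := h.exists_psiMarked_eq hn hr
    have hv := h.markAt_fullLabelling hn hmk
    rw [← hv] at hs
    have h3 := hs.rootMarked_markAt
    have h4 := hs.symm.rootMarked_markAt
    rw [h3, h4, hsi, hsj, he, splitPair_apply, Option.some.injEq, Option.some.injEq]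
    have hkk := ((hpsi _ _).1 (hp.symm ((hpsi k _).2 ⟨hk, rfl⟩))).2
    have h5 : i = t.psi k ↔ t.psi i = k := by
      constructor
      · rintro rfl
        exact hkk
      · rintro rfl
        exact hpii.symm
    rw [if_neg (by omega)]
    -- If the sibling of i is the marked vertex, the partner of i is now 2n - 1, inside the range.
    -- If i itself is marked, the partner is 2n, just outside. Otherwise the partner is unchanged.
    by_cases h6 : t.psi i = k
    · have h7 : i ≠ k := by
        rintro rfl
        exact hp.ne ((hpsi i _).2 ⟨Finset.mem_Icc.2 hi, rfl⟩) h6.symm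
      rw [if_pos (h5.2 h6)]
      omega
    · rw [if_neg (fun h7 => h6 (h5.1 h7)), if_neg (by omega)]
      split <;> omega
  · have hm := h.markCount_fullLabelling
    have hrv := h.rootMarked_fullLabelling.trans hr
    have h3 : ¬ s.rootMarked = true := by
      intro h3
      have h4 := hs.markCount_le
      have h5 := one_le_markCount_of_rootMarked h3
      rw [hrv, Bool.toNat_true] at h4
      omega
    have h4 : ¬ s'.rootMarked = true := by
      intro h3
      have h4 := hs.symm.markCount_le
      have h5 := one_le_markCount_of_rootMarked h3
      rw [hrv, Bool.toNat_true] at h4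
      omega
    rw [h.psiMarked_of_rootMarked hr, joinPair_apply, if_neg (by omega), if_neg (by omega)]
    constructor
    · rintro ⟨h5, -, h6⟩
      have h7 := h6.resolve_left h4
      omega
    · intro h5
      exact ⟨by omega, h3, Or.inr (by omega)⟩

/-- The labels of the quasi-single leaves are distinct, being among the leaf labels, so their
multiset is a finite set; a pair counted on the left is determined by its smaller element i. -/
theorem IsMarkedTree.card_pairs (h : t.IsMarkedTree n) (hn : 1 ≤ n) :
    ((Finset.Icc 1 n ×ˢ Finset.Icc (n + 1) (2 * n - 1)).filter
      (fun q : ℕ × ℕ => t.psiMarked q.1 = q.2)).card = t.quasiSingleCount := by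
  have hnd : t.fullLabelling.quasiSingleLabels.Nodup :=
    Multiset.nodup_of_le (quasiSingleLabels_le _)
      (by rw [h.leafLabels_fullLabelling]; exact Finset.nodup _)
  rw [← h.unlabelled.eraseLabels_fullLabelling, quasiSingleCount_eraseLabels,
    ← card_quasiSingleLabels, h.unlabelled.eraseLabels_fullLabelling]
  change _ = (⟨_, hnd⟩ : Finset ℕ).card
  refine Finset.card_nbij' Prod.fst (fun i => (i, t.psiMarked i)) ?_ ?_ ?_ ?_
  · rintro ⟨i, j⟩ hq
    simp only [Finset.coe_filter, Finset.mem_product, Set.mem_ofPred_eq] at hq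
    obtain ⟨⟨h1, h2⟩, rfl⟩ := hq
    exact (h.mem_quasiSingleLabels hn).2 ⟨h1, h2⟩
  · intro i hi
    have := (h.mem_quasiSingleLabels hn).1 hi
    simp only [Finset.coe_filter, Finset.mem_product, Set.mem_ofPred_eq, and_true]
    exact this
  · rintro ⟨i, j⟩ hq
    simp only [Finset.coe_filter, Finset.mem_product, Set.mem_ofPred_eq] at hq
    exact Prod.ext rfl hq.2
  · intro i hi
    rfl

end PlaneTree

/-! ### The bijection from marked trees to matchings, and the theorem -/

theorem mem_markedTrees_mk {t : PlaneTree} {n k : ℕ} :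
    (Quotient.mk PlaneTree.setoid t : UnorderedTree) ∈ markedTrees n k ↔
      t.IsMarkedTree n ∧ t.quasiSingleCount = k := by
  constructor
  · rintro ⟨⟨h1, h2, h3⟩, h4⟩
    exact ⟨⟨⟨h1, h2⟩, h3⟩, h4⟩
  · rintro ⟨⟨⟨h1, h2⟩, h3⟩, h4⟩
    exact ⟨⟨h1, h2, h3⟩, h4⟩

theorem bijOn_psiMarked {n : ℕ} (k : ℕ) (hn : 1 ≤ n) :
    Set.BijOn UnorderedTree.psiMarked (markedTrees n k) (matchingsWithPairs n k) := by
  refine ⟨fun T hT => ?_, fun T hT U hU h => ?_, fun ρ hρ => ?_⟩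
  · induction T using Quotient.inductionOn with
    | h t =>
    obtain ⟨ht, hk⟩ := mem_markedTrees_mk.1 hT
    exact ⟨ht.isMatchingOn_psiMarked hn, (ht.card_pairs hn).trans hk⟩
  · induction T using Quotient.inductionOn with
    | h t =>
    induction U using Quotient.inductionOn with
    | h u =>
    exact Quotient.sound ((mem_markedTrees_mk.1 hT).1.equiv_of_psiMarked_eq
      (mem_markedTrees_mk.1 hU).1 hn h)
  · obtain ⟨h1, h2⟩ := hρ
    obtain ⟨t, ht, rfl⟩ := PlaneTree.exists_psiMarked_eq hn h1
    exact ⟨Quotient.mk PlaneTree.setoid t,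
      mem_markedTrees_mk.2 ⟨ht, (ht.card_pairs hn).symm.trans h2⟩, rfl⟩

theorem mainTheorem6 (n k : ℕ) (hn : 1 ≤ n) :
    Set.BijOn LabelledPath.toMarkedTree (positivePaths n k) (markedTrees n k) ∧
      Set.BijOn UnorderedTree.psiMarked (markedTrees n k) (matchingsWithPairs n k) :=
  ⟨bijOn_toMarkedTree n k, bijOn_psiMarked k hn⟩
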